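/- Let $X_1,X_2,\dots$ be i.i.d. real random variables whose law has a bounded density $p$ on $\mathbb R$ and whose moment generating function $\phi(t)=E e^{tX_1}$ is finite in a neighbourhood of $0$. Assume that, for some constant $c>0$ and some functions $g>0$ and $q$, $$p(x)=c\exp\bigl(-(g(x)-q(x))\bigr)\quad (x>0),$$ that $g$ is differentiable on $(0,\infty)$ with derivative $h=g'$, that $g(x)/x\to\infty$ as $x\to\infty$, and that for some $\vartheta>0$ and all large $x$, $\sup_{|v-x|<\vartheta x}|q(v)|\le 1/\sqrt{x\,h(x)}$. Put $\psi(u)=\inf\{x>0: h(x)\ge u\}$, and assume that one of the following holds. (i) For some $\beta>0$ and all large $x$, $h(x)=x^{\beta}l(x)$, where $l(x)=\exp\bigl(\int_1^x\epsilon(u)u^{-1}\,du\bigr)$ for $x\ge1$, $\epsilon$ is twice differentiable on $[1,\infty)$, $\epsilon(x)\to0$, $\limsup_{x\to\infty} x|\epsilon'(x)|<\infty$ and $\limsup_{x\to\infty} x^2|\epsilon''(x)|<\infty$. (ii) $h$ is strictly increasing on $(0,\infty)$, $\psi(x)=\exp\bigl(\int_1^x\epsilon(u)u^{-1}\,du\bigr)$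 for $x\ge1$, $\psi(x)\to\infty$, $\epsilon$ is twice differentiable on $[1,\infty)$, $\epsilon(x)\to0$, $x\epsilon'(x)/\epsilon(x)\to0$, $x^2\epsilon''(x)/\epsilon(x)\to0$, and $\liminf_{x\to\infty} x^{\eta}\epsilon(x)>0$ for some $\eta\in(0,1/4)$. Let $a_n\to\infty$, let $t_n$ be determined by $(\log\phi)'(t_n)=a_n$ (for $n$ large), and assume $$\lim_{n\to\infty}\frac{\psi(t_n)^2}{\sqrt{n\,\psi'(t_n)}}=0 .$$ Let $\pi^{a_n}(x)=e^{t_nx}p(x)/\phi(t_n)$ be the tilted density at $a_n$. Let $P_{a_n}$ be the conditional law of $(X_1,\dots,X_n)$ given $X_1+\dots+X_n=na_n$, that is, the probability measure on the hyperplane $y_1+\dots+y_n=na_n$ obtained by normalizing the restriction to it of the joint density $p(y_1)\cdots p(y_n)$. Let $(Y_1,\dots,Y_n)$ have law $P_{a_n}$. Then, for all large $n$, $P_{a_n}$ is a well-defined probability measure under which $Y_1$ has a density $p_{a_n}$; and there are measurable functions $R_n$ of $(Y_1,\dots,Y_n)$ such that, for all large $n$, $P_{a_n}$-almost surely, $$p_{a_n}(Y_1)=\pi^{a_n}(Y_1)\,(1+R_n),$$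 and, for every $\delta>0$, $$P_{a_n}\bigl(|R_n|>\delta/\sqrt n\bigr)\longrightarrow 0\qquad(n\to\infty).$$ -/

import Mathlib

open MeasureTheory ProbabilityTheory Filter Topology Set

noncomputable section

namespace LightTail

/-- `l` and `ε` are linked by the representation `l x = exp (∫_1^x ε u / u du)`, `x ≥ 1`, where
`ε` is twice differentiable on `[1, ∞)` (with derivatives `ε'`, `ε''`) and tends to `0`. -/
structure SlowRep (l ε ε' ε'' : ℝ → ℝ) : Prop where
  hasDeriv : ∀ x, 1 ≤ x → HasDerivWithinAt ε (ε' x) (Ici 1) x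
  hasDeriv' : ∀ x, 1 ≤ x → HasDerivWithinAt ε' (ε'' x) (Ici 1) x
  tendsto_zero : Tendsto ε atTop (𝓝 0)
  rep : ∀ x, 1 ≤ x → l x = Real.exp (∫ u in (1 : ℝ)..x, ε u / u)

/-- The class `R_β`: for large `x`, `h x = x ^ β * l x`, where `l` has a representation as above
with `limsup x |ε' x| < ∞` and `limsup x² |ε'' x| < ∞`. -/
def ClassRBeta (β : ℝ) (h : ℝ → ℝ) : Prop :=
  ∃ l ε ε' ε'' : ℝ → ℝ, SlowRep l ε ε' ε'' ∧
    (∀ᶠ x in atTop, h x = x ^ β * l x) ∧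
    (∃ C : ℝ, ∀ᶠ x in atTop, x * |ε' x| ≤ C) ∧
    (∃ C : ℝ, ∀ᶠ x in atTop, x ^ 2 * |ε'' x| ≤ C)

/-- The class `R̃_0`. The last clause says `liminf x ^ η * ε x > 0` for some `η ∈ (0, 1/4)`. -/
def ClassRTilde (l : ℝ → ℝ) : Prop :=
  ∃ ε ε' ε'' : ℝ → ℝ, SlowRep l ε ε' ε'' ∧
    Tendsto l atTop atTop ∧
    Tendsto (fun x => x * ε' x / ε x) atTop (𝓝 0) ∧
    Tendsto (fun x => x ^ 2 * ε'' x / ε x) atTop (𝓝 0) ∧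
    ∃ η : ℝ, 0 < η ∧ η < 1 / 4 ∧ ∃ κ : ℝ, 0 < κ ∧ ∀ᶠ x in atTop, κ ≤ x ^ η * ε x

/-- The generalized inverse `ψ u = inf {x > 0 : h x ≥ u}` of a function on the positive
half-line. -/
def genInv (h : ℝ → ℝ) (u : ℝ) : ℝ := sInf {x | 0 < x ∧ u ≤ h x}

/-- The class `R_∞`: `h` is strictly increasing and its inverse belongs to `R̃_0`. -/
def ClassRInfty (h : ℝ → ℝ) : Prop :=
  StrictMonoOn h (Ioi 0) ∧ ClassRTilde (genInv h)

/-- The class `R`, the union of all `R_β`, `β > 0`, and of `R_∞`. -/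
def ClassR (h : ℝ → ℝ) : Prop :=
  (∃ β : ℝ, 0 < β ∧ ClassRBeta β h) ∨ ClassRInfty h

/-- The law on `ℝ` with density `p`. -/
def law (p : ℝ → ℝ) : Measure ℝ := volume.withDensity (fun x => ENNReal.ofReal (p x))

/-- `m t = (log φ)' t`, where `φ t = E exp (t X)` and `X` has density `p`. -/
def tiltMean (p : ℝ → ℝ) (t : ℝ) : ℝ := deriv (cgf id (law p)) t

/-- The parameter `t` determined by `m t = a`. -/
def tiltParam (p : ℝ → ℝ) (a : ℝ) : ℝ := Classical.epsilon (fun t => tiltMean p t = a)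

/-- The tilted density `π^a x = exp (t x) / φ t * p x` at the point `a`, where `m t = a`. -/
def tiltedDensity (p : ℝ → ℝ) (a x : ℝ) : ℝ :=
  Real.exp (tiltParam p a * x) / mgf id (law p) (tiltParam p a) * p x

/-- The vector of `ℝ^n` whose first `n - 1` coordinates are `y` and whose coordinates sum
to `s`. -/
def completeToSum (n : ℕ) (s : ℝ) (y : Fin (n - 1) → ℝ) : Fin n → ℝ :=
  fun i => if hi : i.val < n - 1 then y ⟨i.val, hi⟩ else s - ∑ j, y j

theorem measurable_completeToSum (n : ℕ) (s : ℝ) : Measurable (completeToSum n s) := by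
  refine measurable_pi_lambda _ fun i => ?_
  unfold completeToSum
  by_cases hi : i.val < n - 1
  · simp only [hi, dite_true]
    exact measurable_pi_apply _
  · simp only [hi, dite_false]
    fun_prop

/-- The restriction of the joint density `p x₁ ⋯ p xₙ` to the hyperplane `x₁ + ⋯ + xₙ = s`,
parametrized by the first `n - 1` coordinates, as a measure on `ℝ^n`. Its total mass is the
density at `s` of the sum of `n` independent variables with density `p`. -/
def sliceMeasure (p : ℝ → ℝ) (n : ℕ) (s : ℝ) : Measure (Fin n → ℝ) :=
  ((volume : Measure (Fin (n - 1) → ℝ)).withDensity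
    (fun y => ∏ i, ENNReal.ofReal (p (completeToSum n s y i)))).map (completeToSum n s)

/-- The conditional law of `(X₁, …, Xₙ)`, independent with density `p`, given that
`X₁ + ⋯ + Xₙ = n * α`. -/
def condLaw (p : ℝ → ℝ) (n : ℕ) (α : ℝ) : Measure (Fin n → ℝ) :=
  (sliceMeasure p n (n * α) univ)⁻¹ • sliceMeasure p n (n * α)

/-- The law of the coordinate `Y_i` when `(Y₁, …, Yₙ)` has law `condLaw p n α`. -/
def condMargin (p : ℝ → ℝ) (n : ℕ) (α : ℝ) (i : Fin n) : Measure ℝ :=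
  (condLaw p n α).map (fun y => y i)

/-- The density of a margin of the conditional law. -/
def condDensity (p : ℝ → ℝ) (n : ℕ) (α : ℝ) (i : Fin n) (x : ℝ) : ℝ :=
  ((condMargin p n α i).rnDeriv volume x).toReal

end LightTail

end

/-!
Write `f n` for the tilted density `π^{a n}`, centred and standardized by a scale `σ`. The
conditional law is unchanged by tilting, so `Y₁`, standardized, has density `f n v` times
`f n ^{*(n-1)} (-v) / f n ^{*n} 0` (`sliceMass_eq_convPow`, `condMargin_eq`), and the
relative error `R n` is this ratio of two consecutive convolution powers, minus `1`. Two facts are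
needed: the ratio is `1 + o(1 / √n)` uniformly for bounded `v`, and the standardized `Y₁` is tight.

*Laplace's method.* Around `b`, where `h b` is approximately `t`, the exponent `t x - g x` is
asymptotically quadratic on the scale `σ`, which for both classes of `h` follows from regular
variation: the derivative of `h`, respectively of the inverse `ψ`, is asymptotically constant on
that scale (`ClassRBeta.exists_laplaceScale`, `ClassRInfty.exists_laplaceScale`). Since `g` is
eventually convex, the local expansion forces an exponential bound on the whole line, whence
`TailDensity.exists_gaussianLimit`: the rescaled tilted densities converge to the Gaussian density
`exp (-π v²)` under a common exponential bound. Normalizing and centring preserves this, and makes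
the Fourier transforms of the `f n` behave like that of a Gaussian density
(`GaussianLimit.localLimitArray`). As the tilted mean is `b + o(σ)`, the parameter `t n` tends to
infinity together with the level `a n` (`tendsto_tiltParam`).

*Local limit theorem.* Fourier inversion holds at every point for convolution powers of a bounded
density (`convPow_eq_integral`). It gives `√n * f n ^{*n} 0 → 1` (`tendsto_sqrt_mul_convPow`), and
for the difference of consecutive powers the integrand `(exp (2 π i w ξ) - 𝓕 f ξ) (𝓕 f ξ) ^ n`,
whose first factor is `2 π i w ξ + O(ξ²)`. On the scale `ξ = u / √n` the linear term converges,
after multiplication by `n`, to a first moment of a Gaussian function, which vanishes, and the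
quadratic one is `O(n ^ (-3/2))`. Hence the difference is `o(1 / n)`
(`eventually_abs_convPow_sub_le`), and the ratio is `1 + o(1 / √n)`.

*Tightness.* The ratio is bounded on the whole line (`exists_densityRatio_le`), so Markov's
inequality for `f n` bounds the tail of the standardized `Y₁` (`condMargin_tail_le`). Both facts
are combined in `exists_relative_error`.
-/

open scoped FourierTransform ComplexConjugate

namespace LightTail

/-! ### Fourier transforms on `L¹ ∩ L²` and convolution powers -/

/-- On `L¹ ∩ L²` the Fourier transform of `L²` is given by the Fourier integral. -/
theorem fourier_toLp_ae_eq {f : ℝ → ℂ} (h1 : Integrable f) (h2 : MemLp f 2) :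
    ((𝓕 (h2.toLp f) : Lp ℂ 2 (volume : Measure ℝ)) : ℝ → ℂ) =ᵐ[volume] 𝓕 f := by
  have hcont : Continuous (𝓕 f) := VectorFourier.fourierIntegral_continuous
    Real.continuous_fourierChar (by exact continuous_inner) h1
  -- Both sides are locally integrable, so it suffices to test against smooth compactly supported
  -- functions, where the transform is moved to the test function.
  refine ae_eq_of_integral_contDiff_smul_eq
    ((Lp.memLp _).locallyIntegrable (by norm_num)) hcont.locallyIntegrable fun g hg hgc => ?_
  have hg' : ContDiff ℝ ((⊤ : ℕ∞) : WithTop ℕ∞) (fun x => (g x : ℂ)) :=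
    Complex.ofRealCLM.contDiff.comp hg
  have hgc' : HasCompactSupport (fun x => (g x : ℂ)) :=
    hgc.comp_left (g := Complex.ofReal) (by simp)
  let φ : SchwartzMap ℝ ℂ := hgc'.toSchwartzMap hg'
  have hφ : ∀ x, φ x = (g x : ℂ) := fun x => rfl
  have key := congrArg (fun T => T φ) (Lp.fourier_toTemperedDistribution_eq (h2.toLp f))
  simp only [TemperedDistribution.fourier_apply, Lp.toTemperedDistribution_apply] at key
  have e1 : ∫ x, (𝓕 φ) x • (h2.toLp f) x = ∫ x, (𝓕 φ) x • f x := by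
    refine integral_congr_ae ?_
    filter_upwards [h2.coeFn_toLp] with x hx
    rw [hx]
  have e2 : ∫ x, (𝓕 φ) x • f x = ∫ x, φ x • 𝓕 f x := by
    rw [SchwartzMap.fourier_coe]
    have := VectorFourier.integral_fourierIntegral_smul_eq_flip (μ := (volume : Measure ℝ))
      (ν := (volume : Measure ℝ)) (L := innerₗ ℝ) Real.continuous_fourierChar
      (by exact continuous_inner) φ.integrable h1
    rw [flip_innerₗ] at this
    exact this
  rw [e1, e2] at key
  simp only [hφ] at key
  calc _ = ∫ x, (g x : ℂ) • (𝓕 (h2.toLp f) : Lp ℂ 2 (volume : Measure ℝ)) x := by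
        simp [Complex.real_smul]
    _ = ∫ x, (g x : ℂ) • 𝓕 f x := key.symm
    _ = _ := by simp [Complex.real_smul]

theorem memLp_fourier {f : ℝ → ℂ} (h1 : Integrable f) (h2 : MemLp f 2) : MemLp (𝓕 f) 2 :=
  (memLp_congr_ae (fourier_toLp_ae_eq h1 h2)).1 (Lp.memLp _)

/-- Parseval's identity on `L¹ ∩ L²`. -/
theorem integral_inner_fourier {f g : ℝ → ℂ} (hf : Integrable f) (hf2 : MemLp f 2)
    (hg : Integrable g) (hg2 : MemLp g 2) :
    ∫ x, conj (𝓕 f x) * 𝓕 g x = ∫ x, conj (f x) * g x := by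
  have key := Lp.inner_fourier_eq (hf2.toLp f) (hg2.toLp g)
  rw [L2.inner_def, L2.inner_def] at key
  calc _ = ∫ a, inner ℂ ((𝓕 (hf2.toLp f) : Lp ℂ 2 (volume : Measure ℝ)) a)
          ((𝓕 (hg2.toLp g) : Lp ℂ 2 (volume : Measure ℝ)) a) := by
        refine integral_congr_ae ?_
        filter_upwards [fourier_toLp_ae_eq hf hf2, fourier_toLp_ae_eq hg hg2] with x h1 h2
        rw [h1, h2, RCLike.inner_apply, mul_comm]
    _ = _ := key
    _ = _ := by
        refine integral_congr_ae ?_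
        filter_upwards [hf2.coeFn_toLp, hg2.coeFn_toLp] with x h1 h2
        rw [h1, h2, RCLike.inner_apply, mul_comm]

/-- `convPow f k` is the `(k + 1)`-fold convolution power of `f`, defined at every point by the
convolution integral. -/
noncomputable def convPow (f : ℝ → ℝ) : ℕ → ℝ → ℝ
  | 0 => f
  | k + 1 => fun w => ∫ v, f v * convPow f k (w - v)

/-- The Fourier transform of a real function. -/
noncomputable def fourierReal (f : ℝ → ℝ) (ξ : ℝ) : ℂ := 𝓕 (fun v => (f v : ℂ)) ξ

theorem fourierReal_eq (f : ℝ → ℝ) (ξ : ℝ) :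
    fourierReal f ξ = ∫ v, Complex.exp ((-2 * Real.pi * v * ξ : ℝ) * Complex.I) * f v := by
  rw [fourierReal, Real.fourier_real_eq_integral_exp_smul]
  simp [smul_eq_mul]

theorem norm_fourierReal_le (f : ℝ → ℝ) (ξ : ℝ) : ‖fourierReal f ξ‖ ≤ ∫ v, |f v| := by
  rw [fourierReal_eq]
  refine (norm_integral_le_integral_norm _).trans (le_of_eq ?_)
  congr 1 with v
  rw [norm_mul, Complex.norm_exp_ofReal_mul_I, one_mul, Complex.norm_real, Real.norm_eq_abs]

theorem continuous_fourierReal {f : ℝ → ℝ} (hf : Integrable f) : Continuous (fourierReal f) :=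
  VectorFourier.fourierIntegral_continuous Real.continuous_fourierChar
    (by exact continuous_inner) hf.ofReal

theorem conj_fourierReal (f : ℝ → ℝ) (ξ : ℝ) : conj (fourierReal f ξ) = fourierReal f (-ξ) := by
  rw [fourierReal_eq, fourierReal_eq, ← integral_conj]
  congr 1 with v
  rw [map_mul, ← Complex.exp_conj, map_mul, Complex.conj_ofReal, Complex.conj_ofReal,
    Complex.conj_I]
  congr 2
  push_cast
  ring

theorem memLp_two_of_bounded {f : ℝ → ℝ} (hf : Integrable f) {C : ℝ} (hC : ∀ v, |f v| ≤ C) :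
    MemLp (fun v => (f v : ℂ)) 2 := by
  refine (memLp_two_iff_integrable_sq_norm hf.ofReal.1).2 ?_
  refine (hf.norm.const_mul C).mono' (by fun_prop) (ae_of_all _ fun v => ?_)
  simp only [Complex.norm_real, norm_pow, Real.norm_eq_abs]
  rw [sq, abs_abs]
  exact mul_le_mul_of_nonneg_right (hC v) (abs_nonneg _)

theorem integrable_norm_sq_fourierReal {f : ℝ → ℝ} (hf : Integrable f) {C : ℝ}
    (hC : ∀ v, |f v| ≤ C) : Integrable (fun ξ => ‖fourierReal f ξ‖ ^ 2) :=
  (memLp_two_iff_integrable_sq_norm (continuous_fourierReal hf).aestronglyMeasurable).1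
    (memLp_fourier hf.ofReal (memLp_two_of_bounded hf hC))

theorem integral_norm_sq_fourierReal {f : ℝ → ℝ} (hf : Integrable f) {C : ℝ}
    (hC : ∀ v, |f v| ≤ C) : ∫ ξ, ‖fourierReal f ξ‖ ^ 2 = ∫ v, f v ^ 2 := by
  have h2 := memLp_two_of_bounded hf hC
  have key := integral_inner_fourier hf.ofReal h2 hf.ofReal h2
  have e : ∀ z : ℂ, conj z * z = ((‖z‖ ^ 2 : ℝ) : ℂ) := fun z => by
    rw [Complex.conj_mul']; push_cast; rfl
  simp only [e, integral_complex_ofReal] at key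
  have := Complex.ofReal_injective key
  simpa [fourierReal] using this

theorem norm_fourierReal_pow_le {f : ℝ → ℝ} {I : ℝ} (hI : ∫ v, |f v| ≤ I) (k : ℕ) (ξ : ℝ) :
    ‖fourierReal f ξ‖ ^ (k + 2) ≤ I ^ k * ‖fourierReal f ξ‖ ^ 2 := by
  rw [pow_add]
  gcongr
  exact (norm_fourierReal_le f ξ).trans hI

theorem integrable_fourierReal_pow {f : ℝ → ℝ} (hf : Integrable f) {C : ℝ}
    (hC : ∀ v, |f v| ≤ C) (k : ℕ) : Integrable (fun ξ => fourierReal f ξ ^ (k + 2)) := by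
  refine ((integrable_norm_sq_fourierReal hf hC).const_mul ((∫ v, |f v|) ^ k)).mono'
    ((continuous_fourierReal hf).pow _).aestronglyMeasurable (ae_of_all _ fun ξ => ?_)
  rw [norm_pow]
  exact norm_fourierReal_pow_le le_rfl k ξ

/-- **Fourier inversion** for convolution powers, at every point: from the second convolution
power on, the transform is integrable, and the first step is Parseval's identity for `f` and the
reflected translate of `f`, so no continuity of `f` is needed. -/
theorem convPow_eq_integral {f : ℝ → ℝ} (hf : Integrable f) {C : ℝ} (hC : ∀ v, |f v| ≤ C)
    (k : ℕ) (w : ℝ) :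
    (convPow f (k + 1) w : ℂ) = ∫ ξ, Complex.exp ((2 * Real.pi * w * ξ : ℝ) * Complex.I) *
      fourierReal f ξ ^ (k + 2) := by
  have hfc : Integrable (fun v => (f v : ℂ)) := hf.ofReal
  induction k generalizing w with
  | zero =>
    have h2 := memLp_two_of_bounded hf hC
    have hg := hf.comp_sub_left w
    have hgc : Integrable (fun v => (f (w - v) : ℂ)) := hg.ofReal
    have hg2 := memLp_two_of_bounded hg (fun v => hC (w - v))
    have key := integral_inner_fourier hfc h2 hgc hg2
    have e1 : ∀ ξ, 𝓕 (fun v => ((f (w - v) : ℝ) : ℂ)) ξ =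
        Complex.exp ((-2 * Real.pi * w * ξ : ℝ) * Complex.I) * fourierReal f (-ξ) := by
      intro ξ
      rw [Real.fourier_real_eq_integral_exp_smul, fourierReal_eq, ← integral_const_mul,
        ← integral_sub_left_eq_self _ volume w]
      congr 1 with v
      rw [smul_eq_mul, ← mul_assoc, ← Complex.exp_add]
      congr 2
      · push_cast; ring
      · simp
    have e2 : ∫ ξ, fourierReal f (-ξ) * (Complex.exp ((-2 * Real.pi * w * ξ : ℝ) * Complex.I) *
        fourierReal f (-ξ)) = ∫ v, ((f v * f (w - v) : ℝ) : ℂ) := by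
      refine Eq.trans ?_ (key.trans ?_)
      · congr 1 with ξ
        rw [← e1, ← conj_fourierReal]
        rfl
      · congr 1 with v
        rw [Complex.conj_ofReal, Complex.ofReal_mul]
    simp only [convPow]
    rw [← integral_complex_ofReal, ← e2, ← integral_neg_eq_self]
    congr 1 with ξ
    push_cast
    simp only [neg_neg]
    rw [show -2 * (Real.pi : ℂ) * w * -ξ * Complex.I = 2 * Real.pi * w * ξ * Complex.I by ring]
    ring
  | succ k ih =>
    have hint := integrable_fourierReal_pow hf hC k
    have step : (convPow f (k + 1 + 1) w : ℂ) = ∫ v, ∫ ξ, (f v : ℂ) *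
        (Complex.exp ((2 * Real.pi * (w - v) * ξ : ℝ) * Complex.I) *
          fourierReal f ξ ^ (k + 2)) := by
      rw [convPow, ← integral_complex_ofReal]
      congr 1 with v
      rw [Complex.ofReal_mul, ih, ← integral_const_mul]
    rw [step, integral_integral_swap]
    · congr 1 with ξ
      rw [pow_succ _ (k + 2), fourierReal_eq f ξ, ← integral_const_mul, ← integral_const_mul,
        ← fourierReal_eq f ξ]
      congr 1 with v
      rw [show ((2 * Real.pi * (w - v) * ξ : ℝ) : ℂ) * Complex.I =
        (2 * Real.pi * w * ξ : ℝ) * Complex.I + (-2 * Real.pi * v * ξ : ℝ) * Complex.I by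
          push_cast; ring, Complex.exp_add]
      ring
    · refine (hfc.mul_prod hint).bdd_mul (c := 1) (f := fun z : ℝ × ℝ =>
        Complex.exp ((2 * Real.pi * (w - z.1) * z.2 : ℝ) * Complex.I)) ?_ ?_ |>.congr ?_
      · exact Continuous.aestronglyMeasurable (by fun_prop)
      · exact ae_of_all _ fun z => by rw [Complex.norm_exp_ofReal_mul_I]
      · refine ae_of_all _ fun z => ?_
        simp only [Function.uncurry]
        ring

/-! ### Centred densities and Taylor bounds for their transforms -/

theorem norm_exp_mul_I_sub_one_sub_le (y : ℝ) :
    ‖Complex.exp (y * Complex.I) - 1 - y * Complex.I‖ ≤ 3 * y ^ 2 := by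
  have hy : ‖(y : ℂ) * Complex.I‖ = |y| := by simp
  rcases le_total |y| 1 with h | h
  · have := Complex.norm_exp_sub_one_sub_id_le (x := y * Complex.I) (by rwa [hy])
    rw [hy, sq_abs] at this
    nlinarith [sq_nonneg y]
  · have h1 : ‖Complex.exp (y * Complex.I) - 1 - y * Complex.I‖ ≤ 1 + 1 + |y| := by
      refine (norm_sub_le _ _).trans (add_le_add ((norm_sub_le _ _).trans ?_) hy.le)
      rw [Complex.norm_exp_ofReal_mul_I, norm_one]
    nlinarith [sq_abs y]

theorem norm_exp_mul_I_taylor_two_le (y : ℝ) :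
    ‖Complex.exp (y * Complex.I) - 1 - y * Complex.I + y ^ 2 / 2‖ ≤ 4 * |y| ^ 3 := by
  have hy : ‖(y : ℂ) * Complex.I‖ = |y| := by simp
  rcases le_total |y| 1 with h | h
  · have := Complex.norm_exp_sub_sum_le_norm_mul_exp (y * Complex.I) 3
    rw [hy] at this
    simp only [Finset.sum_range_succ, Finset.sum_range_zero] at this
    have e : Complex.exp (y * Complex.I) - 1 - y * Complex.I + y ^ 2 / 2 =
        Complex.exp (y * Complex.I) - (0 + (y * Complex.I) ^ 0 / (Nat.factorial 0 : ℂ) +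
          (y * Complex.I) ^ 1 / (Nat.factorial 1 : ℂ) +
          (y * Complex.I) ^ 2 / (Nat.factorial 2 : ℂ)) := by
      simp [mul_pow, Nat.factorial]
      ring
    rw [e]
    refine this.trans ?_
    have he : Real.exp |y| ≤ 4 := by
      have := Real.exp_le_exp.2 h
      have := Real.exp_one_lt_d9
      linarith
    nlinarith [pow_nonneg (abs_nonneg y) 3]
  · have h1 : ‖Complex.exp (y * Complex.I) - 1 - y * Complex.I + y ^ 2 / 2‖ ≤
        1 + 1 + |y| + |y| ^ 2 / 2 := by
      refine (norm_add_le _ _).trans (add_le_add ((norm_sub_le _ _).trans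
        (add_le_add ((norm_sub_le _ _).trans ?_) hy.le)) ?_)
      · rw [Complex.norm_exp_ofReal_mul_I, norm_one]
      · simp
    have h2 : |y| ≤ |y| ^ 3 := le_self_pow₀ h (by norm_num)
    have h3 : |y| ^ 2 ≤ |y| ^ 3 := pow_le_pow_right₀ h (by norm_num)
    linarith

theorem integrable_abs_pow_mul_exp_neg_abs (k : ℕ) :
    Integrable (fun v : ℝ => |v| ^ k * Real.exp (-|v|)) := by
  have h : IntegrableOn (fun v : ℝ => |v| ^ k * Real.exp (-|v|)) (Ioi 0) := by
    have := Real.GammaIntegral_convergent (s := (k : ℝ) + 1) (by positivity)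
    refine this.congr_fun (fun v hv => ?_) measurableSet_Ioi
    simp only [add_sub_cancel_right, Real.rpow_natCast]
    rw [abs_of_pos (mem_Ioi.1 hv), mul_comm]
  rw [← integrableOn_univ, ← Iic_union_Ioi (a := (0 : ℝ)), integrableOn_union]
  refine ⟨?_, h⟩
  rw [integrableOn_Iic_iff_integrableOn_Iio]
  have h' : IntegrableOn (fun v : ℝ => |v| ^ k * Real.exp (-|v|)) (Ioi (-0)) := by
    rwa [neg_zero]
  refine h'.comp_neg_Iio.congr_fun (fun v _ => ?_) measurableSet_Iio
  simp only [abs_neg]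

/-- A centred probability density with the exponential bound `C * exp (-|v|)`. -/
structure CenteredDensity (C : ℝ) (f : ℝ → ℝ) : Prop where
  measurable : Measurable f
  nonneg : ∀ v, 0 ≤ f v
  le_exp : ∀ v, f v ≤ C * Real.exp (-|v|)
  integral_eq_one : ∫ v, f v = 1
  integral_mul_eq_zero : ∫ v, v * f v = 0

namespace CenteredDensity

variable {C : ℝ} {f : ℝ → ℝ}

theorem const_nonneg (h : CenteredDensity C f) : 0 ≤ C := by
  simpa using (h.nonneg 0).trans (h.le_exp 0)

theorem integrable_abs_pow_mul (h : CenteredDensity C f) (k : ℕ) :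
    Integrable (fun v => |v| ^ k * f v) := by
  refine ((integrable_abs_pow_mul_exp_neg_abs k).const_mul C).mono'
    ((by fun_prop : Measurable fun v : ℝ => |v| ^ k).mul h.measurable).aestronglyMeasurable
    (ae_of_all _ fun v => ?_)
  rw [Real.norm_eq_abs, abs_of_nonneg (mul_nonneg (by positivity) (h.nonneg v))]
  calc |v| ^ k * f v ≤ |v| ^ k * (C * Real.exp (-|v|)) := by gcongr; exact h.le_exp v
    _ = _ := by ring

theorem integral_abs_pow_mul_le (h : CenteredDensity C f) (k : ℕ) :
    ∫ v, |v| ^ k * f v ≤ C * ∫ v : ℝ, |v| ^ k * Real.exp (-|v|) := by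
  rw [← integral_const_mul]
  refine integral_mono (h.integrable_abs_pow_mul k)
    ((integrable_abs_pow_mul_exp_neg_abs k).const_mul C) fun v => ?_
  calc |v| ^ k * f v ≤ |v| ^ k * (C * Real.exp (-|v|)) := by gcongr; exact h.le_exp v
    _ = _ := by ring

theorem integrable (h : CenteredDensity C f) : Integrable f := by
  simpa using h.integrable_abs_pow_mul 0

theorem integrable_mul (h : CenteredDensity C f) : Integrable (fun v => v * f v) := by
  refine (h.integrable_abs_pow_mul 1).mono (measurable_id.mul h.measurable).aestronglyMeasurable
    (ae_of_all _ fun v => ?_)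
  simp

theorem integrable_sq_mul (h : CenteredDensity C f) : Integrable (fun v => v ^ 2 * f v) := by
  simpa using h.integrable_abs_pow_mul 2

theorem abs_le (h : CenteredDensity C f) (v : ℝ) : |f v| ≤ C := by
  rw [abs_of_nonneg (h.nonneg v)]
  refine (h.le_exp v).trans (mul_le_of_le_one_right h.const_nonneg ?_)
  simp

theorem integral_abs (h : CenteredDensity C f) : ∫ v, |f v| = 1 := by
  simp_rw [abs_of_nonneg (h.nonneg _)]
  exact h.integral_eq_one

theorem norm_fourierReal_le_one (h : CenteredDensity C f) (ξ : ℝ) : ‖fourierReal f ξ‖ ≤ 1 :=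
  (norm_fourierReal_le f ξ).trans_eq h.integral_abs

theorem integral_norm_sq_le (h : CenteredDensity C f) :
    ∫ ξ, ‖fourierReal f ξ‖ ^ 2 ≤ C := by
  rw [integral_norm_sq_fourierReal h.integrable h.abs_le]
  calc ∫ v, f v ^ 2 ≤ ∫ v, C * f v := by
        refine integral_mono_of_nonneg (ae_of_all _ fun v => sq_nonneg _)
          (h.integrable.const_mul C) (ae_of_all _ fun v => ?_)
        simp only [sq]
        exact mul_le_mul_of_nonneg_right ((le_abs_self _).trans (h.abs_le v)) (h.nonneg v)
    _ = C := by rw [integral_const_mul, h.integral_eq_one, mul_one]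

theorem integrable_exp_mul (h : CenteredDensity C f) (ξ : ℝ) :
    Integrable (fun v => Complex.exp ((-2 * Real.pi * v * ξ : ℝ) * Complex.I) * f v) :=
  h.integrable.ofReal.bdd_mul (c := 1) (Continuous.aestronglyMeasurable (by fun_prop))
    (ae_of_all _ fun v => by rw [Complex.norm_exp_ofReal_mul_I])

/-- First-order Taylor bound for the Fourier transform of a centred density. -/
theorem norm_fourierReal_sub_one_le (h : CenteredDensity C f) (ξ : ℝ) :
    ‖fourierReal f ξ - 1‖ ≤
      12 * Real.pi ^ 2 * (C * ∫ v : ℝ, |v| ^ 2 * Real.exp (-|v|)) * ξ ^ 2 := by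
  have i1 : Integrable (fun v => (f v : ℂ)) := h.integrable.ofReal
  have i2 : Integrable (fun v => ((v * f v : ℝ) : ℂ)) := h.integrable_mul.ofReal
  have e : fourierReal f ξ - 1 = ∫ v, (Complex.exp ((-2 * Real.pi * v * ξ : ℝ) * Complex.I) - 1
      - (-2 * Real.pi * v * ξ : ℝ) * Complex.I) * f v := by
    have e1 : ∀ v, (Complex.exp ((-2 * Real.pi * v * ξ : ℝ) * Complex.I) - 1
      - (-2 * Real.pi * v * ξ : ℝ) * Complex.I) * f v =
      Complex.exp ((-2 * Real.pi * v * ξ : ℝ) * Complex.I) * f v - f v -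
        (-2 * Real.pi * ξ * Complex.I) * (v * f v : ℝ) := fun v => by push_cast; ring
    have j1 : Integrable (fun v =>
        Complex.exp ((-2 * Real.pi * v * ξ : ℝ) * Complex.I) * f v - f v) :=
      (h.integrable_exp_mul ξ).sub i1
    simp_rw [e1]
    rw [integral_sub j1 (i2.const_mul _),
      integral_sub (h.integrable_exp_mul ξ) i1, integral_const_mul, integral_complex_ofReal,
      integral_complex_ofReal, h.integral_eq_one, h.integral_mul_eq_zero, ← fourierReal_eq]
    simp
  rw [e]
  calc _ ≤ ∫ v, 12 * Real.pi ^ 2 * ξ ^ 2 * (|v| ^ 2 * f v) := by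
        refine norm_integral_le_of_norm_le ((h.integrable_abs_pow_mul 2).const_mul _)
          (ae_of_all _ fun v => ?_)
        rw [norm_mul, Complex.norm_real, Real.norm_eq_abs, abs_of_nonneg (h.nonneg v), ← mul_assoc]
        refine mul_le_mul_of_nonneg_right ?_ (h.nonneg v)
        refine (norm_exp_mul_I_sub_one_sub_le _).trans (le_of_eq ?_)
        rw [sq_abs]; ring
    _ = 12 * Real.pi ^ 2 * ξ ^ 2 * ∫ v, |v| ^ 2 * f v := integral_const_mul _ _
    _ ≤ 12 * Real.pi ^ 2 * ξ ^ 2 * (C * ∫ v : ℝ, |v| ^ 2 * Real.exp (-|v|)) := by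
        gcongr; exact h.integral_abs_pow_mul_le 2
    _ = _ := by ring

/-- Second-order Taylor bound for the Fourier transform of a centred density. -/
theorem norm_fourierReal_taylor_two_le (h : CenteredDensity C f) (ξ : ℝ) :
    ‖fourierReal f ξ - (1 - 2 * Real.pi ^ 2 * (∫ v, v ^ 2 * f v) * ξ ^ 2 : ℝ)‖ ≤
      32 * Real.pi ^ 3 * (C * ∫ v : ℝ, |v| ^ 3 * Real.exp (-|v|)) * |ξ| ^ 3 := by
  have i1 : Integrable (fun v => (f v : ℂ)) := h.integrable.ofReal
  have i2 : Integrable (fun v => ((v * f v : ℝ) : ℂ)) := h.integrable_mul.ofReal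
  have i3 : Integrable (fun v => ((v ^ 2 * f v : ℝ) : ℂ)) := h.integrable_sq_mul.ofReal
  have e : fourierReal f ξ - (1 - 2 * Real.pi ^ 2 * (∫ v, v ^ 2 * f v) * ξ ^ 2 : ℝ) =
      ∫ v, (Complex.exp ((-2 * Real.pi * v * ξ : ℝ) * Complex.I) - 1
      - (-2 * Real.pi * v * ξ : ℝ) * Complex.I + (-2 * Real.pi * v * ξ : ℝ) ^ 2 / 2) * f v := by
    have e1 : ∀ v, (Complex.exp ((-2 * Real.pi * v * ξ : ℝ) * Complex.I) - 1
      - (-2 * Real.pi * v * ξ : ℝ) * Complex.I + (-2 * Real.pi * v * ξ : ℝ) ^ 2 / 2) * f v =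
      Complex.exp ((-2 * Real.pi * v * ξ : ℝ) * Complex.I) * f v - f v -
        (-2 * Real.pi * ξ * Complex.I) * (v * f v : ℝ) +
        (2 * Real.pi ^ 2 * ξ ^ 2) * (v ^ 2 * f v : ℝ) := fun v => by push_cast; ring
    have j1 : Integrable (fun v =>
        Complex.exp ((-2 * Real.pi * v * ξ : ℝ) * Complex.I) * f v - f v) :=
      (h.integrable_exp_mul ξ).sub i1
    have j2 : Integrable (fun v =>
        Complex.exp ((-2 * Real.pi * v * ξ : ℝ) * Complex.I) * f v - f v -
          (-2 * Real.pi * ξ * Complex.I) * (v * f v : ℝ)) := j1.sub (i2.const_mul _)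
    simp_rw [e1]
    rw [integral_add j2 (i3.const_mul _), integral_sub j1 (i2.const_mul _),
      integral_sub (h.integrable_exp_mul ξ) i1, integral_const_mul, integral_const_mul,
      integral_complex_ofReal, integral_complex_ofReal, integral_complex_ofReal,
      h.integral_eq_one, h.integral_mul_eq_zero, ← fourierReal_eq]
    push_cast
    ring
  rw [e]
  calc _ ≤ ∫ v, 32 * Real.pi ^ 3 * |ξ| ^ 3 * (|v| ^ 3 * f v) := by
        refine norm_integral_le_of_norm_le ((h.integrable_abs_pow_mul 3).const_mul _)
          (ae_of_all _ fun v => ?_)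
        rw [norm_mul, Complex.norm_real, Real.norm_eq_abs, abs_of_nonneg (h.nonneg v), ← mul_assoc]
        refine mul_le_mul_of_nonneg_right ?_ (h.nonneg v)
        refine (norm_exp_mul_I_taylor_two_le _).trans (le_of_eq ?_)
        rw [abs_mul, abs_mul, abs_mul, abs_of_pos Real.pi_pos]
        norm_num
        ring
    _ = 32 * Real.pi ^ 3 * |ξ| ^ 3 * ∫ v, |v| ^ 3 * f v := integral_const_mul _ _
    _ ≤ 32 * Real.pi ^ 3 * |ξ| ^ 3 * (C * ∫ v : ℝ, |v| ^ 3 * Real.exp (-|v|)) := by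
        gcongr; exact h.integral_abs_pow_mul_le 3
    _ = _ := by ring

end CenteredDensity

/-- Near the origin the Fourier transforms of centred densities with a common exponential bound
and variance bounded below have a common Gaussian bound. -/
theorem exists_norm_fourierReal_le_exp (C : ℝ) : ∃ δ : ℝ, 0 < δ ∧ ∀ f, CenteredDensity C f →
    1 / (4 * Real.pi) ≤ ∫ v, v ^ 2 * f v → ∫ v, v ^ 2 * f v ≤ 1 → ∀ ξ, |ξ| ≤ δ →
      ‖fourierReal f ξ‖ ≤ Real.exp (-(ξ ^ 2 / 2)) := by
  set B := 32 * Real.pi ^ 3 * (C * ∫ v : ℝ, |v| ^ 3 * Real.exp (-|v|)) with hB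
  -- The first bound on `δ` makes the quadratic Taylor polynomial nonnegative, the second one makes
  -- the cubic remainder at most half of `ξ ^ 2`.
  refine ⟨min (1 / 5) (1 / (2 * (|B| + 1))), by positivity, fun f hf hs1 hs2 ξ hξ => ?_⟩
  set s := ∫ v, v ^ 2 * f v
  have h1 : |ξ| ≤ 1 / 5 := hξ.trans (min_le_left _ _)
  have h2 : |ξ| ≤ 1 / (2 * (|B| + 1)) := hξ.trans (min_le_right _ _)
  have h3 : (|B| + 1) * |ξ| ≤ 1 / 2 := by
    rw [le_div_iff₀ (by positivity)] at h2
    linarith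
  have hpi := Real.pi_gt_three
  have hpi2 := Real.pi_lt_d2
  have h4 : 1 ≤ 2 * Real.pi ^ 2 * s := by
    rw [div_le_iff₀ (by positivity)] at hs1
    nlinarith
  have h5 : ξ ^ 2 ≤ 1 / 25 := by
    rw [← sq_abs]
    nlinarith [abs_nonneg ξ]
  have hs0 : 0 ≤ s := by
    refine le_trans ?_ hs1
    positivity
  have h6 : 0 ≤ 1 - 2 * Real.pi ^ 2 * s * ξ ^ 2 := by
    have : Real.pi ^ 2 ≤ 10 := by nlinarith
    have a1 : Real.pi ^ 2 * s ≤ 10 := by nlinarith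
    have a2 : Real.pi ^ 2 * s * ξ ^ 2 ≤ 10 * (1 / 25) := by gcongr
    linarith
  have h7 : B * |ξ| ^ 3 ≤ 1 / 2 * ξ ^ 2 := by
    have : B * |ξ| ≤ 1 / 2 := by
      nlinarith [le_abs_self B, abs_nonneg ξ]
    calc B * |ξ| ^ 3 = B * |ξ| * |ξ| ^ 2 := by ring
      _ ≤ 1 / 2 * |ξ| ^ 2 := by gcongr
      _ = _ := by rw [sq_abs]
  calc ‖fourierReal f ξ‖ ≤ ‖((1 - 2 * Real.pi ^ 2 * s * ξ ^ 2 : ℝ) : ℂ)‖ +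
        ‖fourierReal f ξ - (1 - 2 * Real.pi ^ 2 * s * ξ ^ 2 : ℝ)‖ := norm_le_insert' _ _
    _ ≤ (1 - 2 * Real.pi ^ 2 * s * ξ ^ 2) + B * |ξ| ^ 3 := by
        refine add_le_add (le_of_eq ?_) (hf.norm_fourierReal_taylor_two_le ξ)
        rw [Complex.norm_real, Real.norm_eq_abs, abs_of_nonneg h6]
    _ ≤ -(ξ ^ 2 / 2) + 1 := by nlinarith [sq_nonneg ξ]
    _ ≤ _ := Real.add_one_le_exp _

/-! ### Triangular arrays of centred densities: powers of the transforms -/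

/-- A sequence of centred densities which behaves, for the purposes of the local limit theorem,
like a single one with variance `1 / (2 π)`, for which the limiting Gaussian density `exp (-π v²)`
is its own Fourier transform. -/
structure LocalLimitArray (C : ℝ) (f : ℕ → ℝ → ℝ) : Prop where
  centered : ∀ᶠ n in atTop, CenteredDensity C (f n)
  variance : Tendsto (fun n => ∫ v, v ^ 2 * f n v) atTop (𝓝 (1 / (2 * Real.pi)))
  far : ∀ δ : ℝ, 0 < δ → ∃ ρ : ℝ, 0 ≤ ρ ∧ ρ < 1 ∧ ∀ᶠ n in atTop, ∀ ξ, δ ≤ |ξ| →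
    ‖fourierReal (f n) ξ‖ ≤ ρ

/-- The `k`-th power of the Fourier transform of `f`, cut off outside `[-δ, δ]`. -/
noncomputable def nearPow (δ : ℝ) (f : ℝ → ℝ) (k : ℕ) (ξ : ℝ) : ℂ :=
  (Icc (-δ) δ).indicator (fun ξ => fourierReal f ξ ^ k) ξ

theorem measurable_nearPow (δ : ℝ) {f : ℝ → ℝ} (hf : Integrable f) (k : ℕ) :
    Measurable (nearPow δ f k) :=
  ((continuous_fourierReal hf).pow k).measurable.indicator measurableSet_Icc

theorem integrable_pow_mul_exp_neg_sq (j : ℕ) {b : ℝ} (hb : 0 < b) :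
    Integrable (fun u : ℝ => |u| ^ j * Real.exp (-(b * u ^ 2))) := by
  have := (integrable_rpow_mul_exp_neg_mul_sq hb (s := j)
    (by have := Nat.cast_nonneg (α := ℝ) j; linarith)).norm
  refine this.congr (ae_of_all _ fun u => ?_)
  simp [Real.rpow_natCast]

namespace LocalLimitArray

variable {C : ℝ} {f : ℕ → ℝ → ℝ}

/-- Shifting the array turns statements about `f n` and its `n`-fold power into statements about
`f n` and its `(n - 1)`-fold power. -/
theorem succ (h : LocalLimitArray C f) : LocalLimitArray C (fun n => f (n + 1)) where
  centered := (tendsto_add_atTop_nat 1).eventually h.centered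
  variance := h.variance.comp (tendsto_add_atTop_nat 1)
  far δ hδ := by
    obtain ⟨ρ, h0, h1, h2⟩ := h.far δ hδ
    exact ⟨ρ, h0, h1, (tendsto_add_atTop_nat 1).eventually h2⟩

theorem eventually_norm_le_exp (h : LocalLimitArray C f) : ∃ δ : ℝ, 0 < δ ∧ ∀ᶠ n in atTop,
    ∀ ξ, |ξ| ≤ δ → ‖fourierReal (f n) ξ‖ ≤ Real.exp (-(ξ ^ 2 / 2)) := by
  obtain ⟨δ, hδ, H⟩ := exists_norm_fourierReal_le_exp C
  have hpi := Real.pi_gt_three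
  have l1 : 1 / (4 * Real.pi) < 1 / (2 * Real.pi) := by
    apply one_div_lt_one_div_of_lt <;> linarith
  have l2 : 1 / (2 * Real.pi) < 1 := by
    rw [div_lt_one] <;> linarith
  refine ⟨δ, hδ, ?_⟩
  filter_upwards [h.centered, h.variance.eventually (lt_mem_nhds l1),
    h.variance.eventually (gt_mem_nhds l2)] with n h1 h2 h3
  exact H (f n) h1 h2.le h3.le

/-- The central limit theorem for the array, on the level of Fourier transforms. -/
theorem tendsto_fourierReal_pow (h : LocalLimitArray C f) (u : ℝ) :
    Tendsto (fun n : ℕ => fourierReal (f n) (u / √n) ^ n) atTop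
      (𝓝 (Real.exp (-(Real.pi * u ^ 2)) : ℂ)) := by
  -- Once `n (𝓕 f (u / √n) - 1)` converges to `-π u²`, the powers converge to its exponential.
  have key : Tendsto (fun n : ℕ => (n : ℂ) * (fourierReal (f n) (u / √n) - 1)) atTop
      (𝓝 (-(Real.pi * u ^ 2) : ℝ)) := by
    set B := 32 * Real.pi ^ 3 * (C * ∫ v : ℝ, |v| ^ 3 * Real.exp (-|v|)) with hB
    have t1 : Tendsto (fun n : ℕ => ((-(2 * Real.pi ^ 2 * (∫ v, v ^ 2 * f n v) * u ^ 2) : ℝ) : ℂ))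
        atTop (𝓝 (-(Real.pi * u ^ 2) : ℝ)) := by
      refine (Complex.continuous_ofReal.tendsto _).comp ?_
      have := ((h.variance.const_mul (2 * Real.pi ^ 2)).mul_const (u ^ 2)).neg
      refine this.trans_eq ?_
      congr 2
      have := Real.pi_ne_zero
      field_simp
    have t2 : Tendsto (fun n : ℕ => (n : ℂ) * (fourierReal (f n) (u / √n) - 1) -
        ((-(2 * Real.pi ^ 2 * (∫ v, v ^ 2 * f n v) * u ^ 2) : ℝ) : ℂ)) atTop (𝓝 0) := by
      have t3 : Tendsto (fun n : ℕ => B * |u| ^ 3 / √(n : ℝ)) atTop (𝓝 0) :=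
        tendsto_const_nhds.div_atTop
          (Real.tendsto_sqrt_atTop.comp tendsto_natCast_atTop_atTop)
      refine squeeze_zero_norm' ?_ t3
      filter_upwards [h.centered, eventually_gt_atTop 0] with n hn hn0
      have hs : (0 : ℝ) < √n := Real.sqrt_pos.2 (by exact_mod_cast hn0)
      have hsq : √(n : ℝ) ^ 2 = n := Real.sq_sqrt (by positivity)
      have e : (n : ℂ) * (fourierReal (f n) (u / √n) - 1) -
        ((-(2 * Real.pi ^ 2 * (∫ v, v ^ 2 * f n v) * u ^ 2) : ℝ) : ℂ) =
        n * (fourierReal (f n) (u / √n) -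
          (1 - 2 * Real.pi ^ 2 * (∫ v, v ^ 2 * f n v) * (u / √n) ^ 2 : ℝ)) := by
        rw [div_pow, hsq]
        push_cast
        have : (n : ℂ) ≠ 0 := by exact_mod_cast hn0.ne'
        field_simp
        ring
      rw [e, norm_mul, Complex.norm_natCast]
      calc (n : ℝ) * _ ≤ n * (B * |u / √n| ^ 3) := by
            gcongr
            exact hn.norm_fourierReal_taylor_two_le _
        _ = B * |u| ^ 3 / √n := by
            rw [abs_div, abs_of_pos hs, div_pow]
            nth_rewrite 1 [← hsq]
            field_simp
    simpa using t2.add t1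
  have := Complex.tendsto_one_add_pow_exp_of_tendsto key
  simpa using this

theorem norm_nearPow_le {g : ℝ → ℝ} {δ : ℝ}
    (hg : ∀ ξ, |ξ| ≤ δ → ‖fourierReal g ξ‖ ≤ Real.exp (-(ξ ^ 2 / 2))) {n : ℕ} (hn : 0 < n)
    (u : ℝ) : ‖nearPow δ g n (u / √n)‖ ≤ Real.exp (-(1 / 2 * u ^ 2)) := by
  have hsq : √(n : ℝ) ^ 2 = n := Real.sq_sqrt (by positivity)
  have hn' : (n : ℝ) ≠ 0 := by positivity
  unfold nearPow
  by_cases hu : u / √n ∈ Icc (-δ) δ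
  · rw [indicator_of_mem hu, norm_pow]
    calc _ ≤ Real.exp (-((u / √n) ^ 2 / 2)) ^ n := by
          gcongr
          exact hg _ (abs_le.2 hu)
      _ = _ := by
          rw [← Real.exp_nat_mul, div_pow, hsq]
          congr 1
          field_simp
  · rw [indicator_of_notMem hu, norm_zero]
    positivity

/-- Change of variable `ξ = u / √n` in a moment integral. -/
theorem sqrt_pow_smul_integral {E : Type*} [NormedAddCommGroup E] [NormedSpace ℝ E] (j : ℕ)
    {n : ℕ} (hn : 0 < n) (φ : ℝ → ℝ) (hφ : ∀ a u, 0 < a → φ (u / a) = φ u / a ^ j) (G : ℝ → E) :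
    √(n : ℝ) ^ (j + 1) • ∫ ξ, φ ξ • G ξ = ∫ u, φ u • G (u / √n) := by
  have hs : (0 : ℝ) < √n := Real.sqrt_pos.2 (by exact_mod_cast hn)
  have := Measure.integral_comp_mul_left (fun ξ => φ ξ • G ξ) (√(n : ℝ))⁻¹
  rw [inv_inv, abs_of_pos hs] at this
  rw [pow_succ, mul_smul, ← this, ← integral_smul]
  congr 1 with u
  rw [inv_mul_eq_div, hφ _ _ hs, smul_smul]
  congr 1
  field_simp

theorem tendsto_integral_pow_mul_nearPow (h : LocalLimitArray C f) {δ : ℝ} (hδ : 0 < δ)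
    (hf : ∀ᶠ n in atTop, ∀ ξ, |ξ| ≤ δ → ‖fourierReal (f n) ξ‖ ≤ Real.exp (-(ξ ^ 2 / 2)))
    (j : ℕ) :
    Tendsto (fun n : ℕ => √(n : ℝ) ^ (j + 1) • ∫ ξ : ℝ, ξ ^ j • nearPow δ (f n) n ξ) atTop
      (𝓝 (∫ u : ℝ, u ^ j • (Real.exp (-(Real.pi * u ^ 2)) : ℂ))) := by
  have e : (fun n : ℕ => ∫ u : ℝ, u ^ j • nearPow δ (f n) n (u / √n)) =ᶠ[atTop]
      (fun n : ℕ => √(n : ℝ) ^ (j + 1) • ∫ ξ : ℝ, ξ ^ j • nearPow δ (f n) n ξ) := by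
    filter_upwards [eventually_gt_atTop 0] with n hn
    exact (sqrt_pow_smul_integral j hn _ (fun a u _ => div_pow u a j) _).symm
  refine Tendsto.congr' e ?_
  refine tendsto_integral_filter_of_dominated_convergence
    (fun u => |u| ^ j * Real.exp (-(1 / 2 * u ^ 2))) ?_ ?_
    (integrable_pow_mul_exp_neg_sq j (by norm_num)) (ae_of_all _ fun u => ?_)
  · filter_upwards [h.centered] with n hn
    have := measurable_nearPow δ hn.integrable n
    exact Measurable.aestronglyMeasurable (by fun_prop)
  · filter_upwards [hf, eventually_gt_atTop 0] with n hn hn0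
    refine ae_of_all _ fun u => ?_
    rw [norm_smul, norm_pow, Real.norm_eq_abs]
    gcongr
    exact norm_nearPow_le hn hn0 u
  · refine Tendsto.const_smul ?_ _
    refine (h.tendsto_fourierReal_pow u).congr' ?_
    have t : Tendsto (fun n : ℕ => u / √(n : ℝ)) atTop (𝓝 0) :=
      tendsto_const_nhds.div_atTop (Real.tendsto_sqrt_atTop.comp tendsto_natCast_atTop_atTop)
    filter_upwards [t.eventually (Icc_mem_nhds (neg_lt_zero.2 hδ) hδ)] with n hn
    rw [nearPow, indicator_of_mem (mem_Icc.2 hn)]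

theorem integral_pow_mul_norm_nearPow_le {g : ℝ → ℝ} {δ : ℝ}
    (hg : ∀ ξ, |ξ| ≤ δ → ‖fourierReal g ξ‖ ≤ Real.exp (-(ξ ^ 2 / 2))) {n : ℕ} (hn : 0 < n)
    (j : ℕ) :
    √(n : ℝ) ^ (j + 1) * ∫ ξ : ℝ, |ξ| ^ j * ‖nearPow δ g n ξ‖ ≤
      ∫ u : ℝ, |u| ^ j * Real.exp (-(1 / 2 * u ^ 2)) := by
  have := sqrt_pow_smul_integral j hn (fun u => |u| ^ j)
    (fun a u ha => by rw [abs_div, abs_of_pos ha, div_pow]) (fun ξ => ‖nearPow δ g n ξ‖)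
  simp only [smul_eq_mul] at this
  rw [this]
  refine integral_mono_of_nonneg (ae_of_all _ fun u => by positivity)
    (integrable_pow_mul_exp_neg_sq j (by norm_num)) (ae_of_all _ fun u => ?_)
  simp only
  gcongr
  exact norm_nearPow_le hg hn u

theorem integrable_pow_mul_norm_nearPow {g : ℝ → ℝ} (hg : Integrable g) (δ : ℝ) (n j : ℕ) :
    Integrable (fun ξ : ℝ => |ξ| ^ j * ‖nearPow δ g n ξ‖) := by
  have : (fun ξ : ℝ => |ξ| ^ j * ‖nearPow δ g n ξ‖) =
      (Icc (-δ) δ).indicator (fun ξ => |ξ| ^ j * ‖fourierReal g ξ ^ n‖) := by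
    ext ξ
    unfold nearPow
    by_cases hξ : ξ ∈ Icc (-δ) δ
    · rw [indicator_of_mem hξ, indicator_of_mem hξ]
    · rw [indicator_of_notMem hξ, indicator_of_notMem hξ, norm_zero, mul_zero]
  rw [this, integrable_indicator_iff measurableSet_Icc]
  have := continuous_fourierReal hg
  exact Continuous.integrableOn_Icc (by fun_prop)

/-- Away from the origin the powers of the transforms are negligible to every polynomial order;
one half of the bound is the geometric factor, the other is Plancherel's identity. -/
theorem tendsto_integral_far (h : LocalLimitArray C f) {δ : ℝ} (hδ : 0 < δ) :
    Tendsto (fun n : ℕ => n * ∫ ξ, ‖fourierReal (f n) ξ ^ n - nearPow δ (f n) n ξ‖) atTop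
      (𝓝 0) := by
  obtain ⟨ρ, h0, h1, hρ⟩ := h.far δ hδ
  have t : Tendsto (fun n : ℕ => C * (n * ρ ^ (n - 2))) atTop (𝓝 0) := by
    rw [← mul_zero C]
    refine Tendsto.const_mul C ?_
    rw [← tendsto_add_atTop_iff_nat 2]
    have a1 := tendsto_self_mul_const_pow_of_lt_one h0 h1
    have a2 := (tendsto_pow_atTop_nhds_zero_of_lt_one h0 h1).const_mul 2
    have := a1.add a2
    simp only [mul_zero, add_zero] at this
    refine this.congr fun n => ?_
    simp only [Nat.add_sub_cancel]
    push_cast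
    ring
  refine squeeze_zero' (Eventually.of_forall fun n => by positivity) ?_ t
  filter_upwards [h.centered, hρ, eventually_ge_atTop 2] with n hn hr hn2
  obtain ⟨k, rfl⟩ := Nat.exists_eq_add_of_le' hn2
  simp only [Nat.add_sub_cancel]
  have : ∫ ξ, ‖fourierReal (f (k + 2)) ξ ^ (k + 2) - nearPow δ (f (k + 2)) (k + 2) ξ‖ ≤
      ∫ ξ, ρ ^ k * ‖fourierReal (f (k + 2)) ξ‖ ^ 2 := by
    refine integral_mono_of_nonneg (ae_of_all _ fun ξ => norm_nonneg _)
      ((integrable_norm_sq_fourierReal hn.integrable hn.abs_le).const_mul _)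
      (ae_of_all _ fun ξ => ?_)
    simp only [nearPow]
    by_cases hξ : ξ ∈ Icc (-δ) δ
    · rw [indicator_of_mem hξ, sub_self, norm_zero]
      positivity
    · rw [indicator_of_notMem hξ, sub_zero, norm_pow, pow_add]
      gcongr
      refine hr ξ ?_
      by_contra hlt
      exact hξ (abs_le.1 (not_le.1 hlt).le)
  calc _ ≤ ((k + 2 : ℕ) : ℝ) * (ρ ^ k * C) := by
        gcongr
        refine this.trans ?_
        rw [integral_const_mul]
        gcongr
        exact hn.integral_norm_sq_le
    _ = _ := by ring

end LocalLimitArray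

/-! ### Local limit theorem for consecutive convolution powers -/

theorem integral_exp_neg_pi_mul_sq : ∫ u : ℝ, Real.exp (-(Real.pi * u ^ 2)) = 1 := by
  have := integral_gaussian Real.pi
  rw [div_self Real.pi_ne_zero, Real.sqrt_one] at this
  simpa using this

theorem integral_mul_exp_neg_pi_mul_sq : ∫ u : ℝ, u * Real.exp (-(Real.pi * u ^ 2)) = 0 := by
  have := integral_neg_eq_self (fun u : ℝ => u * Real.exp (-(Real.pi * u ^ 2))) volume
  simp only [neg_mul, even_two.neg_pow, integral_neg] at this
  linarith

theorem integrable_nearPow {g : ℝ → ℝ} (hg : Integrable g) (δ : ℝ) (n : ℕ) :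
    Integrable (nearPow δ g n) := by
  have := LocalLimitArray.integrable_pow_mul_norm_nearPow hg δ n 0
  simp only [pow_zero, one_mul] at this
  exact (integrable_norm_iff (measurable_nearPow δ hg n).aestronglyMeasurable).1 this

theorem integrable_pow_smul_nearPow {g : ℝ → ℝ} (hg : Integrable g) (δ : ℝ) (n j : ℕ) :
    Integrable (fun ξ : ℝ => ξ ^ j • nearPow δ g n ξ) := by
  refine (LocalLimitArray.integrable_pow_mul_norm_nearPow hg δ n j).mono' ?_
    (ae_of_all _ fun ξ => ?_)
  · have := measurable_nearPow δ hg n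
    exact Measurable.aestronglyMeasurable (by fun_prop)
  · rw [norm_smul, norm_pow, Real.norm_eq_abs]

namespace CenteredDensity

variable {C : ℝ} {f : ℝ → ℝ}

theorem integrable_pow (h : CenteredDensity C f) {n : ℕ} (hn : 2 ≤ n) :
    Integrable (fun ξ => fourierReal f ξ ^ n) := by
  obtain ⟨k, rfl⟩ := Nat.exists_eq_add_of_le' hn
  exact integrable_fourierReal_pow h.integrable h.abs_le k

/-- Inversion for the `n`-fold convolution power, which is `convPow f (n - 1)`. -/
theorem convPow_eq (h : CenteredDensity C f) {n : ℕ} (hn : 2 ≤ n) (w : ℝ) :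
    (convPow f (n - 1) w : ℂ) = ∫ ξ, Complex.exp ((2 * Real.pi * w * ξ : ℝ) * Complex.I) *
      fourierReal f ξ ^ n := by
  obtain ⟨k, rfl⟩ := Nat.exists_eq_add_of_le' hn
  exact convPow_eq_integral h.integrable h.abs_le k w

theorem integrable_exp_mul_pow (h : CenteredDensity C f) {n : ℕ} (hn : 2 ≤ n) (w : ℝ) :
    Integrable (fun ξ => Complex.exp ((2 * Real.pi * w * ξ : ℝ) * Complex.I) *
      fourierReal f ξ ^ n) :=
  (h.integrable_pow hn).bdd_mul (c := 1) (Continuous.aestronglyMeasurable (by fun_prop))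
    (ae_of_all _ fun v => by rw [Complex.norm_exp_ofReal_mul_I])

/-- Splitting the difference of two consecutive convolution powers into the linear term near the
origin, a quadratic remainder near the origin, and the part away from the origin. -/
theorem abs_convPow_sub_le (h : CenteredDensity C f) {n : ℕ} (hn : 2 ≤ n) (δ : ℝ) {K w : ℝ}
    (hw : |w| ≤ K) :
    |convPow f (n - 1) w - convPow f n 0| ≤
      2 * Real.pi * K * ‖∫ ξ : ℝ, ξ ^ 1 • nearPow δ f n ξ‖ +
      (12 * Real.pi ^ 2 * K ^ 2 +
        12 * Real.pi ^ 2 * (C * ∫ v : ℝ, |v| ^ 2 * Real.exp (-|v|))) *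
        (∫ ξ : ℝ, |ξ| ^ 2 * ‖nearPow δ f n ξ‖) +
      2 * ∫ ξ, ‖fourierReal f ξ ^ n - nearPow δ f n ξ‖ := by
  set E : ℝ → ℂ := fun ξ => Complex.exp ((2 * Real.pi * w * ξ : ℝ) * Complex.I) with hE
  set X := fourierReal f with hX
  set Z := nearPow δ f n with hZ
  set B := 12 * Real.pi ^ 2 * (C * ∫ v : ℝ, |v| ^ 2 * Real.exp (-|v|)) with hB
  have hK : 0 ≤ K := (abs_nonneg w).trans hw
  have e0 : (convPow f n 0 : ℂ) = ∫ ξ, X ξ ^ (n + 1) := by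
    have := h.convPow_eq (n := n + 1) (by omega) 0
    simpa using this
  have e1 : ((convPow f (n - 1) w - convPow f n 0 : ℝ) : ℂ) = ∫ ξ, (E ξ - X ξ) * X ξ ^ n := by
    rw [Complex.ofReal_sub, h.convPow_eq hn, e0,
      ← integral_sub (h.integrable_exp_mul_pow hn w) (h.integrable_pow (by omega))]
    congr 1 with ξ
    ring
  have iZ : Integrable Z := integrable_nearPow h.integrable δ n
  have iX : Integrable (fun ξ => X ξ ^ n) := h.integrable_pow hn
  have iZ1 : Integrable (fun ξ : ℝ => ξ ^ 1 • Z ξ) := integrable_pow_smul_nearPow h.integrable δ n 1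
  have iZ2 : Integrable (fun ξ : ℝ => |ξ| ^ 2 * ‖Z ξ‖) :=
    LocalLimitArray.integrable_pow_mul_norm_nearPow h.integrable δ n 2
  have hEc : Continuous E := by fun_prop
  have hXc : Continuous X := continuous_fourierReal h.integrable
  have nE : ∀ ξ, ‖E ξ‖ = 1 := fun ξ => Complex.norm_exp_ofReal_mul_I _
  have nEX : ∀ ξ, ‖E ξ - X ξ‖ ≤ 2 := fun ξ => by
    refine (norm_sub_le _ _).trans ?_
    have := h.norm_fourierReal_le_one ξ
    rw [nE]
    linarith
  have iA : Integrable (fun ξ => (E ξ - X ξ) * (X ξ ^ n - Z ξ)) :=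
    (iX.sub iZ).bdd_mul (c := 2) (by fun_prop) (ae_of_all _ nEX)
  have iB : Integrable (fun ξ => (E ξ - X ξ - (2 * Real.pi * w * ξ : ℝ) * Complex.I) * Z ξ) := by
    have j1 : Integrable (fun ξ => (E ξ - X ξ) * Z ξ) :=
      iZ.bdd_mul (c := 2) (by fun_prop) (ae_of_all _ nEX)
    refine (j1.sub (iZ1.const_mul (2 * Real.pi * w * Complex.I))).congr (ae_of_all _ fun ξ => ?_)
    simp only [Pi.sub_apply, Complex.real_smul]
    push_cast
    ring
  have e2 : ∫ ξ, (E ξ - X ξ) * X ξ ^ n =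
      (2 * Real.pi * w * Complex.I) * (∫ ξ : ℝ, ξ ^ 1 • Z ξ) +
      (∫ ξ, (E ξ - X ξ - (2 * Real.pi * w * ξ : ℝ) * Complex.I) * Z ξ) +
      ∫ ξ, (E ξ - X ξ) * (X ξ ^ n - Z ξ) := by
    rw [← integral_const_mul, ← integral_add (iZ1.const_mul _) iB, ← integral_add _ iA]
    · congr 1 with ξ
      simp only [Complex.real_smul]
      push_cast
      ring
    · exact (iZ1.const_mul _).add iB
  have b1 : ‖(2 * Real.pi * w * Complex.I) * (∫ ξ : ℝ, ξ ^ 1 • Z ξ)‖ ≤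
      2 * Real.pi * K * ‖∫ ξ : ℝ, ξ ^ 1 • Z ξ‖ := by
    rw [norm_mul]
    gcongr
    simp only [norm_mul, Complex.norm_I, Complex.norm_real, Real.norm_eq_abs,
      abs_of_pos Real.pi_pos, mul_one, Complex.norm_ofNat]
    gcongr
  have b2 : ‖∫ ξ, (E ξ - X ξ - (2 * Real.pi * w * ξ : ℝ) * Complex.I) * Z ξ‖ ≤
      (12 * Real.pi ^ 2 * K ^ 2 + B) * ∫ ξ : ℝ, |ξ| ^ 2 * ‖Z ξ‖ := by
    rw [← integral_const_mul]
    refine norm_integral_le_of_norm_le (iZ2.const_mul _) (ae_of_all _ fun ξ => ?_)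
    rw [norm_mul, ← mul_assoc]
    gcongr
    have c1 := norm_exp_mul_I_sub_one_sub_le (2 * Real.pi * w * ξ)
    have c2 := h.norm_fourierReal_sub_one_le ξ
    have c3 : w ^ 2 ≤ K ^ 2 := by
      rw [← sq_abs w]
      gcongr
    calc ‖E ξ - X ξ - (2 * Real.pi * w * ξ : ℝ) * Complex.I‖
        = ‖(E ξ - 1 - (2 * Real.pi * w * ξ : ℝ) * Complex.I) - (X ξ - 1)‖ := by
          congr 1; ring
      _ ≤ 3 * (2 * Real.pi * w * ξ) ^ 2 + B * ξ ^ 2 := (norm_sub_le _ _).trans (add_le_add c1 c2)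
      _ = (12 * Real.pi ^ 2 * w ^ 2 + B) * |ξ| ^ 2 := by rw [sq_abs]; ring
      _ ≤ _ := by gcongr
  have b3 : ‖∫ ξ, (E ξ - X ξ) * (X ξ ^ n - Z ξ)‖ ≤ 2 * ∫ ξ, ‖X ξ ^ n - Z ξ‖ := by
    rw [← integral_const_mul]
    refine norm_integral_le_of_norm_le ((iX.sub iZ).norm.const_mul 2) (ae_of_all _ fun ξ => ?_)
    rw [norm_mul]
    gcongr
    exact nEX ξ
  rw [← Real.norm_eq_abs, ← Complex.norm_real, e1, e2]
  exact (norm_add_le _ _).trans (add_le_add ((norm_add_le _ _).trans (add_le_add b1 b2)) b3)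

end CenteredDensity

namespace LocalLimitArray

variable {C : ℝ} {f : ℕ → ℝ → ℝ}

/-- The density of the sum of `n` independent variables at its mean is asymptotic to `1 / √n`. -/
theorem tendsto_sqrt_mul_convPow (h : LocalLimitArray C f) :
    Tendsto (fun n : ℕ => √(n : ℝ) * convPow (f n) (n - 1) 0) atTop (𝓝 1) := by
  obtain ⟨δ, hδ, hnear⟩ := h.eventually_norm_le_exp
  have t1 := h.tendsto_integral_pow_mul_nearPow hδ hnear 0
  have t2 := h.tendsto_integral_far hδ
  simp only [pow_zero, one_smul, zero_add, pow_one, integral_complex_ofReal,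
    integral_exp_neg_pi_mul_sq] at t1
  have t3 : Tendsto (fun n : ℕ => √(n : ℝ) • ∫ ξ, (fourierReal (f n) ξ ^ n - nearPow δ (f n) n ξ))
      atTop (𝓝 0) := by
    refine squeeze_zero_norm' ?_ t2
    filter_upwards [eventually_ge_atTop 1] with n hn
    have hn' : (1 : ℝ) ≤ n := by exact_mod_cast hn
    rw [norm_smul, Real.norm_eq_abs, abs_of_nonneg (Real.sqrt_nonneg _)]
    gcongr
    · exact Real.sqrt_le_iff.2 ⟨by linarith, by nlinarith⟩
    · exact norm_integral_le_integral_norm _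
  have t4 := t1.add t3
  have t5 : Tendsto (fun n : ℕ => ((√(n : ℝ) * convPow (f n) (n - 1) 0 : ℝ) : ℂ)) atTop
      (𝓝 ((1 : ℝ) : ℂ)) := by
    rw [add_zero] at t4
    refine t4.congr' ?_
    filter_upwards [h.centered, eventually_ge_atTop 2] with n hn hn2
    have iZ := integrable_nearPow hn.integrable δ n
    have iY : Integrable (fun ξ => fourierReal (f n) ξ ^ n - nearPow δ (f n) n ξ) :=
      (hn.integrable_pow hn2).sub iZ
    rw [← smul_add, ← integral_add iZ iY, Complex.ofReal_mul,
      hn.convPow_eq hn2, Complex.real_smul]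
    simp
  have := (Complex.continuous_re.tendsto _).comp t5
  simpa [Function.comp_def] using this

theorem eventually_abs_convPow_le (h : LocalLimitArray C f) :
    ∃ D : ℝ, ∀ᶠ n : ℕ in atTop, ∀ w, √(n : ℝ) * |convPow (f n) (n - 1) w| ≤ D := by
  obtain ⟨δ, hδ, hnear⟩ := h.eventually_norm_le_exp
  refine ⟨(∫ u : ℝ, |u| ^ 0 * Real.exp (-(1 / 2 * u ^ 2))) + 1, ?_⟩
  filter_upwards [h.centered, eventually_ge_atTop 2, hnear,
    (h.tendsto_integral_far hδ).eventually (gt_mem_nhds one_pos)] with n hn hn2 h1 h2 w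
  have h3 := integral_pow_mul_norm_nearPow_le h1 (n := n) (by omega) 0
  have hn' : (1 : ℝ) ≤ n := by exact_mod_cast (by omega : 1 ≤ n)
  have iZ := integrable_nearPow hn.integrable δ n
  have iY : Integrable (fun ξ => ‖fourierReal (f n) ξ ^ n - nearPow δ (f n) n ξ‖) :=
    ((hn.integrable_pow hn2).sub iZ).norm
  have i0 := integrable_pow_mul_norm_nearPow hn.integrable δ n 0
  calc √(n : ℝ) * |convPow (f n) (n - 1) w|
      ≤ √(n : ℝ) * ∫ ξ, (|ξ| ^ 0 * ‖nearPow δ (f n) n ξ‖ +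
          ‖fourierReal (f n) ξ ^ n - nearPow δ (f n) n ξ‖) := by
        gcongr
        rw [← Real.norm_eq_abs, ← Complex.norm_real, hn.convPow_eq hn2]
        refine norm_integral_le_of_norm_le (i0.add iY) (ae_of_all _ fun ξ => ?_)
        rw [norm_mul, Complex.norm_exp_ofReal_mul_I, one_mul, pow_zero, one_mul]
        exact norm_le_insert' _ _
    _ = √(n : ℝ) ^ (0 + 1) * (∫ ξ, |ξ| ^ 0 * ‖nearPow δ (f n) n ξ‖) +
        √(n : ℝ) * ∫ ξ, ‖fourierReal (f n) ξ ^ n - nearPow δ (f n) n ξ‖ := by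
        rw [integral_add i0 iY]
        ring
    _ ≤ _ := by
        refine add_le_add h3 (le_trans ?_ h2.le)
        gcongr
        exact Real.sqrt_le_iff.2 ⟨by linarith, by nlinarith⟩

/-- Consecutive convolution powers differ by `o(1 / n)`, uniformly on bounded sets: the linear
term of the expansion has a Gaussian limit with vanishing first moment. -/
theorem eventually_abs_convPow_sub_le (h : LocalLimitArray C f) (K : ℝ) {η : ℝ} (hη : 0 < η) :
    ∀ᶠ n : ℕ in atTop, ∀ w, |w| ≤ K →
      n * |convPow (f n) (n - 1) w - convPow (f n) n 0| ≤ η := by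
  obtain ⟨δ, hδ, hnear⟩ := h.eventually_norm_le_exp
  set B := (12 * Real.pi ^ 2 * K ^ 2 +
        12 * Real.pi ^ 2 * (C * ∫ v : ℝ, |v| ^ 2 * Real.exp (-|v|)))
  set G := ∫ u : ℝ, |u| ^ 2 * Real.exp (-(1 / 2 * u ^ 2))
  have t1 : Tendsto (fun n : ℕ => 2 * Real.pi * K *
      ‖√(n : ℝ) ^ (1 + 1) • ∫ ξ : ℝ, ξ ^ 1 • nearPow δ (f n) n ξ‖) atTop (𝓝 0) := by
    have := (h.tendsto_integral_pow_mul_nearPow hδ hnear 1).norm.const_mul (2 * Real.pi * K)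
    simp only [pow_one, Complex.real_smul, ← Complex.ofReal_mul, integral_complex_ofReal,
      integral_mul_exp_neg_pi_mul_sq] at this
    simpa using this
  have t2 : Tendsto (fun n : ℕ => |B| * G / √(n : ℝ)) atTop (𝓝 0) :=
    tendsto_const_nhds.div_atTop (Real.tendsto_sqrt_atTop.comp tendsto_natCast_atTop_atTop)
  have t3 := (h.tendsto_integral_far hδ).const_mul 2
  have t := (t1.add t2).add t3
  simp only [mul_zero, add_zero] at t
  filter_upwards [h.centered, eventually_ge_atTop 2, hnear,
    t.eventually (gt_mem_nhds hη)] with n hn hn2 h1 h2 w hw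
  refine le_trans ?_ h2.le
  have hs : (0 : ℝ) < √n := Real.sqrt_pos.2 (by exact_mod_cast (by omega : 0 < n))
  have hsq : √(n : ℝ) ^ 2 = n := Real.sq_sqrt (by positivity)
  have h3 := integral_pow_mul_norm_nearPow_le h1 (n := n) (by omega) 2
  calc n * |convPow (f n) (n - 1) w - convPow (f n) n 0|
      ≤ n * (2 * Real.pi * K * ‖∫ ξ : ℝ, ξ ^ 1 • nearPow δ (f n) n ξ‖ +
        B * (∫ ξ : ℝ, |ξ| ^ 2 * ‖nearPow δ (f n) n ξ‖) +
        2 * ∫ ξ, ‖fourierReal (f n) ξ ^ n - nearPow δ (f n) n ξ‖) := by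
        gcongr
        exact hn.abs_convPow_sub_le hn2 δ hw
    _ = 2 * Real.pi * K * ‖√(n : ℝ) ^ (1 + 1) • ∫ ξ : ℝ, ξ ^ 1 • nearPow δ (f n) n ξ‖ +
        B * (√(n : ℝ) ^ (2 + 1) * (∫ ξ : ℝ, |ξ| ^ 2 * ‖nearPow δ (f n) n ξ‖)) / √(n : ℝ) +
        2 * (n * ∫ ξ, ‖fourierReal (f n) ξ ^ n - nearPow δ (f n) n ξ‖) := by
        rw [norm_smul, Real.norm_eq_abs, abs_of_pos (by positivity : 0 < √(n : ℝ) ^ (1 + 1))]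
        norm_num
        rw [pow_succ √(n : ℝ) 2, hsq]
        field_simp
    _ ≤ _ := by
        gcongr
        exact le_abs_self _

end LocalLimitArray

/-! ### Slices of a product density -/

/-- The total mass of the slice measure, which is the density at `s` of the sum of `n` independent
variables with density `p`. -/
noncomputable def sliceMass (p : ℝ → ℝ) (n : ℕ) (s : ℝ) : ENNReal := sliceMeasure p n s univ

theorem sliceMass_eq_lintegral (p : ℝ → ℝ) (n : ℕ) (s : ℝ) :
    sliceMass p n s = ∫⁻ y, ∏ i, ENNReal.ofReal (p (completeToSum n s y i)) := by
  rw [sliceMass, sliceMeasure, Measure.map_apply (measurable_completeToSum n s) MeasurableSet.univ,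
    preimage_univ, withDensity_apply _ MeasurableSet.univ, Measure.restrict_univ]

theorem completeToSum_succ_zero (m : ℕ) (s : ℝ) (y : Fin (m + 1) → ℝ) :
    completeToSum (m + 2) s y 0 = y 0 := by
  simp [completeToSum]

theorem completeToSum_succ_succ (m : ℕ) (s : ℝ) (y : Fin (m + 1) → ℝ) (i : Fin (m + 1)) :
    completeToSum (m + 2) s y i.succ =
      completeToSum (m + 1) (s - y 0) (fun j : Fin m => y j.succ) i := by
  unfold completeToSum
  by_cases hi : i.val < m
  · have h1 : i.succ.val < m + 2 - 1 := by simpa using hi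
    have h2 : i.val < m + 1 - 1 := by simpa using hi
    rw [dif_pos h1, dif_pos h2]
    rfl
  · have h1 : ¬ i.succ.val < m + 2 - 1 := by simpa using hi
    have h2 : ¬ i.val < m + 1 - 1 := by simpa using hi
    rw [dif_neg h1, dif_neg h2]
    have := Fin.sum_univ_succ y
    change s - ∑ j : Fin (m + 1), y j = _
    rw [this, sub_sub]
    rfl

theorem prod_completeToSum_succ (p : ℝ → ℝ) (m : ℕ) (s : ℝ) (y : Fin (m + 1) → ℝ) :
    ∏ i, ENNReal.ofReal (p (completeToSum (m + 2) s y i)) = ENNReal.ofReal (p (y 0)) *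
      ∏ i, ENNReal.ofReal (p (completeToSum (m + 1) (s - y 0) (fun j : Fin m => y j.succ) i)) := by
  rw [Fin.prod_univ_succ, completeToSum_succ_zero]
  simp_rw [completeToSum_succ_succ]

theorem measurable_prod_completeToSum {p : ℝ → ℝ} (hp : Measurable p) (n : ℕ) :
    Measurable (fun z : ℝ × (Fin (n - 1) → ℝ) =>
      ∏ i, ENNReal.ofReal (p (completeToSum n z.1 z.2 i))) := by
  have : Measurable (fun z : ℝ × (Fin (n - 1) → ℝ) => completeToSum n z.1 z.2) := by
    refine measurable_pi_lambda _ fun i => ?_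
    unfold completeToSum
    by_cases hi : i.val < n - 1
    · simp only [hi, dite_true]
      fun_prop
    · simp only [hi, dite_false]
      fun_prop
  refine Finset.measurable_prod _ fun i _ => ?_
  exact (hp.comp ((measurable_pi_apply i).comp this)).ennreal_ofReal

theorem measurable_sliceMass {p : ℝ → ℝ} (hp : Measurable p) (n : ℕ) :
    Measurable (sliceMass p n) := by
  have e : sliceMass p n = fun s => ∫⁻ y, ∏ i, ENNReal.ofReal (p (completeToSum n s y i)) :=
    funext (sliceMass_eq_lintegral p n)
  rw [e]
  exact (measurable_prod_completeToSum hp n).lintegral_prod_right'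

/-- The density of a slice in `m + 2` variables as a function of the first variable and the
remaining `m` free ones. -/
theorem exists_slice_density {p : ℝ → ℝ} (hp : Measurable p) (m : ℕ) :
    ∃ Q : ℝ → (Fin m → ℝ) → ENNReal, Measurable (Function.uncurry Q) ∧
      (∀ s, sliceMass p (m + 1) s = ∫⁻ z, Q s z) ∧
      ∀ (s : ℝ) (y : Fin (m + 1) → ℝ),
        ∏ i, ENNReal.ofReal (p (completeToSum (m + 2) s y i)) =
          ENNReal.ofReal (p (y 0)) * Q (s - y 0) (fun j : Fin m => y j.succ) :=
  ⟨fun s z => ∏ i, ENNReal.ofReal (p (completeToSum (m + 1) s z i)),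
    measurable_prod_completeToSum hp (m + 1), sliceMass_eq_lintegral p (m + 1),
    prod_completeToSum_succ p m⟩

/-- The first margin of the slice measure. -/
theorem map_sliceMeasure_zero {p : ℝ → ℝ} (hp : Measurable p) (m : ℕ) (s : ℝ) :
    (sliceMeasure p (m + 2) s).map (fun y => y 0) =
      volume.withDensity (fun x => ENNReal.ofReal (p x) * sliceMass p (m + 1) (s - x)) := by
  have hmp := (volume_preserving_piFinSuccAbove (fun _ : Fin (m + 1) => ℝ) 0).symm
  obtain ⟨Q, hQm, hQmass, hQ⟩ := exists_slice_density hp m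
  ext A hA
  have hpre : MeasurableSet ((fun y : Fin (m + 2) → ℝ => y 0) ⁻¹' A) := measurable_pi_apply 0 hA
  have hpre' : MeasurableSet ((fun y : Fin (m + 1) → ℝ => y 0) ⁻¹' A) := measurable_pi_apply 0 hA
  have e : (completeToSum (m + 2) s) ⁻¹' ((fun y : Fin (m + 2) → ℝ => y 0) ⁻¹' A) =
      (fun y : Fin (m + 1) → ℝ => y 0) ⁻¹' A := by
    ext y
    simp only [mem_preimage]
    rw [completeToSum_succ_zero]
  have e1 : (sliceMeasure p (m + 2) s).map (fun y => y 0) A =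
      ∫⁻ y : Fin (m + 1) → ℝ, ((fun y : Fin (m + 1) → ℝ => y 0) ⁻¹' A).indicator
        (fun y => ENNReal.ofReal (p (y 0)) * Q (s - y 0) (fun j : Fin m => y j.succ)) y := by
    rw [Measure.map_apply (measurable_pi_apply 0) hA, sliceMeasure,
      Measure.map_apply (measurable_completeToSum _ _) hpre,
      withDensity_apply _ ((measurable_completeToSum _ _) hpre), e,
      lintegral_indicator hpre']
    simp_rw [hQ]
    rfl
  have hF : Measurable (fun z : ℝ × (Fin m → ℝ) => A.indicator (fun _ => (1 : ENNReal)) z.1 *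
      (ENNReal.ofReal (p z.1) * Q (s - z.1) z.2)) :=
    ((measurable_const.indicator hA).comp measurable_fst).mul
      ((hp.comp measurable_fst).ennreal_ofReal.mul
        (hQm.comp ((measurable_const.sub measurable_fst).prodMk measurable_snd)))
  have e2 : ∀ z : ℝ × (Fin m → ℝ),
      ((fun y : Fin (m + 1) → ℝ => y 0) ⁻¹' A).indicator
        (fun y => ENNReal.ofReal (p (y 0)) * Q (s - y 0) (fun j : Fin m => y j.succ))
        ((MeasurableEquiv.piFinSuccAbove (fun _ : Fin (m + 1) => ℝ) 0).symm z) =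
      A.indicator (fun _ => (1 : ENNReal)) z.1 *
        (ENNReal.ofReal (p z.1) * Q (s - z.1) z.2) := by
    rintro ⟨x, z⟩
    have c0 : (MeasurableEquiv.piFinSuccAbove (fun _ : Fin (m + 1) => ℝ) 0).symm (x, z) 0 = x := rfl
    have c1 : (fun j : Fin m => (MeasurableEquiv.piFinSuccAbove
        (fun _ : Fin (m + 1) => ℝ) 0).symm (x, z) j.succ) = z := by
      ext j
      simp [MeasurableEquiv.piFinSuccAbove, Fin.insertNthEquiv]
    by_cases hx : x ∈ A
    · rw [indicator_of_mem (by simpa [c0] using hx), indicator_of_mem hx, one_mul, c0, c1]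
    · rw [indicator_of_notMem (by simpa [c0] using hx), indicator_of_notMem hx, zero_mul]
  rw [e1, withDensity_apply _ hA, ← hmp.lintegral_comp_emb (MeasurableEquiv.measurableEmbedding _),
    ← lintegral_indicator hA]
  simp_rw [e2]
  rw [Measure.volume_eq_prod, lintegral_prod _ hF.aemeasurable]
  congr 1 with x
  by_cases hx : x ∈ A
  · simp only [indicator_of_mem hx, one_mul]
    rw [hQmass, lintegral_const_mul]
    exact hQm.of_uncurry_left
  · simp only [indicator_of_notMem hx, zero_mul, lintegral_zero]

theorem sliceMass_succ {p : ℝ → ℝ} (hp : Measurable p) (m : ℕ) (s : ℝ) :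
    sliceMass p (m + 2) s = ∫⁻ x, ENNReal.ofReal (p x) * sliceMass p (m + 1) (s - x) := by
  have := congrArg (fun μ => μ univ) (map_sliceMeasure_zero hp m s)
  beta_reduce at this
  rw [Measure.map_apply (measurable_pi_apply 0) MeasurableSet.univ, preimage_univ,
    withDensity_apply _ MeasurableSet.univ, Measure.restrict_univ] at this
  exact this

theorem sliceMass_one (p : ℝ → ℝ) (s : ℝ) : sliceMass p 1 s = ENNReal.ofReal (p s) := by
  rw [sliceMass_eq_lintegral]
  simp only [Finset.univ_unique, Finset.prod_singleton, Fin.default_eq_zero]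
  have : ∀ y : Fin (1 - 1) → ℝ, completeToSum 1 s y 0 = s := fun y => by
    simp [completeToSum]
  simp_rw [this]
  rw [lintegral_const]
  have : (volume : Measure (Fin (1 - 1) → ℝ)) univ = 1 := by
    rw [← pi_univ, volume_pi_pi]
    simp
  rw [this, mul_one]

section ConvPow

variable {C : ℝ} {f : ℝ → ℝ}

theorem measurable_convPow (hf : Measurable f) (k : ℕ) : Measurable (convPow f k) := by
  induction k with
  | zero => exact hf
  | succ k ih =>
    have : Measurable (Function.uncurry fun w v => f v * convPow f k (w - v)) :=
      (hf.comp measurable_snd).mul (ih.comp (measurable_fst.sub measurable_snd))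
    exact this.stronglyMeasurable.integral_prod_right.measurable

theorem convPow_nonneg (hf : ∀ v, 0 ≤ f v) (k : ℕ) (w : ℝ) : 0 ≤ convPow f k w := by
  induction k generalizing w with
  | zero => exact hf w
  | succ k ih => exact integral_nonneg fun v => mul_nonneg (hf v) (ih _)

theorem CenteredDensity.convPow_le (h : CenteredDensity C f) (k : ℕ) (w : ℝ) :
    convPow f k w ≤ C := by
  induction k generalizing w with
  | zero => exact (le_abs_self _).trans (h.abs_le w)
  | succ k ih =>
    calc ∫ v, f v * convPow f k (w - v) ≤ ∫ v, f v * C :=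
          integral_mono_of_nonneg
            (ae_of_all _ fun v => mul_nonneg (h.nonneg v) (convPow_nonneg h.nonneg k _))
            (h.integrable.mul_const C)
            (ae_of_all _ fun v => mul_le_mul_of_nonneg_left (ih _) (h.nonneg v))
      _ = C := by rw [integral_mul_const, h.integral_eq_one, one_mul]

theorem CenteredDensity.integrable_mul_convPow (h : CenteredDensity C f) (k : ℕ) (w : ℝ) :
    Integrable (fun v => f v * convPow f k (w - v)) := by
  refine (h.integrable.mul_const C).mono'
    (h.measurable.mul ((measurable_convPow h.measurable k).comp
      (measurable_const.sub measurable_id))).aestronglyMeasurable (ae_of_all _ fun v => ?_)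
  rw [Real.norm_eq_abs, abs_of_nonneg (mul_nonneg (h.nonneg v) (convPow_nonneg h.nonneg k _))]
  exact mul_le_mul_of_nonneg_left (h.convPow_le k _) (h.nonneg v)

/-- The mass of a slice is unchanged by exponential tilting and affine rescaling, up to the
obvious factors. -/
theorem sliceMass_eq_convPow (h : CenteredDensity C f) {p : ℝ → ℝ} (hp : Measurable p)
    {c t a σ : ℝ} (hc : 0 ≤ c) (hσ : 0 < σ)
    (hpf : ∀ x, p x = c * Real.exp (-(t * x)) * f ((x - a) / σ)) (k : ℕ) (s : ℝ) :
    sliceMass p (k + 1) s = ENNReal.ofReal (c ^ (k + 1) * σ ^ k * Real.exp (-(t * s)) *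
      convPow f k ((s - (k + 1) * a) / σ)) := by
  induction k generalizing s with
  | zero =>
    rw [zero_add, sliceMass_one, hpf]
    simp [convPow]
  | succ k ih =>
    rw [sliceMass_succ hp]
    simp_rw [ih]
    set w := (s - ((k + 1 : ℕ) + 1) * a) / σ with hw
    have e : ∀ x, ENNReal.ofReal (p x) * ENNReal.ofReal (c ^ (k + 1) * σ ^ k *
        Real.exp (-(t * (s - x))) * convPow f k ((s - x - (k + 1) * a) / σ)) =
        ENNReal.ofReal (c ^ (k + 2) * σ ^ k * Real.exp (-(t * s)) *
          (f ((x - a) / σ) * convPow f k (w - (x - a) / σ))) := by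
      intro x
      have hpx : 0 ≤ p x := by
        rw [hpf]
        exact mul_nonneg (by positivity) (h.nonneg _)
      rw [← ENNReal.ofReal_mul hpx, hpf]
      congr 1
      rw [show (s - x - (k + 1) * a) / σ = w - (x - a) / σ by rw [hw]; push_cast; ring,
        show -(t * s) = -(t * x) + -(t * (s - x)) by ring, Real.exp_add]
      ring
    simp_rw [e]
    have i1 : Integrable (fun x => f ((x - a) / σ) * convPow f k (w - (x - a) / σ)) :=
      ((h.integrable_mul_convPow k w).comp_div hσ.ne').comp_sub_right a
    rw [← ofReal_integral_eq_lintegral_ofReal (i1.const_mul _)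
      (ae_of_all _ fun x => mul_nonneg (by positivity)
        (mul_nonneg (h.nonneg _) (convPow_nonneg h.nonneg k _))), integral_const_mul,
      integral_sub_right_eq_self (fun x => f (x / σ) * convPow f k (w - x / σ)) a,
      Measure.integral_comp_div (fun v => f v * convPow f k (w - v)) σ, abs_of_pos hσ]
    congr 1
    rw [convPow, smul_eq_mul]
    ring

end ConvPow

/-! ### Gaussian limits of densities -/

theorem integral_sq_mul_exp_neg_pi_mul_sq :
    ∫ u : ℝ, u ^ 2 * Real.exp (-(Real.pi * u ^ 2)) = 1 / (2 * Real.pi) := by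
  have hpi := Real.pi_pos
  set s : NNReal := ⟨1 / (2 * Real.pi), by positivity⟩ with hs
  have hs' : (s : ℝ) = 1 / (2 * Real.pi) := rfl
  have hs0 : s ≠ 0 := by
    intro h
    have : (s : ℝ) = 0 := by rw [h]; rfl
    rw [hs'] at this
    exact absurd this (by positivity)
  have h1 := variance_id_gaussianReal (μ := 0) (v := s)
  rw [variance_eq_integral aemeasurable_id] at h1
  simp only [id_eq, integral_id_gaussianReal, sub_zero] at h1
  rw [integral_gaussianReal_eq_integral_smul hs0] at h1
  rw [← hs', ← h1]
  congr 1 with u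
  have e : 2 * Real.pi * (s : ℝ) = 1 := by rw [hs']; field_simp
  rw [gaussianPDFReal, e, smul_eq_mul, Real.sqrt_one, inv_one, one_mul, mul_comm, sub_zero]
  congr 2
  rw [hs']
  field_simp

theorem fourierReal_exp_neg_pi_mul_sq (ξ : ℝ) :
    fourierReal (fun u => Real.exp (-(Real.pi * u ^ 2))) ξ = Real.exp (-(Real.pi * ξ ^ 2)) := by
  have := congrFun (fourier_gaussian_pi (b := 1) (by simp)) ξ
  rw [fourierReal]
  simpa using this

/-- Densities, not necessarily normalized or centred, which converge pointwise to `exp (-π v²)`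
under a common exponential bound. -/
structure GaussianLimit {ι : Type*} (l : Filter ι) (C : ℝ) (k : ι → ℝ → ℝ) : Prop where
  measurable : ∀ i, Measurable (k i)
  nonneg : ∀ i v, 0 ≤ k i v
  le_exp : ∀ᶠ i in l, ∀ v, k i v ≤ C * Real.exp (-|v|)
  tendsto : ∀ v, Tendsto (fun i => k i v) l (𝓝 (Real.exp (-(Real.pi * v ^ 2))))

/-- The mean of the probability density proportional to `k`. -/
noncomputable def meanOf (k : ℝ → ℝ) : ℝ := (∫ v, v * k v) / ∫ v, k v

/-- The probability density proportional to `k`, centred at its mean. -/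
noncomputable def centerOf (k : ℝ → ℝ) (v : ℝ) : ℝ := k (v + meanOf k) / ∫ v, k v

theorem measurable_centerOf {k : ℝ → ℝ} (hk : Measurable k) : Measurable (centerOf k) := by
  unfold centerOf
  fun_prop

namespace GaussianLimit

variable {ι : Type*} {l : Filter ι} {C : ℝ} {k : ι → ℝ → ℝ}

theorem comp {κ : Type*} {l' : Filter κ} (h : GaussianLimit l C k) {u : κ → ι}
    (hu : Tendsto u l' l) : GaussianLimit l' C (fun j => k (u j)) where
  measurable _ := h.measurable _
  nonneg _ := h.nonneg _
  le_exp := hu.eventually h.le_exp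
  tendsto v := (h.tendsto v).comp hu

theorem norm_pow_mul_le {g : ℝ → ℝ} (h0 : ∀ v, 0 ≤ g v) (hg : ∀ v, g v ≤ C * Real.exp (-|v|))
    (j : ℕ) (v : ℝ) : ‖v ^ j * g v‖ ≤ C * (|v| ^ j * Real.exp (-|v|)) := by
  rw [norm_mul, norm_pow, Real.norm_eq_abs, Real.norm_eq_abs, abs_of_nonneg (h0 v)]
  calc |v| ^ j * g v ≤ |v| ^ j * (C * Real.exp (-|v|)) := by gcongr; exact hg v
    _ = _ := by ring

theorem eventually_integrable (h : GaussianLimit l C k) (j : ℕ) :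
    ∀ᶠ i in l, Integrable (fun v => v ^ j * k i v) := by
  filter_upwards [h.le_exp] with i hi
  have := h.measurable i
  exact ((integrable_abs_pow_mul_exp_neg_abs j).const_mul C).mono'
    (Measurable.aestronglyMeasurable (by fun_prop))
    (ae_of_all _ (norm_pow_mul_le (h.nonneg i) hi j))

variable [l.IsCountablyGenerated]

theorem tendsto_moment (h : GaussianLimit l C k) (j : ℕ) :
    Tendsto (fun i => ∫ v, v ^ j * k i v) l
      (𝓝 (∫ v : ℝ, v ^ j * Real.exp (-(Real.pi * v ^ 2)))) := by
  refine tendsto_integral_filter_of_dominated_convergence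
    (fun v => C * (|v| ^ j * Real.exp (-|v|))) (Eventually.of_forall fun i => ?_) ?_
    ((integrable_abs_pow_mul_exp_neg_abs j).const_mul C)
    (ae_of_all _ fun v => (h.tendsto v).const_mul _)
  · have := h.measurable i
    exact Measurable.aestronglyMeasurable (by fun_prop)
  · filter_upwards [h.le_exp] with i hi
    exact ae_of_all _ (norm_pow_mul_le (h.nonneg i) hi j)

theorem tendsto_integral (h : GaussianLimit l C k) : Tendsto (fun i => ∫ v, k i v) l (𝓝 1) := by
  have := h.tendsto_moment 0
  simpa only [pow_zero, one_mul, integral_exp_neg_pi_mul_sq] using this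

theorem tendsto_meanOf (h : GaussianLimit l C k) : Tendsto (fun i => meanOf (k i)) l (𝓝 0) := by
  have := h.tendsto_moment 1
  simp only [pow_one, integral_mul_exp_neg_pi_mul_sq] at this
  have t := this.div h.tendsto_integral one_ne_zero
  rwa [zero_div] at t

theorem tendsto_integral_abs_sub (h : GaussianLimit l C k) :
    Tendsto (fun i => ∫ v, |k i v - Real.exp (-(Real.pi * v ^ 2))|) l (𝓝 0) := by
  have hi : Integrable (fun v : ℝ => Real.exp (-(Real.pi * v ^ 2))) := by
    simpa using integrable_pow_mul_exp_neg_sq 0 Real.pi_pos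
  have h0 := integrable_abs_pow_mul_exp_neg_abs 0
  simp only [pow_zero, one_mul] at h0
  rw [← integral_zero ℝ ℝ (μ := volume)]
  refine tendsto_integral_filter_of_dominated_convergence
    (fun v => C * Real.exp (-|v|) + Real.exp (-(Real.pi * v ^ 2)))
    (Eventually.of_forall fun i => ?_) ?_ ((h0.const_mul C).add hi)
    (ae_of_all _ fun v => ?_)
  · have := h.measurable i
    exact Measurable.aestronglyMeasurable (by fun_prop)
  · filter_upwards [h.le_exp] with i hi
    refine ae_of_all _ fun v => ?_
    rw [Real.norm_eq_abs, abs_abs]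
    refine (abs_sub _ _).trans ?_
    rw [abs_of_nonneg (h.nonneg i v), abs_of_pos (Real.exp_pos _)]
    gcongr
    exact hi v
  · have := ((h.tendsto v).sub_const (Real.exp (-(Real.pi * v ^ 2)))).abs
    simpa using this

theorem eventually_half_lt_integral (h : GaussianLimit l C k) :
    ∀ᶠ i in l, 1 / 2 < ∫ v, k i v :=
  h.tendsto_integral.eventually (lt_mem_nhds (by norm_num))

end GaussianLimit

theorem integral_mul_centerOf (k φ : ℝ → ℝ) :
    ∫ v, φ v * centerOf k v = (∫ v, φ (v - meanOf k) * k v) / ∫ v, k v := by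
  rw [← integral_add_right_eq_self (fun v => φ (v - meanOf k) * k v) (meanOf k), ← integral_div]
  congr 1 with v
  rw [centerOf, add_sub_cancel_right, mul_div_assoc]

theorem norm_fourierReal_centerOf (k : ℝ → ℝ) (h0 : 0 ≤ ∫ v, k v) (ξ : ℝ) :
    ‖fourierReal (centerOf k) ξ‖ = ‖fourierReal k ξ‖ / ∫ v, k v := by
  have e : fourierReal (centerOf k) ξ =
      Complex.exp ((2 * Real.pi * meanOf k * ξ : ℝ) * Complex.I) *
        (fourierReal k ξ / (∫ v, k v : ℝ)) := by
    rw [fourierReal_eq, fourierReal_eq, ← integral_div, ← integral_const_mul,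
      ← integral_add_right_eq_self (fun v => Complex.exp ((2 * Real.pi * meanOf k * ξ : ℝ) *
        Complex.I) * (Complex.exp ((-2 * Real.pi * v * ξ : ℝ) * Complex.I) * k v /
          (∫ v, k v : ℝ))) (meanOf k)]
    congr 1 with v
    rw [centerOf, Complex.ofReal_div, show ((-2 * Real.pi * v * ξ : ℝ) : ℂ) * Complex.I =
      (2 * Real.pi * meanOf k * ξ : ℝ) * Complex.I +
        (-2 * Real.pi * (v + meanOf k) * ξ : ℝ) * Complex.I by push_cast; ring, Complex.exp_add]
    ring
  rw [e, norm_mul, Complex.norm_exp_ofReal_mul_I, one_mul, norm_div, Complex.norm_real,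
    Real.norm_eq_abs, abs_of_nonneg h0]

namespace GaussianLimit

variable {C : ℝ} {k : ℕ → ℝ → ℝ}

theorem eventually_centeredDensity (h : GaussianLimit atTop C k) :
    ∀ᶠ n in atTop, CenteredDensity (2 * (C * Real.exp 1)) (centerOf (k n)) := by
  have hm : ∀ᶠ n in atTop, |meanOf (k n)| ≤ 1 := by
    have := h.tendsto_meanOf.abs
    rw [abs_zero] at this
    exact this.eventually (ge_mem_nhds one_pos)
  filter_upwards [h.le_exp, h.eventually_half_lt_integral, h.eventually_integrable 0,
    h.eventually_integrable 1, hm] with n h1 h2 i0 i1 hm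
  simp only [pow_zero, one_mul] at i0
  simp only [pow_one] at i1
  have hJ : 0 < ∫ v, k n v := by linarith
  have hC : 0 ≤ C := by simpa using (h.nonneg n 0).trans (h1 0)
  refine ⟨?_, fun v => div_nonneg (h.nonneg _ _) hJ.le, fun v => ?_, ?_, ?_⟩
  · exact measurable_centerOf (h.measurable n)
  · rw [centerOf, div_le_iff₀ hJ]
    have e1 : Real.exp (-|v + meanOf (k n)|) ≤ Real.exp 1 * Real.exp (-|v|) := by
      rw [← Real.exp_add]
      refine Real.exp_le_exp.2 ?_
      have := abs_sub_abs_le_abs_sub v (-meanOf (k n))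
      rw [abs_neg, sub_neg_eq_add] at this
      linarith
    have e2 : 0 ≤ C * Real.exp 1 * Real.exp (-|v|) := by positivity
    calc k n (v + meanOf (k n)) ≤ C * Real.exp (-|v + meanOf (k n)|) := h1 _
      _ ≤ C * (Real.exp 1 * Real.exp (-|v|)) := by gcongr
      _ = 2 * (C * Real.exp 1 * Real.exp (-|v|)) * (1 / 2) := by ring
      _ ≤ 2 * (C * Real.exp 1 * Real.exp (-|v|)) * ∫ v, k n v := by gcongr
      _ = _ := by ring
  · have := integral_mul_centerOf (k n) (fun _ => 1)
    simp only [one_mul] at this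
    rw [this, div_self hJ.ne']
  · rw [integral_mul_centerOf (k n) (fun v => v)]
    simp only [sub_mul]
    rw [integral_sub i1 (i0.const_mul _), integral_const_mul, meanOf, div_mul_cancel₀ _ hJ.ne',
      sub_self, zero_div]

theorem tendsto_variance_centerOf (h : GaussianLimit atTop C k) :
    Tendsto (fun n => ∫ v, v ^ 2 * centerOf (k n) v) atTop (𝓝 (1 / (2 * Real.pi))) := by
  have t1 := h.tendsto_moment 1
  have t2 := h.tendsto_moment 2
  have tm := h.tendsto_meanOf
  have tJ := h.tendsto_integral
  have t := ((t2.sub ((tm.const_mul 2).mul t1)).add ((tm.pow 2).mul tJ)).div tJ one_ne_zero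
  simp only [integral_sq_mul_exp_neg_pi_mul_sq] at t
  simp only [mul_zero, zero_mul, sub_zero, ne_eq, OfNat.ofNat_ne_zero, not_false_eq_true,
    zero_pow, add_zero, div_one] at t
  refine t.congr' ?_
  filter_upwards [h.eventually_integrable 0, h.eventually_integrable 1,
    h.eventually_integrable 2] with n i0 i1 i2
  simp only [pow_zero, one_mul] at i0
  simp only [pow_one] at i1
  have e : ∀ v, (v - meanOf (k n)) ^ 2 * k n v =
      v ^ 2 * k n v - 2 * meanOf (k n) * (v * k n v) + meanOf (k n) ^ 2 * k n v :=
    fun v => by ring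
  have i3 : Integrable (fun v => v ^ 2 * k n v - 2 * meanOf (k n) * (v * k n v)) :=
    i2.sub (i1.const_mul _)
  rw [integral_mul_centerOf (k n) (fun v => v ^ 2)]
  simp_rw [e]
  rw [integral_add i3 (i0.const_mul _), integral_sub i2 (i1.const_mul _), integral_const_mul,
    integral_const_mul]
  simp only [Pi.div_apply, pow_one]

/-- The total variation limit bounds the Fourier transforms away from `1` outside every
neighbourhood of the origin. -/
theorem exists_norm_fourierReal_centerOf_le (h : GaussianLimit atTop C k) {δ : ℝ} (hδ : 0 < δ) :
    ∃ ρ : ℝ, 0 ≤ ρ ∧ ρ < 1 ∧ ∀ᶠ n in atTop, ∀ ξ, δ ≤ |ξ| →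
      ‖fourierReal (centerOf (k n)) ξ‖ ≤ ρ := by
  set E := Real.exp (-(Real.pi * δ ^ 2)) with hE
  have hE0 : 0 < E := Real.exp_pos _
  have hE1 : E < 1 := by
    rw [hE, Real.exp_lt_one_iff]
    have := Real.pi_pos
    simp only [neg_lt_zero]
    positivity
  have t : Tendsto (fun n => (E + ∫ v, |k n v - Real.exp (-(Real.pi * v ^ 2))|) / ∫ v, k n v) atTop
      (𝓝 ((E + 0) / 1)) :=
    (h.tendsto_integral_abs_sub.const_add E).div h.tendsto_integral one_ne_zero
  have hlt : (E + 0) / 1 < (1 + E) / 2 := by rw [add_zero, div_one]; linarith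
  refine ⟨(1 + E) / 2, by positivity, by linarith, ?_⟩
  have iG : Integrable (fun v : ℝ => Real.exp (-(Real.pi * v ^ 2))) := by
    simpa using integrable_pow_mul_exp_neg_sq 0 Real.pi_pos
  filter_upwards [t.eventually (gt_mem_nhds hlt), h.eventually_half_lt_integral,
    h.eventually_integrable 0] with n hn hJ i0 ξ hξ
  simp only [pow_zero, one_mul] at i0
  have hJ0 : 0 < ∫ v, k n v := by linarith
  refine le_trans ?_ hn.le
  rw [norm_fourierReal_centerOf _ hJ0.le]
  gcongr
  have e : fourierReal (k n) ξ = fourierReal (fun v => Real.exp (-(Real.pi * v ^ 2))) ξ +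
      fourierReal (fun v => k n v - Real.exp (-(Real.pi * v ^ 2))) ξ := by
    have hb : ∀ g : ℝ → ℝ, Integrable g → Integrable
        (fun v => Complex.exp ((-2 * Real.pi * v * ξ : ℝ) * Complex.I) * g v) := fun g hg =>
      hg.ofReal.bdd_mul (c := 1) (Continuous.aestronglyMeasurable (by fun_prop))
        (ae_of_all _ fun v => by rw [Complex.norm_exp_ofReal_mul_I])
    have iD : Integrable (fun v => k n v - Real.exp (-(Real.pi * v ^ 2))) := i0.sub iG
    rw [fourierReal_eq, fourierReal_eq, fourierReal_eq, ← integral_add (hb _ iG) (hb _ iD)]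
    congr 1 with v
    push_cast
    ring
  rw [e, fourierReal_exp_neg_pi_mul_sq]
  refine (norm_add_le _ _).trans (add_le_add ?_ (norm_fourierReal_le _ _))
  rw [Complex.norm_real, Real.norm_eq_abs, abs_of_pos (Real.exp_pos _), hE]
  refine Real.exp_le_exp.2 (neg_le_neg ?_)
  rw [← sq_abs ξ]
  gcongr

theorem localLimitArray (h : GaussianLimit atTop C k) :
    LocalLimitArray (2 * (C * Real.exp 1)) (fun n => centerOf (k n)) where
  centered := h.eventually_centeredDensity
  variance := h.tendsto_variance_centerOf
  far _ hδ := h.exists_norm_fourierReal_centerOf_le hδ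

end GaussianLimit

/-! ### Laplace's method for tilted densities -/

/-- A density of the form `c * exp (-(g - q))` on the positive half-line, where `q` vanishes at
infinity and the derivative `h` of `g` is monotone on `[A, ∞)`. -/
structure TailDensity (p g h q : ℝ → ℝ) (c A : ℝ) : Prop where
  measurable : Measurable p
  nonneg : ∀ x, 0 ≤ p x
  bdd : ∃ M : ℝ, ∀ x, p x ≤ M
  c_pos : 0 < c
  form : ∀ x, 0 < x → p x = c * Real.exp (-(g x - q x))
  hasDerivAt : ∀ x, 0 < x → HasDerivAt g (h x) x
  q_tendsto : Tendsto q atTop (𝓝 0)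
  A_pos : 0 < A
  mono : MonotoneOn h (Ici A)

/-- Centring `b t` and scale `σ t` for the Laplace method with parameter `t`: around `b t`, on the
scale `σ t`, the function `h - t` is asymptotically linear with slope `2 π`. -/
structure LaplaceScale (h : ℝ → ℝ) (b σ : ℝ → ℝ) : Prop where
  center : Tendsto b atTop atTop
  pos : ∀ᶠ t in atTop, 0 < σ t
  ratio : Tendsto (fun t => σ t / b t) atTop (𝓝 0)
  mul_param : Tendsto (fun t => t * σ t) atTop atTop
  slope : ∀ w, Tendsto (fun t => σ t * (h (b t + σ t * w) - t)) atTop (𝓝 (2 * Real.pi * w))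

/-- The unnormalized tilted density with parameter `t` on the scale `σ` around `b`. -/
noncomputable def rescaled (p g : ℝ → ℝ) (c t b σ v : ℝ) : ℝ :=
  Real.exp (t * (σ * v) + g b) * p (b + σ * v) / c

theorem LaplaceScale.tendsto_add {h b σ : ℝ → ℝ} (hS : LaplaceScale h b σ) (v : ℝ) :
    Tendsto (fun t => b t + σ t * v) atTop atTop := by
  have h1 : Tendsto (fun t => 1 + σ t / b t * v) atTop (𝓝 1) := by
    simpa using (hS.ratio.mul_const v).const_add 1
  refine (hS.center.atTop_mul_pos one_pos h1).congr' ?_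
  filter_upwards [hS.center.eventually_gt_atTop 0] with t ht
  field_simp

/-- A concave function on `[-L, ∞)` which vanishes at `0` and lies between `-4` and `-1` at `±1`
is at most `5 - |v|`. -/
theorem concaveOn_le_of_values {G : ℝ → ℝ} {L : ℝ} (hG : ConcaveOn ℝ (Ici (-L)) G) (hL : 1 ≤ L)
    (h0 : G 0 = 0) (h1 : G 1 ≤ -1) (h1' : -4 ≤ G 1) (h2 : G (-1) ≤ -1) (h2' : -4 ≤ G (-1))
    {v : ℝ} (hv : -L ≤ v) : G v ≤ 5 - |v| := by
  -- On `[-1, 1]` the value at the opposite end point bounds `G v` from above, as `0` lies between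
  -- the two; beyond `±1` concavity continues the descent from `0` to `±1`.
  have m0 : (0 : ℝ) ∈ Ici (-L) := by simp only [mem_Ici]; linarith
  have m1 : (1 : ℝ) ∈ Ici (-L) := by simp only [mem_Ici]; linarith
  have m2 : (-1 : ℝ) ∈ Ici (-L) := by simp only [mem_Ici]; linarith
  have key : ∀ x y : ℝ, x ∈ Ici (-L) → y ∈ Ici (-L) → ∀ a b : ℝ, 0 ≤ a → 0 ≤ b → a + b = 1 →
      a * G x + b * G y ≤ G (a * x + b * y) := fun x y hx hy a b ha hb hab => by
    simpa using hG.2 hx hy ha hb hab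
  rcases le_total 0 v with h | h
  · rw [abs_of_nonneg h]
    rcases le_total v 1 with hv1 | hv1
    · have := key v (-1) hv m2 (1 / (1 + v)) (v / (1 + v)) (by positivity) (by positivity)
        (by field_simp)
      rw [show 1 / (1 + v) * v + v / (1 + v) * -1 = 0 by ring, h0] at this
      have e : 1 / (1 + v) * G v + v / (1 + v) * G (-1) = (G v + v * G (-1)) / (1 + v) := by ring
      rw [e, div_le_iff₀ (by positivity)] at this
      nlinarith
    · have hv0 : 0 < v := by linarith
      have := key v 0 hv m0 (1 / v) (1 - 1 / v) (by positivity)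
        (by rw [sub_nonneg, div_le_one hv0]; exact hv1) (by ring)
      rw [show 1 / v * v + (1 - 1 / v) * 0 = 1 by field_simp; ring, h0, mul_zero, add_zero,
        one_div_mul_eq_div, div_le_iff₀ hv0] at this
      nlinarith
  · rw [abs_of_nonpos h]
    rcases le_total (-1) v with hv1 | hv1
    · have hv3 : 0 < 1 - v := by linarith
      have := key v 1 hv m1 (1 / (1 - v)) (-v / (1 - v)) (by positivity)
        (div_nonneg (by linarith) hv3.le) (by field_simp; ring)
      rw [show 1 / (1 - v) * v + -v / (1 - v) * 1 = 0 by ring, h0] at this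
      have e : 1 / (1 - v) * G v + -v / (1 - v) * G 1 = (G v - v * G 1) / (1 - v) := by ring
      rw [e, div_le_iff₀ hv3] at this
      nlinarith
    · have hv0 : 0 < -v := by linarith
      have := key v 0 hv m0 (1 / -v) (1 - 1 / -v) (by positivity)
        (by rw [sub_nonneg, div_le_one hv0]; linarith) (by ring)
      have hvn : v ≠ 0 := (neg_pos.1 hv0).ne
      rw [show 1 / -v * v + (1 - 1 / -v) * 0 = -1 by field_simp; ring, h0, mul_zero, add_zero,
        one_div_mul_eq_div, div_le_iff₀ hv0] at this
      nlinarith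

/-- The exponent of the tilted density on the scale `σ` around `b`, relative to its value
at `b`. -/
noncomputable def localExponent (g : ℝ → ℝ) (t b σ v : ℝ) : ℝ :=
  t * (σ * v) - g (b + σ * v) + g b

namespace TailDensity

variable {p g h q : ℝ → ℝ} {c A : ℝ} {b σ : ℝ → ℝ}

theorem hasDerivAt_localExponent (H : TailDensity p g h q c A) {t b σ v : ℝ}
    (hv : 0 < b + σ * v) :
    HasDerivAt (localExponent g t b σ) (-(σ * (h (b + σ * v) - t))) v := by
  have h1 : HasDerivAt (fun v => b + σ * v) σ v := by
    simpa using ((hasDerivAt_id v).const_mul σ).const_add b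
  have h2 : HasDerivAt (fun v => g (b + σ * v)) (h (b + σ * v) * σ) v :=
    (H.hasDerivAt _ hv).comp v h1
  have h3 : HasDerivAt (fun v => t * (σ * v)) (t * σ) v := by
    simpa using ((hasDerivAt_id v).const_mul σ).const_mul t
  refine ((h3.sub h2).add_const (g b)).congr_deriv ?_
  ring

theorem concaveOn_localExponent (H : TailDensity p g h q c A) {t b σ : ℝ} (hσ : 0 < σ) :
    ConcaveOn ℝ (Ici (-((b - A) / σ))) (localExponent g t b σ) := by
  have hA : ∀ v ∈ Ici (-((b - A) / σ)), A ≤ b + σ * v := fun v hv => by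
    rw [mem_Ici, neg_le, le_div_iff₀' hσ] at hv
    linarith
  have hd : ∀ v ∈ Ici (-((b - A) / σ)), HasDerivAt (localExponent g t b σ)
      (-(σ * (h (b + σ * v) - t))) v := fun v hv =>
    H.hasDerivAt_localExponent (H.A_pos.trans_le (hA v hv))
  refine AntitoneOn.concaveOn_of_deriv (convex_Ici _)
    (fun v hv => (hd v hv).continuousAt.continuousWithinAt)
    (fun v hv => (hd v (interior_subset hv)).differentiableAt.differentiableWithinAt) ?_
  intro x hx y hy hxy
  rw [(hd x (interior_subset hx)).deriv, (hd y (interior_subset hy)).deriv]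
  have := H.mono (hA x (interior_subset hx)) (hA y (interior_subset hy))
    (by gcongr : b + σ * x ≤ b + σ * y)
  gcongr

/-- Local quadratic behaviour of the exponent. -/
theorem tendsto_localExponent (H : TailDensity p g h q c A) (hS : LaplaceScale h b σ) (v : ℝ) :
    Tendsto (fun t => localExponent g t (b t) (σ t) v) atTop (𝓝 (-(Real.pi * v ^ 2))) := by
  have hpos : ∀ᶠ t in atTop, ∀ w ∈ uIcc 0 v, A ≤ b t + σ t * w := by
    filter_upwards [hS.pos, (hS.tendsto_add v).eventually_ge_atTop A,
      (hS.tendsto_add 0).eventually_ge_atTop A] with t h1 h2 h3 w hw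
    rcases le_total 0 v with hv | hv
    · rw [uIcc_of_le hv] at hw
      have := mul_le_mul_of_nonneg_left hw.1 h1.le
      linarith
    · rw [uIcc_of_ge hv] at hw
      have := mul_le_mul_of_nonneg_left hw.1 h1.le
      linarith
  -- Monotonicity supplies both the integrability and the domination of the derivative.
  have hmono : ∀ᶠ t in atTop, MonotoneOn (fun w => σ t * (h (b t + σ t * w) - t)) (uIcc 0 v) := by
    filter_upwards [hS.pos, hpos] with t h1 h2 x hx y hy hxy
    have := H.mono (h2 x hx) (h2 y hy) (by gcongr : b t + σ t * x ≤ b t + σ t * y)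
    simp only
    gcongr
  have hlim : Tendsto (fun t => ∫ w in (0 : ℝ)..v, σ t * (h (b t + σ t * w) - t)) atTop
      (𝓝 (∫ w in (0 : ℝ)..v, 2 * Real.pi * w)) := by
    refine intervalIntegral.tendsto_integral_filter_of_dominated_convergence
      (fun _ => 1 + |2 * Real.pi * v|) ?_ ?_ intervalIntegrable_const
      (ae_of_all _ fun w _ => hS.slope w)
    · filter_upwards [hmono] with t ht
      exact (intervalIntegrable_iff.1 ht.intervalIntegrable).aestronglyMeasurable
    · have s0 := hS.slope 0
      have sv := hS.slope v
      rw [mul_zero] at s0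
      have l0 := s0.abs.eventually (ge_mem_nhds (by simp : |(0 : ℝ)| < 1))
      have lv := sv.abs.eventually (ge_mem_nhds (by linarith :
        |2 * Real.pi * v| < 1 + |2 * Real.pi * v|))
      filter_upwards [hmono, l0, lv] with t ht h0 hv
      refine ae_of_all _ fun w hw => ?_
      have hw' := uIoc_subset_uIcc hw
      have hb := abs_nonneg (2 * Real.pi * v)
      rw [abs_le] at h0 hv
      rw [Real.norm_eq_abs, abs_le]
      rcases le_total 0 v with hv0 | hv0
      · rw [uIcc_of_le hv0] at hw' ht
        have a1 := ht (left_mem_Icc.2 hv0) hw' hw'.1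
        have a2 := ht hw' (right_mem_Icc.2 hv0) hw'.2
        simp only at a1 a2
        constructor <;> linarith
      · rw [uIcc_of_ge hv0] at hw' ht
        have a1 := ht (left_mem_Icc.2 hv0) hw' hw'.1
        have a2 := ht hw' (right_mem_Icc.2 hv0) hw'.2
        simp only at a1 a2
        constructor <;> linarith
  have hval : ∫ w in (0 : ℝ)..v, 2 * Real.pi * w = Real.pi * v ^ 2 := by
    rw [intervalIntegral.integral_const_mul, integral_id]
    ring
  rw [hval] at hlim
  refine hlim.neg.congr' ?_
  filter_upwards [hmono, hpos] with t h1 h2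
  have ftc := intervalIntegral.integral_eq_sub_of_hasDerivAt
    (fun w hw => H.hasDerivAt_localExponent (t := t) (H.A_pos.trans_le (h2 w hw)))
    h1.intervalIntegrable.neg
  have e0 : localExponent g t (b t) (σ t) 0 = 0 := by simp [localExponent]
  rw [e0, sub_zero] at ftc
  rw [← ftc, intervalIntegral.integral_neg]

theorem rescaled_eq (H : TailDensity p g h q c A) {t b σ v : ℝ} (hv : 0 < b + σ * v) :
    rescaled p g c t b σ v = Real.exp (localExponent g t b σ v + q (b + σ * v)) := by
  have hc := H.c_pos.ne'
  rw [rescaled, H.form _ hv, localExponent, mul_left_comm, mul_div_cancel_left₀ _ hc,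
    ← Real.exp_add]
  congr 1
  ring

/-- Concavity of the exponent turns the local quadratic behaviour into a global exponential bound;
to the left of `A` the tilting factor itself decays at least as fast, since `t * σ t ≥ 1`. -/
theorem exists_rescaled_le (H : TailDensity p g h q c A) (hq : ∀ x, A ≤ x → q x ≤ 1)
    (hS : LaplaceScale h b σ) :
    ∃ C : ℝ, ∀ᶠ t in atTop, ∀ v, rescaled p g c t (b t) (σ t) v ≤ C * Real.exp (-|v|) := by
  obtain ⟨M, hM⟩ := H.bdd
  have hM0 : 0 ≤ M := (H.nonneg 0).trans (hM 0)
  have hc := H.c_pos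
  -- The first constant serves the points to the right of `A`, where `q ≤ 1`; the second one serves
  -- those to the left, where only `p ≤ M` is known.
  refine ⟨max (Real.exp 6) (M / c * Real.exp (5 + g A)), ?_⟩
  have hpi1 := Real.pi_gt_three
  have hpi2 := Real.pi_lt_four
  have e1 : -(Real.pi * 1 ^ 2) = -Real.pi := by ring
  have e2 : -(Real.pi * (-1) ^ 2) = -Real.pi := by ring
  have t1 := H.tendsto_localExponent hS 1
  have t2 := H.tendsto_localExponent hS (-1)
  rw [e1] at t1
  rw [e2] at t2
  have hlt : -Real.pi < -1 := by linarith
  have hgt : -4 < -Real.pi := by linarith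
  filter_upwards [t1.eventually (ge_mem_nhds hlt), t1.eventually (le_mem_nhds hgt),
    t2.eventually (ge_mem_nhds hlt), t2.eventually (le_mem_nhds hgt), hS.pos,
    hS.mul_param.eventually_ge_atTop 1, (hS.tendsto_add (-1)).eventually_ge_atTop A]
    with t a1 a2 a3 a4 hσ htσ hA v
  have hL : 1 ≤ (b t - A) / σ t := by
    rw [le_div_iff₀ hσ]
    linarith
  have hG : ∀ v, -((b t - A) / σ t) ≤ v → localExponent g t (b t) (σ t) v ≤ 5 - |v| := fun v hv =>
    concaveOn_le_of_values (H.concaveOn_localExponent hσ) hL (by simp [localExponent])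
      a1 a2 a3 a4 hv
  have hbL : b t + σ t * -((b t - A) / σ t) = A := by
    field_simp
    ring
  rcases le_or_gt (-((b t - A) / σ t)) v with hv | hv
  · have hAv : A ≤ b t + σ t * v := by
      rw [← hbL]
      gcongr
    rw [H.rescaled_eq (H.A_pos.trans_le hAv)]
    calc Real.exp (localExponent g t (b t) (σ t) v + q (b t + σ t * v))
        ≤ Real.exp (6 + -|v|) := by
          refine Real.exp_le_exp.2 ?_
          have := hG v hv
          have := hq _ hAv
          linarith
      _ = Real.exp 6 * Real.exp (-|v|) := Real.exp_add _ _
      _ ≤ _ := by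
          gcongr
          exact le_max_left _ _
  · have hGL := hG _ le_rfl
    rw [localExponent, hbL] at hGL
    -- The bound at the left end `-L`, which corresponds to the point `A`, is continued to `v < -L`
    -- by the factor `exp (t σ t v)`.
    set L := (b t - A) / σ t with hLdef
    have hv0 : v ≤ 0 := by linarith
    have hLabs : |(-L)| = L := by rw [abs_neg, abs_of_nonneg (by linarith)]
    rw [hLabs] at hGL
    rw [abs_of_nonpos hv0]
    have key : t * (σ t * v) + g (b t) ≤ 5 + g A + - -v := by
      have : (t * σ t) * (v + L) ≤ 1 * (v + L) :=
        mul_le_mul_of_nonpos_right htσ (by linarith)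
      nlinarith
    calc rescaled p g c t (b t) (σ t) v
        ≤ Real.exp (5 + g A + - -v) * M / c := by
          rw [rescaled]
          gcongr
          · exact H.nonneg _
          · exact hM _
      _ = M / c * Real.exp (5 + g A) * Real.exp (- -v) := by rw [Real.exp_add]; ring
      _ ≤ _ := by
          gcongr
          exact le_max_right _ _

/-- **Laplace's method**: on the scale `σ t` around `b t` the tilted densities converge to a
Gaussian density under a common exponential bound. -/
theorem exists_gaussianLimit (H : TailDensity p g h q c A) (hq : ∀ x, A ≤ x → q x ≤ 1)
    (hS : LaplaceScale h b σ) :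
    ∃ C : ℝ, GaussianLimit atTop C (fun t => rescaled p g c t (b t) (σ t)) := by
  obtain ⟨C, hC⟩ := H.exists_rescaled_le hq hS
  refine ⟨C, fun t => ?_, fun t v => ?_, hC, fun v => ?_⟩
  · have := H.measurable
    unfold rescaled
    fun_prop
  · exact div_nonneg (mul_nonneg (Real.exp_pos _).le (H.nonneg _)) H.c_pos.le
  · have t1 := (H.tendsto_localExponent hS v).add (H.q_tendsto.comp (hS.tendsto_add v))
    rw [add_zero] at t1
    refine ((Real.continuous_exp.tendsto _).comp t1).congr' ?_
    filter_upwards [(hS.tendsto_add v).eventually_gt_atTop 0] with t ht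
    exact (H.rescaled_eq ht).symm

end TailDensity

/-! ### Laplace scales for regularly varying exponents -/

/-- `f (y t) / f (b t) → 1` whenever `b t → ∞` and `y t / b t → 1`. -/
def RatioContinuous (f : ℝ → ℝ) : Prop :=
  ∀ b y : ℝ → ℝ, Tendsto b atTop atTop → Tendsto (fun t => y t / b t) atTop (𝓝 1) →
    Tendsto (fun t => f (y t) / f (b t)) atTop (𝓝 1)

theorem tendsto_of_div_tendsto_one {b y : ℝ → ℝ} (hb : Tendsto b atTop atTop)
    (hy : Tendsto (fun t => y t / b t) atTop (𝓝 1)) : Tendsto y atTop atTop := by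
  refine (hb.atTop_mul_pos one_pos hy).congr' ?_
  filter_upwards [hb.eventually_gt_atTop 0] with t ht
  field_simp

namespace RatioContinuous

variable {f f' F : ℝ → ℝ}

theorem id : RatioContinuous (fun x => x) := fun _ _ _ hy => hy

theorem mul (hf : RatioContinuous f) (hF : RatioContinuous F) :
    RatioContinuous (fun x => f x * F x) := fun b y hb hy => by
  have := (hf b y hb hy).mul (hF b y hb hy)
  rw [one_mul] at this
  exact this.congr fun t => (mul_div_mul_comm _ _ _ _).symm

theorem div (hf : RatioContinuous f) (hF : RatioContinuous F) :
    RatioContinuous (fun x => f x / F x) := fun b y hb hy => by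
  have := (hf b y hb hy).div (hF b y hb hy) one_ne_zero
  rw [div_one] at this
  exact this.congr fun t => div_div_div_comm _ _ _ _

theorem of_tendsto {a : ℝ} (ha : a ≠ 0) (hf : Tendsto f atTop (𝓝 a)) : RatioContinuous f :=
  fun b y hb hy => by
    have := (hf.comp (tendsto_of_div_tendsto_one hb hy)).div (hf.comp hb) ha
    rwa [div_self ha] at this

/-- A bounded elasticity makes `log f` Lipschitz in `log x`. -/
theorem of_deriv (hd : ∀ᶠ x in atTop, HasDerivAt f (f' x) x) (hpos : ∀ᶠ x in atTop, 0 < f x)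
    {E : ℝ} (hE : ∀ᶠ x in atTop, |x * f' x| ≤ E * f x) : RatioContinuous f := by
  intro b y hb hy
  obtain ⟨S, hS⟩ := eventually_atTop.1 (Real.tendsto_exp_atTop.eventually (hd.and (hpos.and hE)))
  have hlip : ∀ s ∈ Ici S, ∀ r ∈ Ici S,
      ‖Real.log (f (Real.exp r)) - Real.log (f (Real.exp s))‖ ≤ E * ‖r - s‖ := by
    intro s hs r hr
    refine (convex_Ici S).norm_image_sub_le_of_norm_hasDerivWithin_le
      (f := fun s => Real.log (f (Real.exp s)))
      (f' := fun s => f' (Real.exp s) * Real.exp s / f (Real.exp s)) (fun z hz => ?_)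
      (fun z hz => ?_) hs hr
    · obtain ⟨h1, h2, -⟩ := hS z hz
      exact ((h1.comp z (Real.hasDerivAt_exp z)).log h2.ne').hasDerivWithinAt
    · obtain ⟨-, h2, h3⟩ := hS z hz
      rw [norm_div, Real.norm_eq_abs, Real.norm_eq_abs, abs_of_pos h2, div_le_iff₀ h2, mul_comm]
      exact h3
  have hy' := tendsto_of_div_tendsto_one hb hy
  have hlog : Tendsto (fun t => E * ‖Real.log (y t / b t)‖) atTop (𝓝 0) := by
    have := (((Real.continuousAt_log one_ne_zero).tendsto.comp hy).norm).const_mul E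
    simpa using this
  have hdiff : Tendsto (fun t => Real.log (f (y t)) - Real.log (f (b t))) atTop (𝓝 0) := by
    refine squeeze_zero_norm' ?_ hlog
    filter_upwards [(Real.tendsto_log_atTop.comp hb).eventually_ge_atTop S,
      (Real.tendsto_log_atTop.comp hy').eventually_ge_atTop S, hb.eventually_gt_atTop 0,
      hy'.eventually_gt_atTop 0] with t h1 h2 h3 h4
    have := hlip _ h1 _ h2
    simp only [Function.comp_apply, Real.exp_log h3, Real.exp_log h4] at this
    rwa [← Real.log_div h4.ne' h3.ne'] at this
  have := (Real.continuous_exp.tendsto _).comp hdiff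
  rw [Real.exp_zero] at this
  refine this.congr' ?_
  filter_upwards [hb.eventually hpos, hy'.eventually hpos] with t h1 h2
  rw [Function.comp_apply, Real.exp_sub, Real.exp_log h1, Real.exp_log h2]

/-- If the derivative is ratio continuous, increments over small relative distances are
asymptotically linear. -/
theorem tendsto_increment (hd : ∀ᶠ x in atTop, HasDerivAt f (f' x) x)
    (hf' : RatioContinuous f') {b y : ℝ → ℝ} (hb : Tendsto b atTop atTop)
    (hy : Tendsto (fun t => y t / b t) atTop (𝓝 0)) (hy0 : ∀ᶠ t in atTop, y t ≠ 0) :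
    Tendsto (fun t => (f (b t + y t) - f (b t)) / (y t * f' (b t))) atTop (𝓝 1) := by
  obtain ⟨X, hX⟩ := eventually_atTop.1 hd
  have hby : Tendsto (fun t => (b t + y t) / b t) atTop (𝓝 1) := by
    have := hy.const_add 1
    rw [add_zero] at this
    refine this.congr' ?_
    filter_upwards [hb.eventually_gt_atTop 0] with t ht
    rw [add_div, div_self ht.ne']
  have hby' := tendsto_of_div_tendsto_one hb hby
  have hex : ∀ t, ∃ ξ, X ≤ b t → X ≤ b t + y t → y t ≠ 0 →
      |ξ - b t| ≤ |y t| ∧ f (b t + y t) - f (b t) = y t * f' ξ := by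
    intro t
    by_cases hc : X ≤ b t ∧ X ≤ b t + y t ∧ y t ≠ 0
    · obtain ⟨h1, h2, h3⟩ := hc
      rcases lt_or_gt_of_ne h3 with h | h
      · obtain ⟨ξ, hξ, he⟩ := exists_hasDerivAt_eq_slope f f' (by linarith : b t + y t < b t)
          (fun x hx => (hX x (h2.trans hx.1)).continuousAt.continuousWithinAt)
          (fun x hx => hX x (h2.trans hx.1.le))
        refine ⟨ξ, fun _ _ _ => ⟨?_, ?_⟩⟩
        · rw [abs_of_neg h, abs_le]
          constructor <;> linarith [hξ.1, hξ.2]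
        · rw [eq_div_iff (by linarith)] at he
          linear_combination he
      · obtain ⟨ξ, hξ, he⟩ := exists_hasDerivAt_eq_slope f f' (by linarith : b t < b t + y t)
          (fun x hx => (hX x (h1.trans hx.1)).continuousAt.continuousWithinAt)
          (fun x hx => hX x (h1.trans hx.1.le))
        refine ⟨ξ, fun _ _ _ => ⟨?_, ?_⟩⟩
        · rw [abs_of_pos h, abs_le]
          constructor <;> linarith [hξ.1, hξ.2]
        · rw [eq_div_iff (by linarith)] at he
          linear_combination -he
    · exact ⟨0, fun h1 h2 h3 => absurd ⟨h1, h2, h3⟩ hc⟩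
  choose ξ hξ using hex
  have hξ1 : Tendsto (fun t => ξ t / b t) atTop (𝓝 1) := by
    rw [tendsto_iff_norm_sub_tendsto_zero]
    refine squeeze_zero' (Eventually.of_forall fun _ => norm_nonneg _) ?_
      (by simpa using hy.norm : Tendsto (fun t => ‖y t / b t‖) atTop (𝓝 0))
    filter_upwards [hb.eventually_ge_atTop X, hby'.eventually_ge_atTop X, hy0,
      hb.eventually_gt_atTop 0] with t h1 h2 h3 h4
    rw [div_sub_one h4.ne', norm_div, norm_div]
    gcongr
    exact (hξ t h1 h2 h3).1
  refine (hf' b ξ hb hξ1).congr' ?_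
  filter_upwards [hb.eventually_ge_atTop X, hby'.eventually_ge_atTop X, hy0] with t h1 h2 h3
  rw [(hξ t h1 h2 h3).2, mul_div_mul_left _ _ h3]

end RatioContinuous

theorem SlowRep.pos {l ε ε' ε'' : ℝ → ℝ} (hl : SlowRep l ε ε' ε'') {x : ℝ} (hx : 1 ≤ x) :
    0 < l x := by
  rw [hl.rep x hx]
  exact Real.exp_pos _

theorem SlowRep.hasDerivAt {l ε ε' ε'' : ℝ → ℝ} (hl : SlowRep l ε ε' ε'') {x : ℝ} (hx : 1 < x) :
    HasDerivAt l (l x * ε x / x) x := by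
  have hc : ContinuousOn (fun u => ε u / u) (Ici 1) := by
    refine ContinuousOn.div (fun u hu => (hl.hasDeriv u hu).continuousWithinAt) continuousOn_id
      fun u hu => ?_
    have : (1 : ℝ) ≤ u := hu
    positivity
  have hcx : ContinuousAt (fun u => ε u / u) x := hc.continuousAt (Ici_mem_nhds hx)
  have hint : IntervalIntegrable (fun u => ε u / u) volume 1 x := by
    refine ContinuousOn.intervalIntegrable (hc.mono ?_)
    rw [uIcc_of_le hx.le]
    exact Icc_subset_Ici_self
  have hmeas : StronglyMeasurableAtFilter (fun u => ε u / u) (𝓝 x) volume :=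
    (hc.mono Ioi_subset_Ici_self).stronglyMeasurableAtFilter isOpen_Ioi x hx
  have h1 := (intervalIntegral.integral_hasDerivAt_right hint hmeas hcx).exp
  rw [← hl.rep x hx.le, ← mul_div_assoc] at h1
  refine h1.congr_of_eventuallyEq ?_
  filter_upwards [Ioi_mem_nhds hx] with u hu
  exact hl.rep u (le_of_lt hu)

theorem SlowRep.ratioContinuous {l ε ε' ε'' : ℝ → ℝ} (hl : SlowRep l ε ε' ε'') :
    RatioContinuous l := by
  refine RatioContinuous.of_deriv (E := 1) (f' := fun x => l x * ε x / x)
    ((eventually_gt_atTop 1).mono fun x hx => hl.hasDerivAt hx)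
    ((eventually_ge_atTop 1).mono fun x hx => hl.pos hx) ?_
  have h0 := hl.tendsto_zero.abs
  rw [abs_zero] at h0
  filter_upwards [h0.eventually (ge_mem_nhds one_pos), eventually_ge_atTop 1] with x h1 hx
  have hp := hl.pos hx
  have : x * (l x * ε x / x) = l x * ε x := by field_simp
  rw [this, abs_mul, abs_of_pos hp, one_mul]
  exact mul_le_of_le_one_right hp.le h1

/-- A monotone derivative of a function growing faster than linearly tends to infinity. -/
theorem tendsto_atTop_of_monotoneOn_deriv {g h : ℝ → ℝ} {A : ℝ} (hA : 0 < A)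
    (hmono : MonotoneOn h (Ici A)) (hd : ∀ x, 0 < x → HasDerivAt g (h x) x)
    (hlim : Tendsto (fun x => g x / x) atTop atTop) : Tendsto h atTop atTop := by
  refine tendsto_atTop.2 fun B' => ?_
  filter_upwards [hlim.eventually_ge_atTop (|B'| + 1), eventually_gt_atTop A,
    eventually_ge_atTop (g A)] with x h1 h2 h3
  have hx : 0 < x := hA.trans h2
  obtain ⟨ξ, hξ, he⟩ := exists_hasDerivAt_eq_slope g h h2
    (fun y hy => (hd y (hA.trans_le hy.1)).continuousAt.continuousWithinAt)
    (fun y hy => hd y (hA.trans hy.1))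
  rw [le_div_iff₀ hx] at h1
  have h4 : h ξ ≤ h x := hmono hξ.1.le h2.le hξ.2.le
  rw [eq_div_iff (by linarith)] at he
  have hpos : 0 < x - A := by linarith
  have : |B'| * (x - A) ≤ h x * (x - A) := by
    have a1 : h ξ * (x - A) ≤ h x * (x - A) := by gcongr
    nlinarith [abs_nonneg B']
  exact (le_abs_self B').trans (le_of_mul_le_mul_right this hpos)

/-- The Laplace scale for a function whose inverse is slowly varying. -/
theorem ClassRInfty.exists_laplaceScale {h : ℝ → ℝ} (hh : ClassRInfty h)
    (hlim : Tendsto h atTop atTop) : ∃ b σ, LaplaceScale h b σ := by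
  obtain ⟨hmono, ε, ε', ε'', hrep, htop, hε1, -, η, hη0, hη1, κ, hκ, hεκ⟩ := hh
  set ψ := genInv h with hψ
  have hεpos : ∀ᶠ x in atTop, 0 < ε x := by
    filter_upwards [hεκ, eventually_gt_atTop 0] with x h1 hx
    exact (pos_iff_pos_of_mul_pos (hκ.trans_le h1)).1 (by positivity)
  have hεrc : RatioContinuous ε := by
    refine RatioContinuous.of_deriv (f' := ε') (E := 1) ?_ hεpos ?_
    · filter_upwards [eventually_gt_atTop 1] with x hx
      exact (hrep.hasDeriv x hx.le).hasDerivAt (Ici_mem_nhds hx)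
    · have h0 := hε1.abs
      rw [abs_zero] at h0
      filter_upwards [h0.eventually (ge_mem_nhds one_pos), hεpos] with x h1 h2
      rwa [abs_div, abs_of_pos h2, div_le_iff₀ h2] at h1
  set D : ℝ → ℝ := fun x => ψ x * ε x / x with hD
  have hDrc : RatioContinuous D := (hrep.ratioContinuous.mul hεrc).div RatioContinuous.id
  have hder : ∀ᶠ x in atTop, HasDerivAt ψ (D x) x :=
    (eventually_gt_atTop 1).mono fun x hx => hrep.hasDerivAt hx
  have hDpos : ∀ᶠ x in atTop, 0 < D x := by
    filter_upwards [hεpos, eventually_ge_atTop 1] with x h1 h2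
    have := hrep.pos h2
    positivity
  -- Since `D` is the derivative of the inverse of `h`, this gives `h` the slope `2 π / σ t ^ 2`.
  set σ : ℝ → ℝ := fun t => √(2 * Real.pi * D t) with hσ
  have hpi := Real.pi_pos
  have hσpos : ∀ᶠ t in atTop, 0 < σ t := by
    filter_upwards [hDpos] with t ht
    exact Real.sqrt_pos.2 (by positivity)
  have hσsq : ∀ᶠ t in atTop, σ t ^ 2 = 2 * Real.pi * D t := by
    filter_upwards [hDpos] with t ht
    exact Real.sq_sqrt (by positivity)
  have hmul : Tendsto (fun t => t * σ t) atTop atTop := by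
    -- `(t σ t)² = 2 π t ψ t ε t`, and `ε t ≥ κ t ^ (-η)` with `η < 1`.
    have h1 : Tendsto (fun t : ℝ => 2 * Real.pi * κ * (t ^ (1 - η) * ψ t)) atTop atTop :=
      ((tendsto_rpow_atTop (by linarith)).atTop_mul_atTop₀ htop).const_mul_atTop (by positivity)
    have h2 := Real.tendsto_sqrt_atTop.comp h1
    refine tendsto_atTop_mono' _ ?_ h2
    filter_upwards [hεκ, hσsq, hσpos, eventually_ge_atTop 1] with t h3 h4 h5 h6
    have ht : 0 < t := by linarith
    have hψp := hrep.pos h6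
    refine Real.sqrt_le_iff.2 ⟨by positivity, ?_⟩
    rw [mul_pow, h4, hD]
    have e : t ^ 2 * (2 * Real.pi * (ψ t * ε t / t)) = 2 * Real.pi * (t ^ (1 - η) * ψ t) *
        (t ^ η * ε t) := by
      have : t = t ^ (1 - η) * t ^ η := by
        rw [← Real.rpow_add ht]
        simp
      have e2 : t ^ 2 * (2 * Real.pi * (ψ t * ε t / t)) = 2 * Real.pi * ψ t * ε t * t := by
        field_simp
      rw [e2]
      nth_rewrite 3 [this]
      ring
    rw [e]
    calc 2 * Real.pi * κ * (t ^ (1 - η) * ψ t) = 2 * Real.pi * (t ^ (1 - η) * ψ t) * κ := by ring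
      _ ≤ _ := by gcongr
  refine ⟨ψ, σ, htop, hσpos, ?_, hmul, fun w => ?_⟩
  · have h1 : Tendsto (fun t => 2 * Real.pi * ε t / (t * ψ t)) atTop (𝓝 0) :=
      (hrep.tendsto_zero.const_mul _).div_atTop (tendsto_id.atTop_mul_atTop₀ htop)
    have h2 := (Real.continuous_sqrt.tendsto _).comp h1
    rw [Real.sqrt_zero] at h2
    refine h2.congr' ?_
    filter_upwards [hσsq, hσpos, eventually_ge_atTop 1] with t h4 h5 h6
    have hψp := hrep.pos h6
    rw [Function.comp_apply, ← Real.sqrt_sq (by positivity : 0 ≤ σ t / ψ t), div_pow, h4]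
    congr 1
    rw [hD]
    field_simp
  · -- increments of `ψ` on the scale `1 / σ t`, which are then inverted by monotonicity of `h`
    have key : ∀ r, Tendsto (fun t => (ψ (t + r / σ t) - ψ t) / σ t) atTop
        (𝓝 (r / (2 * Real.pi))) := by
      intro r
      rcases eq_or_ne r 0 with rfl | hr
      · simp
      have hy : Tendsto (fun t => r / σ t / t) atTop (𝓝 0) := by
        have := (tendsto_const_nhds (x := r)).div_atTop hmul
        refine this.congr fun t => ?_
        rw [div_div, mul_comm]
      have hy0 : ∀ᶠ t in atTop, r / σ t ≠ 0 := by
        filter_upwards [hσpos] with t ht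
        exact div_ne_zero hr ht.ne'
      have := (RatioContinuous.tendsto_increment hder hDrc tendsto_id hy hy0).mul_const
        (r / (2 * Real.pi))
      rw [one_mul] at this
      refine this.congr' ?_
      filter_upwards [hσpos, hσsq, hDpos] with t h1 h2 h3
      have h4 : D t = σ t ^ 2 / (2 * Real.pi) := by rw [h2]; field_simp
      simp only [id_eq]
      rw [h4]
      field_simp
    have hne : ∀ u, {x | 0 < x ∧ u ≤ h x}.Nonempty := fun u => by
      obtain ⟨x, h1, h2⟩ := ((eventually_gt_atTop 0).and (hlim.eventually_ge_atTop u)).exists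
      exact ⟨x, h1, h2⟩
    -- `ψ` is only a generalized inverse: `ψ u < x` gives `u ≤ h x`, and `x < ψ u` gives `h x < u`.
    have hge : ∀ u x, 0 < x → ψ u < x → u ≤ h x := fun u x hx hux => by
      obtain ⟨z, hz, hzx⟩ := exists_lt_of_csInf_lt (hne u) hux
      exact hz.2.trans (hmono.monotoneOn hz.1 hx hzx.le)
    have hlt : ∀ u x, 0 < x → x < ψ u → h x < u := fun u x hx hux => by
      by_contra hcon
      have hbdd : BddBelow {x | 0 < x ∧ u ≤ h x} := ⟨0, fun z hz => hz.1.le⟩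
      exact absurd (csInf_le hbdd ⟨hx, not_lt.1 hcon⟩) (not_le.2 hux)
    have hpos : ∀ᶠ t in atTop, 0 < ψ t + σ t * w := by
      have h1 : Tendsto (fun t => 2 * Real.pi * ε t / (t * ψ t)) atTop (𝓝 0) :=
        (hrep.tendsto_zero.const_mul _).div_atTop (tendsto_id.atTop_mul_atTop₀ htop)
      have h2 : Tendsto (fun t => w ^ 2 * (2 * Real.pi * ε t / (t * ψ t))) atTop (𝓝 0) := by
        simpa using h1.const_mul (w ^ 2)
      filter_upwards [h2.eventually (gt_mem_nhds one_pos), hσsq, eventually_ge_atTop 1]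
        with t h3 h4 h5
      have hψp := hrep.pos h5
      have h6 : (σ t * w) ^ 2 < ψ t ^ 2 := by
        have e : (σ t * w) ^ 2 = w ^ 2 * (2 * Real.pi * ε t / (t * ψ t)) * ψ t ^ 2 := by
          rw [mul_pow, h4, hD]
          field_simp
        rw [e]
        exact mul_lt_of_lt_one_left (by positivity) h3
      have := abs_lt_of_sq_lt_sq h6 hψp.le
      rw [abs_lt] at this
      linarith
    refine tendsto_order.2 ⟨fun a ha => ?_, fun a ha => ?_⟩
    · obtain ⟨r, hr1, hr2⟩ := exists_between ha
      have hrw : r / (2 * Real.pi) < w := by rw [div_lt_iff₀ (by positivity)]; linarith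
      filter_upwards [(key r).eventually (gt_mem_nhds hrw), hσpos, hpos] with t h1 h2 h3
      rw [div_lt_iff₀ h2] at h1
      have h4 := hge (t + r / σ t) _ h3 (by linarith)
      have h5 : r / σ t ≤ h (ψ t + σ t * w) - t := by linarith
      rw [div_le_iff₀' h2] at h5
      linarith
    · obtain ⟨r, hr1, hr2⟩ := exists_between ha
      have hrw : w < r / (2 * Real.pi) := by rw [lt_div_iff₀ (by positivity)]; linarith
      filter_upwards [(key r).eventually (lt_mem_nhds hrw), hσpos, hpos] with t h1 h2 h3
      rw [lt_div_iff₀ h2] at h1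
      have h4 := hlt (t + r / σ t) _ h3 (by linarith)
      have h5 : h (ψ t + σ t * w) - t < r / σ t := by linarith
      rw [lt_div_iff₀' h2] at h5
      linarith

/-- A regularly varying function has a relative derivative `(β + ε x) / x` and is eventually
positive. -/
theorem ClassRBeta.exists_deriv {h : ℝ → ℝ} {β : ℝ} (hβ : 0 < β) (hh : ClassRBeta β h) :
    ∃ ε : ℝ → ℝ, Tendsto ε atTop (𝓝 0) ∧ (∀ᶠ x in atTop, 0 < h x) ∧ RatioContinuous h ∧
      ∀ᶠ x in atTop, HasDerivAt h (h x * (β + ε x) / x) x := by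
  obtain ⟨l, ε, ε', ε'', hl, hrep, -, -⟩ := hh
  have hpos : ∀ᶠ x in atTop, 0 < h x := by
    filter_upwards [hrep, eventually_ge_atTop 1] with x h1 h2
    rw [h1]
    have := hl.pos h2
    have : 0 < x := by linarith
    positivity
  have hder : ∀ᶠ x in atTop, HasDerivAt h (h x * (β + ε x) / x) x := by
    obtain ⟨X, hX⟩ := eventually_atTop.1 hrep
    filter_upwards [eventually_gt_atTop X, hrep, eventually_gt_atTop 1] with x h1 h2 h3
    have hx : 0 < x := by linarith
    have := (Real.hasDerivAt_rpow_const (p := β) (Or.inl hx.ne')).mul (hl.hasDerivAt h3)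
    refine HasDerivAt.congr_of_eventuallyEq (this.congr_deriv ?_)
      (Filter.mem_of_superset (Ioi_mem_nhds h1) fun y hy => hX y (le_of_lt hy))
    rw [h2, Real.rpow_sub_one hx.ne']
    field_simp
  refine ⟨ε, hl.tendsto_zero, hpos, ?_, hder⟩
  refine RatioContinuous.of_deriv (E := β + 1) hder hpos ?_
  have h0 := hl.tendsto_zero.abs
  rw [abs_zero] at h0
  filter_upwards [h0.eventually (ge_mem_nhds one_pos), hpos, eventually_gt_atTop 0] with x h1 h2 h3
  have : x * (h x * (β + ε x) / x) = (β + ε x) * h x := by field_simp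
  rw [this, abs_mul, abs_of_pos h2]
  gcongr
  rw [abs_le] at h1 ⊢
  constructor <;> linarith

theorem ClassRBeta.exists_monotoneOn {h : ℝ → ℝ} {β : ℝ} (hβ : 0 < β) (hh : ClassRBeta β h) :
    ∃ A, 0 < A ∧ MonotoneOn h (Ici A) := by
  obtain ⟨ε, hε, hpos, -, hder⟩ := hh.exists_deriv hβ
  obtain ⟨A, hA⟩ := eventually_atTop.1 (hder.and (hpos.and ((eventually_gt_atTop 0).and
    (hε.eventually (lt_mem_nhds (neg_lt_zero.2 hβ))))))
  refine ⟨A, (hA A le_rfl).2.2.1, monotoneOn_of_deriv_nonneg (convex_Ici A)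
    (fun x hx => (hA x hx).1.continuousAt.continuousWithinAt)
    (fun x hx => (hA x (interior_subset hx)).1.differentiableAt.differentiableWithinAt)
    fun x hx => ?_⟩
  obtain ⟨h1, h2, h3, h4⟩ := hA x (interior_subset hx)
  rw [h1.deriv]
  have : 0 < β + ε x := by linarith
  positivity

/-- The Laplace scale for a regularly varying function. -/
theorem ClassRBeta.exists_laplaceScale {h : ℝ → ℝ} {β : ℝ} (hβ : 0 < β) (hh : ClassRBeta β h)
    (hlim : Tendsto h atTop atTop) : ∃ b σ, LaplaceScale h b σ := by
  obtain ⟨ε, hε, hpos, hrc, hder⟩ := hh.exists_deriv hβ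
  obtain ⟨A₀, hA₀, hmono₀⟩ := hh.exists_monotoneOn hβ
  obtain ⟨A₁, hA₁⟩ := eventually_atTop.1 hder
  set A := max A₀ A₁
  have hmono : MonotoneOn h (Ici A) := hmono₀.mono (Ici_subset_Ici.2 (le_max_left _ _))
  have hcont : ContinuousOn h (Ici A) := fun x hx =>
    (hA₁ x ((le_max_right _ _).trans hx)).continuousAt.continuousWithinAt
  have hex : ∀ t, ∃ x, h A ≤ t → A ≤ x ∧ h x = t := fun t => by
    by_cases ht : h A ≤ t
    · obtain ⟨B, hB1, hB2⟩ := ((eventually_ge_atTop A).and (hlim.eventually_ge_atTop t)).exists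
      obtain ⟨x, hx, hxt⟩ := intermediate_value_Icc hB1 (hcont.mono Icc_subset_Ici_self) ⟨ht, hB2⟩
      exact ⟨x, fun _ => ⟨hx.1, hxt⟩⟩
    · exact ⟨0, fun h => absurd h ht⟩
  -- `b t` is a preimage of `t` under `h`, so the exponent `t x - g x` is stationary there.
  choose b hb using hex
  have hhb : ∀ᶠ t in atTop, h (b t) = t := (eventually_ge_atTop (h A)).mono fun t ht => (hb t ht).2
  have hbtop : Tendsto b atTop atTop := by
    refine tendsto_atTop.2 fun B => ?_
    filter_upwards [eventually_ge_atTop (h A), eventually_gt_atTop (h (max B A))] with t h1 h2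
    by_contra hcon
    obtain ⟨h3, h4⟩ := hb t h1
    have := hmono h3 (mem_Ici.2 (le_max_right B A)) ((not_le.1 hcon).le.trans (le_max_left B A))
    linarith
  set D : ℝ → ℝ := fun x => h x * (β + ε x) / x with hD
  have hder' : ∀ᶠ x in atTop, HasDerivAt h (D x) x := hder
  have hβε : Tendsto (fun x => β + ε x) atTop (𝓝 β) := by simpa using hε.const_add β
  have hDrc : RatioContinuous D :=
    (hrc.mul (RatioContinuous.of_tendsto hβ.ne' hβε)).div RatioContinuous.id
  have hβεb := hβε.comp hbtop
  have hall : ∀ᶠ t in atTop, h (b t) = t ∧ 0 < t ∧ 0 < b t ∧ 0 < β + ε (b t) := by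
    filter_upwards [hhb, eventually_gt_atTop 0, hbtop.eventually_gt_atTop 0,
      hβεb.eventually (lt_mem_nhds hβ)] with t h1 h2 h3 h4
    exact ⟨h1, h2, h3, h4⟩
  have hpi := Real.pi_pos
  -- The slope of `h` at `b t` is `D (b t) = 2 π / σ t ^ 2`.
  set σ : ℝ → ℝ := fun t => √(2 * Real.pi / D (b t)) with hσ
  have hDpos : ∀ᶠ t in atTop, 0 < D (b t) := by
    filter_upwards [hall] with t ⟨h1, h2, h3, h4⟩
    simp only [hD, h1]
    positivity
  have hσpos : ∀ᶠ t in atTop, 0 < σ t := by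
    filter_upwards [hDpos] with t ht
    exact Real.sqrt_pos.2 (by positivity)
  have hσsq : ∀ᶠ t in atTop, σ t ^ 2 = 2 * Real.pi / D (b t) := by
    filter_upwards [hDpos] with t ht
    exact Real.sq_sqrt (by positivity)
  have hratio : Tendsto (fun t => σ t / b t) atTop (𝓝 0) := by
    have h1 : Tendsto (fun t => 2 * Real.pi / (t * b t * (β + ε (b t)))) atTop (𝓝 0) :=
      tendsto_const_nhds.div_atTop ((tendsto_id.atTop_mul_atTop₀ hbtop).atTop_mul_pos hβ hβεb)
    have h2 := (Real.continuous_sqrt.tendsto _).comp h1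
    rw [Real.sqrt_zero] at h2
    refine h2.congr' ?_
    filter_upwards [hσsq, hσpos, hall] with t h4 h5 ⟨h6, h7, h8, h9⟩
    rw [Function.comp_apply, ← Real.sqrt_sq (by positivity : 0 ≤ σ t / b t), div_pow, h4]
    congr 1
    simp only [hD, h6]
    field_simp
  refine ⟨b, σ, hbtop, hσpos, hratio, ?_, fun w => ?_⟩
  · have h1 : Tendsto (fun t => t * b t * (2 * Real.pi / (β + ε (b t)))) atTop atTop :=
      (tendsto_id.atTop_mul_atTop₀ hbtop).atTop_mul_pos (by positivity)
        (tendsto_const_nhds.div hβεb hβ.ne')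
    refine (Real.tendsto_sqrt_atTop.comp h1).congr' ?_
    filter_upwards [hσsq, hσpos, hall] with t h4 h5 ⟨h6, h7, h8, h9⟩
    rw [Function.comp_apply, ← Real.sqrt_sq (by positivity : 0 ≤ t * σ t), mul_pow, h4]
    congr 1
    simp only [hD, h6]
    field_simp
  · rcases eq_or_ne w 0 with rfl | hw
    · simp only [mul_zero, add_zero]
      refine tendsto_const_nhds.congr' ?_
      filter_upwards [hhb] with t ht
      rw [ht, sub_self, mul_zero]
    have hy : Tendsto (fun t => σ t * w / b t) atTop (𝓝 0) := by
      have := hratio.mul_const w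
      rw [zero_mul] at this
      refine this.congr fun t => ?_
      ring
    have hy0 : ∀ᶠ t in atTop, σ t * w ≠ 0 := by
      filter_upwards [hσpos] with t ht
      exact mul_ne_zero ht.ne' hw
    have := (RatioContinuous.tendsto_increment hder' hDrc hbtop hy hy0).mul_const (2 * Real.pi * w)
    rw [one_mul] at this
    refine this.congr' ?_
    filter_upwards [hσpos, hσsq, hDpos, hhb] with t h1 h2 h3 h4
    have h5 : D (b t) = 2 * Real.pi / σ t ^ 2 := by
      rw [h2]
      field_simp
    rw [h5, h4]
    field_simp

/-! ### Mean and parameter of the tilted law -/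

theorem integral_law {p : ℝ → ℝ} (hp : Measurable p) (h0 : ∀ x, 0 ≤ p x) (φ : ℝ → ℝ) :
    ∫ x, φ x ∂(law p) = ∫ x, p x * φ x := by
  rw [law, integral_withDensity_eq_integral_toReal_smul hp.ennreal_ofReal
    (ae_of_all _ fun x => ENNReal.ofReal_lt_top)]
  congr 1 with x
  rw [ENNReal.toReal_ofReal (h0 x), smul_eq_mul]

theorem integrable_law_iff {p : ℝ → ℝ} (hp : Measurable p) (h0 : ∀ x, 0 ≤ p x) (φ : ℝ → ℝ) :
    Integrable φ (law p) ↔ Integrable (fun x => p x * φ x) := by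
  rw [law, integrable_withDensity_iff_integrable_smul' hp.ennreal_ofReal
    (ae_of_all _ fun x => ENNReal.ofReal_lt_top)]
  simp only [ENNReal.toReal_ofReal (h0 _), smul_eq_mul]

theorem monotoneOn_tiltMean (p : ℝ → ℝ) :
    MonotoneOn (tiltMean p) (interior (integrableExpSet id (law p))) := by
  have han := (analyticOnNhd_cgf (X := id) (μ := law p)).deriv
  refine monotoneOn_of_deriv_nonneg convex_integrableExpSet.interior han.continuousOn
    (han.differentiableOn.mono interior_subset) fun t ht => ?_
  have ht' := interior_subset ht
  have := iteratedDeriv_two_cgf_eq_integral ht'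
  rw [iteratedDeriv_succ, iteratedDeriv_one] at this
  change 0 ≤ deriv (deriv (cgf id (law p))) t
  rw [this]
  exact div_nonneg (integral_nonneg fun x => by positivity) mgf_nonneg

/-- To the left of its domain of finiteness the moment generating function is zero by convention,
so the logarithmic derivative is zero there, including at the left end point. -/
theorem tiltMean_eq_zero {p : ℝ → ℝ} {s T : ℝ} (hT : T ∈ integrableExpSet id (law p)) (hsT : s < T)
    (hs : s ∉ interior (integrableExpSet id (law p))) : tiltMean p s = 0 := by
  have hlt : ∀ u, u < s → cgf id (law p) u = 0 := fun u hu => by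
    have hu' : u ∉ integrableExpSet id (law p) := fun hmem => by
      refine hs (mem_interior.2 ⟨Ioo u T, fun x hx => ?_, isOpen_Ioo, hu, hsT⟩)
      exact convex_integrableExpSet.ordConnected.out hmem hT ⟨hx.1.le, hx.2.le⟩
    rw [cgf, mgf_undef hu', Real.log_zero]
  by_cases hd : DifferentiableAt ℝ (cgf id (law p)) s
  · have hs0 : cgf id (law p) s = 0 := by
      have h1 : Tendsto (cgf id (law p)) (𝓝[<] s) (𝓝 (cgf id (law p) s)) :=
        hd.continuousAt.tendsto.mono_left nhdsWithin_le_nhds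
      have h2 : Tendsto (cgf id (law p)) (𝓝[<] s) (𝓝 0) := by
        refine tendsto_const_nhds.congr' ?_
        filter_upwards [self_mem_nhdsWithin] with u hu
        exact (hlt u hu).symm
      exact tendsto_nhds_unique h1 h2
    have h1 : HasDerivWithinAt (cgf id (law p)) (tiltMean p s) (Iic s) s :=
      hd.hasDerivAt.hasDerivWithinAt
    have h2 : HasDerivWithinAt (cgf id (law p)) 0 (Iic s) s := by
      refine (hasDerivWithinAt_const s (Iic s) (0 : ℝ)).congr (fun u hu => ?_) hs0
      rcases eq_or_lt_of_le (mem_Iic.1 hu) with rfl | h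
      · exact hs0
      · exact hlt u h
    exact UniqueDiffWithinAt.eq_deriv _ (uniqueDiffOn_Iic s s self_mem_Iic) h1 h2
  · exact deriv_zero_of_not_differentiableAt hd

/-- The tilting parameter solves its equation for large levels and tends to infinity, as soon as
the tilted mean is finite and tends to infinity for large parameters. -/
theorem tendsto_tiltParam {p : ℝ → ℝ} {T₀ : ℝ}
    (hT₀ : ∀ t, T₀ < t → t ∈ interior (integrableExpSet id (law p)))
    (hlim : Tendsto (tiltMean p) atTop atTop) :
    (∀ᶠ a in atTop, tiltMean p (tiltParam p a) = a) ∧ Tendsto (tiltParam p) atTop atTop := by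
  have hcont : ContinuousOn (tiltMean p) (interior (integrableExpSet id (law p))) :=
    (analyticOnNhd_cgf (X := id) (μ := law p)).deriv.continuousOn
  have hsolve : ∀ᶠ a in atTop, tiltMean p (tiltParam p a) = a := by
    filter_upwards [eventually_ge_atTop (tiltMean p (T₀ + 1))] with a ha
    obtain ⟨B, hB1, hB2⟩ := ((eventually_ge_atTop (T₀ + 1)).and
      (hlim.eventually_ge_atTop a)).exists
    obtain ⟨t, -, ht⟩ := intermediate_value_Icc hB1 (hcont.mono fun t ht => hT₀ t (by
      have := ht.1
      linarith)) ⟨ha, hB2⟩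
    exact Classical.epsilon_spec (p := fun t => tiltMean p t = a) ⟨t, ht⟩
  refine ⟨hsolve, tendsto_atTop.2 fun B => ?_⟩
  set T := max (T₀ + 1) B with hT
  have hTmem : T ∈ interior (integrableExpSet id (law p)) :=
    hT₀ T (by have := le_max_left (T₀ + 1) B; linarith)
  filter_upwards [hsolve, eventually_gt_atTop 0, eventually_gt_atTop (tiltMean p T)] with a h1 h2 h3
  by_contra hcon
  have hlt : tiltParam p a < T := (not_le.1 hcon).trans_le (le_max_right _ _)
  by_cases hs : tiltParam p a ∈ interior (integrableExpSet id (law p))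
  · have := monotoneOn_tiltMean p hs hTmem hlt.le
    linarith
  · have := tiltMean_eq_zero (interior_subset hTmem) hlt hs
    linarith

section Rescaled

variable {p g : ℝ → ℝ} {c t b σ : ℝ}

theorem mul_exp_eq_rescaled (hc : c ≠ 0) (hσ : σ ≠ 0) (x : ℝ) :
    p x * Real.exp (t * x) =
      c * Real.exp (t * b - g b) * rescaled p g c t b σ ((x - b) / σ) := by
  rw [rescaled, mul_div_cancel₀ _ hσ, add_sub_cancel]
  have : Real.exp (t * x) = Real.exp (t * b - g b) * Real.exp (t * (x - b) + g b) := by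
    rw [← Real.exp_add]
    congr 1
    ring
  rw [this]
  field_simp

theorem integral_mul_mul_exp (hc : c ≠ 0) (hσ : 0 < σ) (φ : ℝ → ℝ) :
    ∫ x, p x * (φ x * Real.exp (t * x)) = c * Real.exp (t * b - g b) * σ *
      ∫ v, φ (b + σ * v) * rescaled p g c t b σ v := by
  have e : ∀ x, p x * (φ x * Real.exp (t * x)) = c * Real.exp (t * b - g b) *
      (φ (b + σ * ((x - b) / σ)) * rescaled p g c t b σ ((x - b) / σ)) := fun x => by
    rw [mul_left_comm, mul_exp_eq_rescaled hc hσ.ne' (g := g) (b := b),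
      mul_div_cancel₀ _ hσ.ne', add_sub_cancel]
    ring
  simp_rw [e]
  rw [integral_const_mul, integral_sub_right_eq_self
    (fun x => φ (b + σ * (x / σ)) * rescaled p g c t b σ (x / σ)) b,
    Measure.integral_comp_div (fun v => φ (b + σ * v) * rescaled p g c t b σ v) σ,
    abs_of_pos hσ, smul_eq_mul]
  ring

theorem mem_integrableExpSet_of_integrable (hp : Measurable p) (h0 : ∀ x, 0 ≤ p x) (hc : c ≠ 0)
    (hσ : 0 < σ) (hi : Integrable (rescaled p g c t b σ)) :
    t ∈ integrableExpSet id (law p) := by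
  change Integrable (fun x => Real.exp (t * id x)) (law p)
  rw [integrable_law_iff hp h0]
  refine (((hi.comp_div hσ.ne').comp_sub_right b).const_mul (c * Real.exp (t * b - g b))).congr
    (ae_of_all _ fun x => ?_)
  exact (mul_exp_eq_rescaled hc hσ.ne' x).symm

theorem mgf_law_eq (hp : Measurable p) (h0 : ∀ x, 0 ≤ p x) (hc : c ≠ 0) (hσ : 0 < σ) :
    mgf id (law p) t = c * Real.exp (t * b - g b) * σ * ∫ v, rescaled p g c t b σ v := by
  rw [mgf, integral_law hp h0]
  simpa using integral_mul_mul_exp (p := p) (g := g) (t := t) (b := b) hc hσ (fun _ => 1)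

theorem tiltMean_eq (hp : Measurable p) (h0 : ∀ x, 0 ≤ p x) (hc : c ≠ 0) (hσ : 0 < σ)
    (ht : t ∈ interior (integrableExpSet id (law p)))
    (i0 : Integrable (rescaled p g c t b σ)) (i1 : Integrable (fun v => v * rescaled p g c t b σ v))
    (hJ : 0 < ∫ v, rescaled p g c t b σ v) :
    tiltMean p t = b + σ * meanOf (rescaled p g c t b σ) := by
  rw [tiltMean, deriv_cgf ht, mgf_law_eq hp h0 hc hσ (b := b) (g := g), integral_law hp h0]
  simp only [id_eq]
  rw [integral_mul_mul_exp (g := g) (b := b) hc hσ (fun x => x)]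
  have e : ∀ v, (b + σ * v) * rescaled p g c t b σ v =
      b * rescaled p g c t b σ v + σ * (v * rescaled p g c t b σ v) := fun v => by ring
  simp_rw [e]
  rw [integral_add (i0.const_mul _) (i1.const_mul _), integral_const_mul, integral_const_mul,
    meanOf]
  have := Real.exp_ne_zero (t * b - g b)
  have := hσ.ne'
  have := hJ.ne'
  field_simp

/-- The density in terms of the centred and standardized tilted density. -/
theorem eq_mul_centerOf (hp : Measurable p) (h0 : ∀ x, 0 ≤ p x) (hc : c ≠ 0) (hσ : 0 < σ)
    (hJ : 0 < ∫ v, rescaled p g c t b σ v) {a : ℝ}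
    (ha : a = b + σ * meanOf (rescaled p g c t b σ)) (x : ℝ) :
    p x = mgf id (law p) t / σ * Real.exp (-(t * x)) *
      centerOf (rescaled p g c t b σ) ((x - a) / σ) := by
  have e : (x - a) / σ + meanOf (rescaled p g c t b σ) = (x - b) / σ := by
    rw [ha]
    field_simp
    ring
  rw [mgf_law_eq hp h0 hc hσ (b := b) (g := g), centerOf, e]
  have h1 := mul_exp_eq_rescaled (p := p) (g := g) (t := t) (b := b) hc hσ.ne' x
  have h2 : Real.exp (t * x) * Real.exp (-(t * x)) = 1 := by
    rw [← Real.exp_add, add_neg_cancel, Real.exp_zero]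
  calc p x = p x * Real.exp (t * x) * Real.exp (-(t * x)) := by rw [mul_assoc, h2, mul_one]
    _ = _ := by
      rw [h1]
      field_simp

end Rescaled

/-- For large parameters the tilted mean is finite, and it is the centring of the Laplace scale
up to a negligible multiple of the scale. -/
theorem TailDensity.eventually_tiltMean {p g h q : ℝ → ℝ} {c A C : ℝ} {b σ : ℝ → ℝ}
    (H : TailDensity p g h q c A) (hS : LaplaceScale h b σ)
    (hG : GaussianLimit atTop C (fun t => rescaled p g c t (b t) (σ t))) :
    (∃ T₀, ∀ t, T₀ < t → t ∈ interior (integrableExpSet id (law p))) ∧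
      (∀ᶠ t in atTop, tiltMean p t = b t + σ t * meanOf (rescaled p g c t (b t) (σ t))) ∧
      Tendsto (tiltMean p) atTop atTop := by
  have hev : ∀ᶠ t in atTop, t ∈ integrableExpSet id (law p) := by
    filter_upwards [hG.eventually_integrable 0, hS.pos] with t i0 hσ
    simp only [pow_zero, one_mul] at i0
    exact mem_integrableExpSet_of_integrable H.measurable H.nonneg H.c_pos.ne' hσ i0
  obtain ⟨T₀, hT₀⟩ := eventually_atTop.1 hev
  have hint : ∀ t, T₀ < t → t ∈ interior (integrableExpSet id (law p)) := fun t ht =>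
    mem_interior.2 ⟨Ioi T₀, fun x hx => hT₀ x (le_of_lt hx), isOpen_Ioi, ht⟩
  have hmean : ∀ᶠ t in atTop,
      tiltMean p t = b t + σ t * meanOf (rescaled p g c t (b t) (σ t)) := by
    filter_upwards [eventually_gt_atTop T₀, hS.pos, hG.eventually_integrable 0,
      hG.eventually_integrable 1, hG.eventually_half_lt_integral] with t h1 hσ i0 i1 hJ
    simp only [pow_zero, one_mul] at i0
    simp only [pow_one] at i1
    exact tiltMean_eq H.measurable H.nonneg H.c_pos.ne' hσ (hint t h1) i0 i1 (by linarith)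
  refine ⟨⟨T₀, hint⟩, hmean, ?_⟩
  have h1 : Tendsto (fun t => 1 + σ t / b t * meanOf (rescaled p g c t (b t) (σ t))) atTop
      (𝓝 1) := by
    simpa using (hS.ratio.mul hG.tendsto_meanOf).const_add 1
  refine (hS.center.atTop_mul_pos one_pos h1).congr' ?_
  filter_upwards [hmean, hS.center.eventually_gt_atTop 0] with t h2 h3
  rw [h2]
  field_simp

/-! ### The first coordinate under the conditional law -/

section Margin

variable {C : ℝ} {f p : ℝ → ℝ} {c t a σ : ℝ}

/-- The density of the first margin divided by the tilted density, as a function of the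
standardized variable: the ratio of two consecutive convolution powers. -/
noncomputable def densityRatio (f : ℝ → ℝ) (n : ℕ) (v : ℝ) : ℝ :=
  convPow f (n - 2) (-v) / convPow f (n - 1) 0

theorem measurable_densityRatio (hf : Measurable f) (n : ℕ) : Measurable (densityRatio f n) :=
  ((measurable_convPow hf _).comp measurable_neg).div_const _

theorem densityRatio_nonneg (hf : ∀ v, 0 ≤ f v) (n : ℕ) (v : ℝ) : 0 ≤ densityRatio f n v :=
  div_nonneg (convPow_nonneg hf _ _) (convPow_nonneg hf _ _)

theorem sliceMass_mean (h : CenteredDensity C f) (hp : Measurable p) (hc : 0 ≤ c) (hσ : 0 < σ)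
    (hpf : ∀ x, p x = c * Real.exp (-(t * x)) * f ((x - a) / σ)) (m : ℕ) :
    sliceMass p (m + 2) ((m + 2 : ℕ) * a) = ENNReal.ofReal (c ^ (m + 2) * σ ^ (m + 1) *
      Real.exp (-(t * ((m + 2 : ℕ) * a))) * convPow f (m + 1) 0) := by
  rw [sliceMass_eq_convPow h hp hc hσ hpf (m + 1)]
  congr 3
  push_cast
  ring

/-- The first margin of the conditional law has the tilted density times the density ratio. -/
theorem condMargin_eq (h : CenteredDensity C f) (hp : Measurable p) (hc : 0 < c) (hσ : 0 < σ)
    (hpf : ∀ x, p x = c * Real.exp (-(t * x)) * f ((x - a) / σ)) {n : ℕ} (hn : 2 ≤ n)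
    (hpos : 0 < convPow f (n - 1) 0) :
    IsProbabilityMeasure (condLaw p n a) ∧ ∀ hn0 : 0 < n,
      condMargin p n a ⟨0, hn0⟩ = volume.withDensity (fun x => ENNReal.ofReal
        (f ((x - a) / σ) / σ * densityRatio f n ((x - a) / σ))) := by
  obtain ⟨m, rfl⟩ := Nat.exists_eq_add_of_le' hn
  have hF : 0 < convPow f (m + 1) 0 := hpos
  set s : ℝ := (m + 2 : ℕ) * a with hs
  set Q := c ^ (m + 2) * σ ^ (m + 1) * Real.exp (-(t * s)) * convPow f (m + 1) 0 with hQ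
  have hQpos : 0 < Q := by positivity
  have hmass : sliceMeasure p (m + 2) s univ = ENNReal.ofReal Q :=
    sliceMass_mean h hp hc.le hσ hpf m
  constructor
  · constructor
    rw [condLaw, ← hs, Measure.smul_apply, hmass, smul_eq_mul]
    exact ENNReal.inv_mul_cancel (by simpa using hQpos) ENNReal.ofReal_ne_top
  · intro hn0
    rw [condMargin, condLaw, ← hs, hmass, Measure.map_smul]
    change _ • (sliceMeasure p (m + 2) s).map (fun y => y 0) = _
    have hm : Measurable (fun x => ENNReal.ofReal (p x) * sliceMass p (m + 1) (s - x)) :=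
      hp.ennreal_ofReal.mul ((measurable_sliceMass hp _).comp
        (measurable_const.sub measurable_id))
    rw [map_sliceMeasure_zero hp, ← withDensity_smul _ hm]
    congr 1
    ext x
    rw [Pi.smul_apply, smul_eq_mul, sliceMass_eq_convPow h hp hc.le hσ hpf m,
      ← ENNReal.ofReal_mul (by rw [hpf]; exact mul_nonneg (by positivity) (h.nonneg _)),
      ← ENNReal.ofReal_inv_of_pos hQpos, ← ENNReal.ofReal_mul (by positivity)]
    congr 1
    rw [hpf, hQ, densityRatio]
    have e1 : (s - x - (m + 1) * a) / σ = -((x - a) / σ) := by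
      rw [hs]
      push_cast
      ring
    have e2 : Real.exp (-(t * s)) = Real.exp (-(t * x)) * Real.exp (-(t * (s - x))) := by
      rw [← Real.exp_add]
      congr 1
      ring
    rw [e1, e2]
    change _ = f ((x - a) / σ) / σ * (convPow f m (-((x - a) / σ)) / convPow f (m + 1) 0)
    have := Real.exp_ne_zero (-(t * x))
    have := Real.exp_ne_zero (-(t * (s - x)))
    have := hF.ne'
    have := hc.ne'
    have := hσ.ne'
    field_simp
    ring

theorem condMargin_absolutelyContinuous (h : CenteredDensity C f) (hp : Measurable p) (hc : 0 < c)
    (hσ : 0 < σ) (hpf : ∀ x, p x = c * Real.exp (-(t * x)) * f ((x - a) / σ)) {n : ℕ}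
    (hn : 2 ≤ n) (hpos : 0 < convPow f (n - 1) 0) (hn0 : 0 < n) :
    condMargin p n a ⟨0, hn0⟩ ≪ volume := by
  rw [(condMargin_eq h hp hc hσ hpf hn hpos).2 hn0]
  exact withDensity_absolutelyContinuous _ _

theorem ae_condDensity_eq (h : CenteredDensity C f) (hp : Measurable p) (hc : 0 < c) (hσ : 0 < σ)
    (hpf : ∀ x, p x = c * Real.exp (-(t * x)) * f ((x - a) / σ)) {n : ℕ} (hn : 2 ≤ n)
    (hpos : 0 < convPow f (n - 1) 0) (hn0 : 0 < n) :
    ∀ᵐ y ∂(condLaw p n a), condDensity p n a ⟨0, hn0⟩ (y ⟨0, hn0⟩) =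
      f ((y ⟨0, hn0⟩ - a) / σ) / σ * densityRatio f n ((y ⟨0, hn0⟩ - a) / σ) := by
  have hf := h.measurable
  have hr := measurable_densityRatio hf n
  have hac := condMargin_absolutelyContinuous h hp hc hσ hpf hn hpos hn0
  have hae : ∀ᵐ x ∂volume, condDensity p n a ⟨0, hn0⟩ x =
      f ((x - a) / σ) / σ * densityRatio f n ((x - a) / σ) := by
    have := Measure.rnDeriv_withDensity (volume : Measure ℝ) (f := fun x => ENNReal.ofReal
        (f ((x - a) / σ) / σ * densityRatio f n ((x - a) / σ))) (by fun_prop)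
    rw [← (condMargin_eq h hp hc hσ hpf hn hpos).2 hn0] at this
    filter_upwards [this] with x hx
    rw [condDensity, hx, ENNReal.toReal_ofReal (mul_nonneg (div_nonneg (h.nonneg _) hσ.le)
      (densityRatio_nonneg h.nonneg n _))]
  exact ae_of_ae_map (measurable_pi_apply _).aemeasurable (hac.ae_le hae)

/-- Tail bound for the standardized first coordinate, by Markov's inequality for the tilted
density. -/
theorem condMargin_tail_le (h : CenteredDensity C f) (hp : Measurable p) (hc : 0 < c) (hσ : 0 < σ)
    (hpf : ∀ x, p x = c * Real.exp (-(t * x)) * f ((x - a) / σ)) {n : ℕ} (hn : 2 ≤ n)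
    (hpos : 0 < convPow f (n - 1) 0) (hn0 : 0 < n) {D K : ℝ} (hD : ∀ v, densityRatio f n v ≤ D)
    (hK : 0 < K) :
    condMargin p n a ⟨0, hn0⟩ {x | K < |(x - a) / σ|} ≤
      ENNReal.ofReal (D / K * (C * ∫ v : ℝ, |v| ^ 1 * Real.exp (-|v|))) := by
  have hS : MeasurableSet {x : ℝ | K < |(x - a) / σ|} :=
    measurableSet_lt measurable_const (by fun_prop)
  have hD0 : 0 ≤ D := (densityRatio_nonneg h.nonneg n 0).trans (hD 0)
  have hi : Integrable (fun x => D / K / σ * (|(x - a) / σ| ^ 1 * f ((x - a) / σ))) :=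
    (((h.integrable_abs_pow_mul 1).comp_div hσ.ne').comp_sub_right a).const_mul _
  rw [(condMargin_eq h hp hc hσ hpf hn hpos).2 hn0, withDensity_apply _ hS]
  calc _ ≤ ∫⁻ x in {x : ℝ | K < |(x - a) / σ|},
          ENNReal.ofReal (D / K / σ * (|(x - a) / σ| ^ 1 * f ((x - a) / σ))) := by
        refine setLIntegral_mono' hS fun x hx => ENNReal.ofReal_le_ofReal ?_
        have hx' : K < |(x - a) / σ| := hx
        have h1 : 1 ≤ |(x - a) / σ| / K := by
          rw [one_le_div hK]
          exact hx'.le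
        have h2 : 0 ≤ f ((x - a) / σ) / σ := div_nonneg (h.nonneg _) hσ.le
        calc f ((x - a) / σ) / σ * densityRatio f n ((x - a) / σ)
            ≤ f ((x - a) / σ) / σ * (D * (|(x - a) / σ| / K)) := by
              gcongr
              exact (hD _).trans (le_mul_of_one_le_right hD0 h1)
          _ = _ := by ring
    _ ≤ ∫⁻ x, ENNReal.ofReal (D / K / σ * (|(x - a) / σ| ^ 1 * f ((x - a) / σ))) :=
        setLIntegral_le_lintegral _ _
    _ = ENNReal.ofReal (D / K * ∫ v, |v| ^ 1 * f v) := by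
        rw [← ofReal_integral_eq_lintegral_ofReal hi (ae_of_all _ fun x =>
          mul_nonneg (by positivity) (mul_nonneg (by positivity) (h.nonneg _))),
          integral_const_mul, integral_sub_right_eq_self
            (fun x => |x / σ| ^ 1 * f (x / σ)) a,
          Measure.integral_comp_div (fun v => |v| ^ 1 * f v) σ, abs_of_pos hσ, smul_eq_mul]
        congr 1
        field_simp
    _ ≤ _ := by
        gcongr
        exact h.integral_abs_pow_mul_le 1

end Margin

namespace LocalLimitArray

variable {C : ℝ} {f : ℕ → ℝ → ℝ}

theorem eventually_convPow_gt (h : LocalLimitArray C f) :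
    ∀ᶠ n : ℕ in atTop, 1 / 2 < √(n : ℝ) * convPow (f n) (n - 1) 0 :=
  h.tendsto_sqrt_mul_convPow.eventually (lt_mem_nhds (by norm_num))

theorem eventually_convPow_pos (h : LocalLimitArray C f) :
    ∀ᶠ n : ℕ in atTop, 0 < convPow (f n) (n - 1) 0 := by
  filter_upwards [h.eventually_convPow_gt] with n hn
  exact (pos_iff_pos_of_mul_pos (by linarith)).1
    (lt_of_le_of_ne (Real.sqrt_nonneg _) fun h0 => by rw [← h0, zero_mul] at hn; linarith)

/-- The density ratio is bounded, uniformly in the array. -/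
theorem exists_densityRatio_le (h : LocalLimitArray C f) :
    ∃ D : ℝ, ∀ᶠ n : ℕ in atTop, ∀ v, densityRatio (f n) n v ≤ D := by
  -- The bound for the `(n - 1)`-fold power is multiplied by `√n / √(n - 1) ≤ 2`, and the `n`-fold
  -- power in the denominator is at least `1 / (2 √n)`.
  obtain ⟨D, hD⟩ := h.succ.eventually_abs_convPow_le
  refine ⟨4 * D, ?_⟩
  have hD' : ∀ᶠ n : ℕ in atTop, ∀ w, √((n - 1 : ℕ) : ℝ) * |convPow (f n) (n - 2) w| ≤ D := by
    obtain ⟨N, hN⟩ := eventually_atTop.1 hD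
    filter_upwards [eventually_ge_atTop (N + 1)] with n hn w
    obtain ⟨k, rfl⟩ : ∃ k, n = k + 1 := ⟨n - 1, by omega⟩
    exact hN k (by omega) w
  filter_upwards [hD', h.eventually_convPow_gt, h.eventually_convPow_pos,
    eventually_ge_atTop 2] with n h1 h2 h3 hn v
  rw [densityRatio, div_le_iff₀ h3]
  have h4 := h1 (-v)
  have hs : √(n : ℝ) ≤ 2 * √((n - 1 : ℕ) : ℝ) := by
    rw [Real.sqrt_le_left (by positivity), mul_pow, Real.sq_sqrt (by positivity)]
    have : n ≤ 4 * (n - 1) := by omega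
    have h5 : (n : ℝ) ≤ ((4 * (n - 1) : ℕ) : ℝ) := by exact_mod_cast this
    push_cast at h5
    linarith
  have hs0 : 0 < √(n : ℝ) := Real.sqrt_pos.2 (by exact_mod_cast (by omega : 0 < n))
  have h6 : √(n : ℝ) * convPow (f n) (n - 2) (-v) ≤ 2 * D := by
    have := abs_nonneg (convPow (f n) (n - 2) (-v))
    calc √(n : ℝ) * convPow (f n) (n - 2) (-v) ≤ √(n : ℝ) * |convPow (f n) (n - 2) (-v)| := by
          gcongr
          exact le_abs_self _
      _ ≤ 2 * √((n - 1 : ℕ) : ℝ) * |convPow (f n) (n - 2) (-v)| := by gcongr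
      _ ≤ 2 * D := by linarith
  have hD0 : 0 ≤ D := le_trans (by positivity) h4
  refine le_of_mul_le_mul_left ?_ hs0
  nlinarith

/-- The density ratio is `1 + o(1 / √n)`, uniformly on bounded sets. -/
theorem eventually_abs_densityRatio_sub_one_le (h : LocalLimitArray C f) (K : ℝ) {δ : ℝ}
    (hδ : 0 < δ) :
    ∀ᶠ n : ℕ in atTop, ∀ v, |v| ≤ K → |densityRatio (f n) n v - 1| ≤ δ / √(n : ℝ) := by
  have hη := h.succ.eventually_abs_convPow_sub_le K (by positivity : 0 < δ / 4)
  have hη' : ∀ᶠ n : ℕ in atTop, ∀ w, |w| ≤ K →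
      ((n - 1 : ℕ) : ℝ) * |convPow (f n) (n - 2) w - convPow (f n) (n - 1) 0| ≤ δ / 4 := by
    obtain ⟨N, hN⟩ := eventually_atTop.1 hη
    filter_upwards [eventually_ge_atTop (N + 1)] with n hn w hw
    obtain ⟨k, rfl⟩ : ∃ k, n = k + 1 := ⟨n - 1, by omega⟩
    exact hN k (by omega) w hw
  filter_upwards [hη', h.eventually_convPow_gt, h.eventually_convPow_pos,
    eventually_ge_atTop 2] with n h1 h2 h3 hn v hv
  have h4 := h1 (-v) (by rwa [abs_neg])
  set G := convPow (f n) (n - 2) (-v)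
  set F := convPow (f n) (n - 1) 0 with hF
  have hs0 : 0 < √(n : ℝ) := Real.sqrt_pos.2 (by exact_mod_cast (by omega : 0 < n))
  have hsq : √(n : ℝ) * √(n : ℝ) = n := Real.mul_self_sqrt (by positivity)
  have h5 : (n : ℝ) ≤ 2 * ((n - 1 : ℕ) : ℝ) := by
    have : n ≤ 2 * (n - 1) := by omega
    exact_mod_cast this
  rw [densityRatio, ← hF, div_sub_one h3.ne', abs_div, abs_of_pos h3, div_le_div_iff₀ h3 hs0]
  have h6 : (n : ℝ) * |G - F| ≤ δ / 2 := by
    calc (n : ℝ) * |G - F| ≤ 2 * ((n - 1 : ℕ) : ℝ) * |G - F| := by gcongr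
      _ ≤ δ / 2 := by linarith
  have h7 : |G - F| * √(n : ℝ) * √(n : ℝ) ≤ δ * F * √(n : ℝ) := by
    rw [mul_assoc, hsq]
    nlinarith
  exact le_of_mul_le_mul_right h7 hs0

end LocalLimitArray

/-- The conclusion for a density whose standardized tilted versions form a local limit array. -/
theorem exists_relative_error {p : ℝ → ℝ} (hp : Measurable p) {C : ℝ} {f : ℕ → ℝ → ℝ}
    (hf : LocalLimitArray C f) (hfm : ∀ n, Measurable (f n)) {a c t σ : ℕ → ℝ}
    (hc : ∀ᶠ n in atTop, 0 < c n) (hσ : ∀ᶠ n in atTop, 0 < σ n)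
    (hpf : ∀ᶠ n in atTop, ∀ x, p x =
      c n * Real.exp (-(t n * x)) * f n ((x - a n) / σ n))
    (htilt : ∀ᶠ n in atTop, ∀ x, tiltedDensity p (a n) x = f n ((x - a n) / σ n) / σ n) :
    (∀ᶠ n : ℕ in atTop, IsProbabilityMeasure (condLaw p n (a n)) ∧
      ∀ hn : 0 < n, condMargin p n (a n) ⟨0, hn⟩ ≪ volume) ∧
    ∃ R : (n : ℕ) → (Fin n → ℝ) → ℝ,
      (∀ n, Measurable (R n)) ∧
      (∀ᶠ n : ℕ in atTop, ∀ hn : 0 < n, ∀ᵐ y ∂(condLaw p n (a n)),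
        condDensity p n (a n) ⟨0, hn⟩ (y ⟨0, hn⟩) =
          tiltedDensity p (a n) (y ⟨0, hn⟩) * (1 + R n y)) ∧
      ∀ δ : ℝ, 0 < δ →
        Tendsto (fun n : ℕ => condLaw p n (a n) {y | δ / √(n : ℝ) < |R n y|}) atTop (𝓝 0) := by
  have hpos := hf.eventually_convPow_pos
  set ρ : ℕ → ℝ → ℝ := fun n x => densityRatio (f n) n ((x - a n) / σ n) - 1 with hρ
  have hρm : ∀ n, Measurable (ρ n) := fun n => by
    have := measurable_densityRatio (hfm n) n
    fun_prop
  refine ⟨?_, fun n y => if hn : 0 < n then ρ n (y ⟨0, hn⟩) else 0, fun n => ?_, ?_, fun δ hδ => ?_⟩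
  · filter_upwards [hf.centered, hc, hσ, hpf, hpos, eventually_ge_atTop 2] with n h1 h2 h3 h4 h5 h6
    exact ⟨(condMargin_eq h1 hp h2 h3 h4 h6 h5).1, fun hn =>
      condMargin_absolutelyContinuous h1 hp h2 h3 h4 h6 h5 hn⟩
  · by_cases hn : 0 < n
    · simp only [hn, dite_true]
      exact (hρm n).comp (measurable_pi_apply _)
    · simp only [hn, dite_false]
      exact measurable_const
  · filter_upwards [hf.centered, hc, hσ, hpf, hpos, eventually_ge_atTop 2, htilt]
      with n h1 h2 h3 h4 h5 h6 h7 hn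
    filter_upwards [ae_condDensity_eq h1 hp h2 h3 h4 h6 h5 hn] with y hy
    simp only [hn, dite_true]
    rw [hy, h7, hρ, add_sub_cancel]
  · obtain ⟨D, hD⟩ := hf.exists_densityRatio_le
    set B := C * ∫ v : ℝ, |v| ^ 1 * Real.exp (-|v|) with hB
    have hlim : Tendsto (fun K : ℝ => ENNReal.ofReal (D / K * B)) atTop (𝓝 0) := by
      have h1 : Tendsto (fun K : ℝ => D / K * B) atTop (𝓝 0) := by
        simpa using (tendsto_const_nhds.div_atTop tendsto_id : Tendsto (fun K : ℝ => D / K) atTop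
          (𝓝 0)).mul_const B
      simpa using ENNReal.tendsto_ofReal h1
    refine ENNReal.tendsto_nhds_zero.2 fun e he => ?_
    -- By tightness the standardized first coordinate exceeds `K` with probability at most `e`; on
    -- the complement the relative error is uniformly small.
    obtain ⟨K, hK1, hK2⟩ := ((hlim.eventually (ge_mem_nhds he)).and
      (eventually_gt_atTop (0 : ℝ))).exists
    filter_upwards [hf.centered, hc, hσ, hpf, hpos, eventually_ge_atTop 2, hD,
      hf.eventually_abs_densityRatio_sub_one_le K hδ] with n h1 h2 h3 h4 h5 h6 h7 h8
    have hn : 0 < n := by omega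
    refine le_trans ?_ ((condMargin_tail_le h1 hp h2 h3 h4 h6 h5 hn h7 hK2).trans hK1)
    rw [condMargin, Measure.map_apply (measurable_pi_apply _)
      (measurableSet_lt measurable_const (by fun_prop))]
    refine measure_mono fun y hy => ?_
    simp only [hn, dite_true, mem_ofPred_eq] at hy
    simp only [mem_preimage, mem_ofPred_eq]
    by_contra hcon
    exact absurd hy (not_lt.2 (h8 _ (not_lt.1 hcon)))

end LightTail

/-! ### Relative error of the tilted density -/

theorem mainTheorem2
    (p g h q : ℝ → ℝ) (c : ℝ)
    -- `p` is a bounded probability density on `ℝ`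
    (hp_meas : Measurable p) (hp_nonneg : ∀ x, 0 ≤ p x)
    (hp_one : ∫⁻ x, ENNReal.ofReal (p x) = 1)
    (hp_bdd : ∃ M : ℝ, ∀ x, p x ≤ M)
    -- the moment generating function is finite in a neighbourhood of `0`
    (hp_mgf : (0 : ℝ) ∈ interior (integrableExpSet id (LightTail.law p)))
    -- the form of `p` on the positive half-line
    (hc : 0 < c)
    (hp_form : ∀ x, 0 < x → p x = c * Real.exp (-(g x - q x)))
    (hg_pos : ∀ x, 0 < x → 0 < g x)
    (hg_deriv : ∀ x, 0 < x → HasDerivAt g (h x) x)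
    (hg_lim : Tendsto (fun x => g x / x) atTop atTop)
    (hq : ∃ θ : ℝ, 0 < θ ∧ ∀ᶠ x in atTop, ∀ v, |v - x| < θ * x →
      |q v| ≤ 1 / Real.sqrt (x * h x))
    (hh : LightTail.ClassR h)
    -- the levels `a n` and their growth condition
    (a : ℕ → ℝ) (ha : Tendsto a atTop atTop)
    (ha_growth : Tendsto
      (fun n : ℕ => LightTail.genInv h (LightTail.tiltParam p (a n)) ^ 2 /
        Real.sqrt (n * deriv (LightTail.genInv h) (LightTail.tiltParam p (a n))))
      atTop (𝓝 0)) :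
    (∀ᶠ n : ℕ in atTop, IsProbabilityMeasure (LightTail.condLaw p n (a n)) ∧
      ∀ hn : 0 < n, LightTail.condMargin p n (a n) ⟨0, hn⟩ ≪ volume) ∧
    ∃ R : (n : ℕ) → (Fin n → ℝ) → ℝ,
      (∀ n, Measurable (R n)) ∧
      (∀ᶠ n : ℕ in atTop, ∀ hn : 0 < n, ∀ᵐ y ∂(LightTail.condLaw p n (a n)),
        LightTail.condDensity p n (a n) ⟨0, hn⟩ (y ⟨0, hn⟩) =
          LightTail.tiltedDensity p (a n) (y ⟨0, hn⟩) * (1 + R n y)) ∧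
      ∀ δ : ℝ, 0 < δ →
        Tendsto (fun n : ℕ => LightTail.condLaw p n (a n) {y | δ / Real.sqrt n < |R n y|})
          atTop (𝓝 0) := by
  -- a threshold from which `h` is monotone
  obtain ⟨A₀, hA₀, hmono₀⟩ : ∃ A, 0 < A ∧ MonotoneOn h (Ici A) := by
    rcases hh with ⟨β, hβ, hβh⟩ | hinf
    · exact hβh.exists_monotoneOn hβ
    · exact ⟨1, one_pos, hinf.1.monotoneOn.mono fun x hx =>
        mem_Ioi.2 (one_pos.trans_le (mem_Ici.1 hx))⟩
  have hlim : Tendsto h atTop atTop :=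
    LightTail.tendsto_atTop_of_monotoneOn_deriv hA₀ hmono₀ hg_deriv hg_lim
  obtain ⟨b, σ, hS⟩ : ∃ b σ, LightTail.LaplaceScale h b σ := by
    rcases hh with ⟨β, hβ, hβh⟩ | hinf
    · exact hβh.exists_laplaceScale hβ hlim
    · exact hinf.exists_laplaceScale hlim
  -- the perturbation vanishes at infinity: take `v = x` in its bound
  have hq0 : Tendsto q atTop (𝓝 0) := by
    obtain ⟨θ, hθ, hqθ⟩ := hq
    have h1 : Tendsto (fun x => 1 / √(x * h x)) atTop (𝓝 0) :=
      tendsto_const_nhds.div_atTop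
        (Real.tendsto_sqrt_atTop.comp (tendsto_id.atTop_mul_atTop₀ hlim))
    refine squeeze_zero_norm' ?_ h1
    filter_upwards [hqθ, eventually_gt_atTop 0] with x hx hx0
    exact hx x (by rw [sub_self, abs_zero]; positivity)
  obtain ⟨A₁, hA₁⟩ := eventually_atTop.1 (hq0.eventually (ge_mem_nhds one_pos))
  have H : LightTail.TailDensity p g h q c (max A₀ A₁) :=
    ⟨hp_meas, hp_nonneg, hp_bdd, hc, hp_form, hg_deriv, hq0, hA₀.trans_le (le_max_left _ _),
      hmono₀.mono (Ici_subset_Ici.2 (le_max_left _ _))⟩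
  obtain ⟨C, hG⟩ := H.exists_gaussianLimit (fun x hx => hA₁ x ((le_max_right _ _).trans hx)) hS
  obtain ⟨⟨T₀, hT₀⟩, hmean, hmean_top⟩ := H.eventually_tiltMean hS hG
  obtain ⟨hsolve, htop⟩ := LightTail.tendsto_tiltParam hT₀ hmean_top
  set t : ℕ → ℝ := fun n => LightTail.tiltParam p (a n) with ht
  have htt : Tendsto t atTop atTop := htop.comp ha
  have hGn := hG.comp htt
  -- `a n` is the mean of the tilted law, so the standardization around `a n` is the centred one
  have han : ∀ᶠ n in atTop, a n = b (t n) + σ (t n) *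
      LightTail.meanOf (LightTail.rescaled p g c (t n) (b (t n)) (σ (t n))) := by
    filter_upwards [ha.eventually hsolve, htt.eventually hmean] with n h1 h2
    rw [← h2, ht, h1]
  have hmgf : ∀ᶠ n in atTop, 0 < mgf id (LightTail.law p) (t n) := by
    filter_upwards [htt.eventually hS.pos, hGn.eventually_half_lt_integral] with n h1 h2
    rw [LightTail.mgf_law_eq hp_meas hp_nonneg hc.ne' h1 (b := b (t n)) (g := g)]
    have : 0 < ∫ v, LightTail.rescaled p g c (t n) (b (t n)) (σ (t n)) v := by linarith
    positivity
  have hpf : ∀ᶠ n in atTop, ∀ x, p x = mgf id (LightTail.law p) (t n) / σ (t n) *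
      Real.exp (-(t n * x)) *
      LightTail.centerOf (LightTail.rescaled p g c (t n) (b (t n)) (σ (t n)))
        ((x - a n) / σ (t n)) := by
    filter_upwards [han, htt.eventually hS.pos, hGn.eventually_half_lt_integral] with n h1 h2 h3 x
    exact LightTail.eq_mul_centerOf hp_meas hp_nonneg hc.ne' h2 (by linarith) h1 x
  refine LightTail.exists_relative_error hp_meas hGn.localLimitArray (fun n => ?_)
    (c := fun n => mgf id (LightTail.law p) (t n) / σ (t n)) (t := t) (σ := fun n => σ (t n))
    ?_ (htt.eventually hS.pos) hpf ?_
  · exact LightTail.measurable_centerOf (hGn.measurable n)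
  · filter_upwards [hmgf, htt.eventually hS.pos] with n h1 h2
    positivity
  · filter_upwards [hmgf, htt.eventually hS.pos, hpf] with n h1 h2 h3 x
    rw [LightTail.tiltedDensity, h3 x]
    have h4 : Real.exp (t n * x) * Real.exp (-(t n * x)) = 1 := by
      rw [← Real.exp_add, add_neg_cancel, Real.exp_zero]
    change Real.exp (t n * x) / mgf id (LightTail.law p) (t n) * _ = _
    rw [← one_mul (LightTail.centerOf _ _ / _), ← h4]
    field_simp
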